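/- Obstacles appear on the road $\mathbb R$ at space-time points $(x_j,t_j)$, $j\in\mathbb N$, which form a Poisson point field on $\mathbb R\times[0,\infty)$ with intensity $\lambda\,dx\,dt$, $\lambda>0$. Obstacle $j$ is present at the point $x_j$ during $[t_j,t_j+\tau_j)$; the lifetimes $\tau_j\ge 0$ are i.i.d. with law $Q$ (distribution function $Q(t)$), $m_Q=E\tau_j>0$ and $E\tau_j^2<\infty$. The time that the car needs to bypass obstacle $j$ is $\eta_j$; the $\eta_j$ are i.i.d. with law $F$ on $[0,\infty]$ (the value $\infty$ means that bypassing is prohibited). The sequences $(x_j,t_j)_j$, $(\tau_j)_j$ and $(\eta_j)_j$ are independent of each other. A car enters the road at a point $x_0\in\mathbb R$ at a moment $t_0\ge 0$ and moves to the right with constant speed $v>0$, except that at an obstacle which is present when the car reaches it the car stops until either the bypass time has elapsed or the obstacle has disappeared, whichever comes first. That is, the time $T(x)$ in which the car passes the distance $x$ satisfies, for all $x\ge 0$, $$T(x)=\frac xv+\sum_{j:\ x_0\le x_j<x_0+x}\delta_j,\qquad \delta_j=\begin{cases}\min(\eta_j,\;t_j+\tau_j-s_j) & \text{if } t_j\le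 s_j<t_j+\tau_j,\\ 0&\text{otherwise,}\end{cases}\qquad s_j=t_0+T(x_j-x_0).$$ Let $b=\lambda m_Q$ and $a=E\min(\eta,\zeta)$, where $\eta$ and $\zeta$ are independent, $\eta$ has law $F$, and $\zeta$ has density $h(t)=(1-Q(t))/m_Q$ on $[0,\infty)$. Then, with probability $1$, there is exactly one finite function $T$ on $[0,\infty)$ satisfying these equations, and $$\frac{x}{T(x)}\to\frac{v}{1+abv}\qquad\text{as } x\to\infty .$$ -/

import Mathlib

open MeasureTheory ProbabilityTheory Set Filter Topology
open scoped ENNReal NNReal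

namespace RoadObstacles

noncomputable section

/-- The number of points of the random sequence `Z` that lie in `B`. -/
def pointCount {Ω E : Type*} (Z : ℕ → Ω → E) (B : Set E) (ω : Ω) : ℝ≥0∞ :=
  ∑' j, B.indicator (fun _ => (1 : ℝ≥0∞)) (Z j ω)

/-- The points `Z 0, Z 1, …` form (an enumeration, in any order, of) a Poisson point field with
intensity measure `μ`: the number of points in a set `B` of finite intensity is Poisson distributed
with parameter `μ B`, and the numbers of points in disjoint sets are independent. -/
structure IsPoissonField {Ω E : Type*} [MeasurableSpace Ω] [MeasurableSpace E]
    (P : Measure Ω) (μ : Measure E) (Z : ℕ → Ω → E) : Prop where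
  measurable : ∀ j, Measurable (Z j)
  hasLaw_count : ∀ B : Set E, MeasurableSet B → μ B ≠ ∞ →
    HasLaw (pointCount Z B)
      ((poissonMeasure (μ B).toNNReal).map (fun n : ℕ => (n : ℝ≥0∞))) P
  iIndepFun_count : ∀ (n : ℕ) (B : Fin n → Set E), (∀ i, MeasurableSet (B i)) →
    Pairwise (fun i k => Disjoint (B i) (B k)) →
    iIndepFun (fun i => pointCount Z (B i)) P

/-- The intensity `lam dx dt` on the space-time half-plane `ℝ × [0, ∞)`, as a measure on the plane
of pairs (coordinate, time). -/
def spaceTimeIntensity (lam : ℝ) : Measure (ℝ × ℝ) :=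
  ENNReal.ofReal lam • (volume : Measure (ℝ × ℝ)).restrict (univ ×ˢ Ici (0 : ℝ))

/-- The time that a car loses at an obstacle which it reaches at the moment `s`, if the obstacle
appears at the moment `t`, stays for the time `τ`, and can be bypassed by the car in the time `η`.
If the obstacle is present at the moment `s`, the car waits until it has bypassed the obstacle or
the obstacle has disappeared, whichever is first; otherwise it loses no time.
The value `η = ∞` means that the obstacle cannot be bypassed. -/
def delay (t τ : ℝ) (η : ℝ≥0∞) (s : ℝ) : ℝ :=
  open Classical in
  if t ≤ s ∧ s < t + τ then (min η (ENNReal.ofReal (t + τ - s))).toReal else 0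

/-- `T d` is the time that a car needs to pass the distance `d`, for every `d ≥ 0`, if it enters the
road at the point `x₀` at the moment `t₀` and moves to the right with speed `v` except while it is
delayed by obstacles. Obstacle number `j` has coordinate `x j`, moment of appearance `t j`,
lifetime `τ j` and bypass time `η j`; the car reaches it at the moment `t₀ + T (x j - x₀)`.
The requirement is that `T d - d / v`, the idle time of the car, is the sum of its delays at the
obstacles that are located in `[x₀, x₀ + d)`. -/
def IsPassageTime (v x₀ t₀ : ℝ) (x t τ : ℕ → ℝ) (η : ℕ → ℝ≥0∞) (T : ℝ → ℝ) : Prop :=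
  ∀ d : ℝ, 0 ≤ d →
    HasSum
      ({j : ℕ | x j ∈ Ico x₀ (x₀ + d)}.indicator
        (fun j => delay (t j) (τ j) (η j) (t₀ + T (x j - x₀))))
      (T d - d / v)

/-- The mean `m_Q` of a law `Q` on `ℝ`. -/
def mean (Q : Measure ℝ) : ℝ := ∫ t, t ∂Q

/-- The law on `[0, ∞)` with density `h(t) = (1 - Q(t)) / m_Q`, where `Q(t)` is the distribution
function of the law `Q`. -/
def residualLaw (Q : Measure ℝ) : Measure ℝ :=
  ((volume : Measure ℝ).restrict (Ici 0)).withDensity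
    (fun t => ENNReal.ofReal ((1 - cdf Q t) / mean Q))

/-- The mean `E min(η, ζ)`, where `η` and `ζ` are independent, `η` has law `F` and `ζ` has the
residual lifetime law of `Q`. -/
def meanDelay (Q : Measure ℝ) (F : Measure ℝ≥0∞) : ℝ :=
  ∫ p : ℝ≥0∞ × ℝ, (min p.1 (ENNReal.ofReal p.2)).toReal ∂(F.prod (residualLaw Q))

end

end RoadObstacles

/-! Take away the time of motion and put W(y) = t₀ + T(y) - y/v. This clock starts from t₀ and moves
only by the delays, and the car reaches the distance y at the moment s = W(y) + y/v. The value W(y)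
depends only on obstacles before y, and the field is independent over disjoint strips of positions,
so the obstacles met next are independent of the current state. If r = t + τ - s is the residual
lifetime on arrival, the delay is min(η, r), and the mean delay per unit length is λ times the
integral of min(η, r) over 0 < r ≤ τ and age τ - r ≤ s (`lintegral_jump`). Without the age condition
this equals λ m_Q E min(η, ζ) = ab (`ofReal_meanDelay`). The condition only lowers it, and its
effect vanishes since s ≥ y/v → ∞. A strong law gives (W(y) - t₀)/y → ab, hence T(d)/d → ab + 1/v.

The clock is handled through grids of positions. Within a cell the state is frozen, so a cell sum is
a function of the past and of an independent field (`lintegral_past_cellSum`); centered sums then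
have additive second moments. Only finitely many obstacles can act before the clock passes a given
value. A fine grid separates them, and from then on the grid clock agrees with the true one. Bounded
first moments exclude explosion, which gives existence and uniqueness (`exists_clock`,
`isClock_unique`).

Delays have a finite mean intensity, but possibly an infinite second moment. The strong law is
therefore proved in Etemadi's way: truncation at the level m for the distance m, summation along m =
⌊c ^ i⌋ (`tsum_defect_le`, `ae_tendsto_deviation`), the pathwise estimate `idle_bounds`, and
interpolation by monotonicity as c ↓ 1.

Of the Poisson property only the mean measure, the simplicity of the positions and the independence
of void events over disjoint strips are needed. These survive independent marking
(`SimpleField.marked`), which attaches the lifetimes and then the bypass times. -/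

namespace RoadObstacles

/-! ### Sequences of points with distinct positions -/

section Separation

/-- Finitely many distinct reals are separated by every sufficiently fine uniform grid. -/
lemma eventually_injOn_floor {ι : Type*} (y : ι → ℝ) (J : Finset ι) (hy : InjOn y J) :
    ∀ᶠ n : ℕ in atTop, InjOn (fun j => ⌊((n : ℝ) + 1) * y j⌋) J := by
  have key : ∀ i ∈ J, ∀ j ∈ J, ∀ᶠ n : ℕ in atTop,
      ⌊((n : ℝ) + 1) * y i⌋ = ⌊((n : ℝ) + 1) * y j⌋ → i = j := by
    intro i hi j hj
    by_cases hij : i = j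
    · exact Eventually.of_forall fun _ _ => hij
    have hne : 0 < |y i - y j| := abs_pos.2 (sub_ne_zero.2 fun h => hij (hy hi hj h))
    obtain ⟨N, hN⟩ := exists_nat_gt (1 / |y i - y j|)
    filter_upwards [eventually_ge_atTop N] with n hn h
    exfalso
    have h1 := Int.abs_sub_lt_one_of_floor_eq_floor h
    have hn0 : (0 : ℝ) ≤ n := n.cast_nonneg
    rw [← mul_sub, abs_mul, abs_of_pos (by linarith : (0 : ℝ) < n + 1)] at h1
    rw [div_lt_iff₀ hne] at hN
    have : (N : ℝ) ≤ n := by exact_mod_cast hn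
    nlinarith
  have := (Finset.eventually_all J (l := atTop)).2
    (fun i hi => (Finset.eventually_all J).2 (fun j hj => key i hi j hj))
  filter_upwards [this] with n hn i hi j hj h using hn i hi j hj h

end Separation

/-! ### Counts and sums over points as functions of void events -/

section Counting

variable {Ω E : Type*}

/-- The event that none of the points lies in `B`. -/
def void (p : ℕ → Ω → E) (B : Set E) : Set Ω := {ω | ∀ j, p j ω ∉ B}

lemma void_union (p : ℕ → Ω → E) (B C : Set E) : void p (B ∪ C) = void p B ∩ void p C := by
  ext ω
  simp [void, forall_and]

lemma measurableSet_void [MeasurableSpace Ω] [MeasurableSpace E] {p : ℕ → Ω → E}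
    (hp : ∀ j, Measurable (p j)) {B : Set E} (hB : MeasurableSet B) :
    MeasurableSet (void p B) := by
  have : void p B = ⋂ j, (p j ⁻¹' B)ᶜ := by ext; simp [void]
  rw [this]
  exact MeasurableSet.iInter fun j => ((hp j) hB).compl

/-- For points with distinct positions, the number of points in a set is the supremum, over finer
and finer partitions of the line of positions, of the number of non-empty cells. -/
lemma pointCount_eq_iSup {X : E → ℝ} {p : ℕ → Ω → E} {ω : Ω}
    (hinj : Function.Injective fun j => X (p j ω)) (B : Set E) :
    pointCount p B ω = ⨆ n : ℕ, ∑' i : ℤ, (void p (B ∩ {e | ⌊((n : ℝ) + 1) * X e⌋ = i}))ᶜ.indicator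
      (fun _ => (1 : ℝ≥0∞)) ω := by
  classical
  apply le_antisymm
  · rw [pointCount, ENNReal.tsum_eq_iSup_sum]
    refine iSup_le fun J => ?_
    obtain ⟨n, hn⟩ := (eventually_injOn_floor (fun j => X (p j ω)) J hinj.injOn).exists
    refine le_trans ?_ (le_iSup _ n)
    have h1 : ∑ j ∈ J, B.indicator (fun _ => (1 : ℝ≥0∞)) (p j ω)
        = ((J.filter fun j => p j ω ∈ B).card : ℝ≥0∞) := by
      simp [Set.indicator_apply]
    have h2 : (J.filter fun j => p j ω ∈ B).card
        = ((J.filter fun j => p j ω ∈ B).image fun j => ⌊((n : ℝ) + 1) * X (p j ω)⌋).card := by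
      rw [Finset.card_image_of_injOn]
      exact hn.mono fun i hi => (Finset.mem_filter.1 hi).1
    rw [h1, h2, Finset.card_eq_sum_ones, Nat.cast_sum]
    refine le_trans (Finset.sum_le_sum fun i hi => ?_) (ENNReal.sum_le_tsum _)
    simp only [Finset.mem_image, Finset.mem_filter] at hi
    obtain ⟨j, ⟨_, hj⟩, rfl⟩ := hi
    rw [Set.indicator_of_mem]
    · simp
    · simp only [void, mem_compl_iff, mem_ofPred_eq, not_forall, not_not]
      exact ⟨j, hj, rfl⟩
  · refine iSup_le fun n => ?_
    have h1 : pointCount p B ω = ∑' i : ℤ, ∑' j, (B ∩ {e | ⌊((n : ℝ) + 1) * X e⌋ = i}).indicator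
        (fun _ => (1 : ℝ≥0∞)) (p j ω) := by
      rw [ENNReal.tsum_comm, pointCount]
      congr 1 with j
      rw [tsum_eq_single ⌊((n : ℝ) + 1) * X (p j ω)⌋]
      · simp [Set.indicator_apply]
      · intro i hi
        rw [Set.indicator_of_notMem]
        rintro ⟨_, h⟩
        exact hi h.symm
    rw [h1]
    refine ENNReal.tsum_le_tsum fun i => ?_
    by_cases h : ω ∈ void p (B ∩ {e | ⌊((n : ℝ) + 1) * X e⌋ = i})
    · simp [h]
    · rw [Set.indicator_of_mem (by exact h)]
      simp only [void, mem_ofPred_eq, not_forall, not_not] at h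
      obtain ⟨j, hj⟩ := h
      refine le_trans ?_ (ENNReal.le_tsum j)
      rw [Set.indicator_of_mem hj]

/-- If all counts in `A` are measurable and the configuration is locally finite, then sums over the
points in `A` are jointly measurable in the configuration and a parameter. -/
lemma measurable_tsum_indicator_uncurry {S : Type*} [MeasurableSpace Ω] [MeasurableSpace E]
    [MeasurableSpace S] {p : ℕ → Ω → E} {A : Set E} (hA : MeasurableSet A)
    (hcount : ∀ B ⊆ A, MeasurableSet B → Measurable (pointCount p B))
    {level : E → ℕ} (hlevel : Measurable level)
    (hfin : ∀ ω i, {j | level (p j ω) = i}.Finite)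
    {f : E × S → ℝ≥0∞} (hf : Measurable f) :
    Measurable fun q : Ω × S => ∑' j, A.indicator (fun e => f (e, q.2)) (p j q.1) := by
  have hL : ∀ i, MeasurableSet (level ⁻¹' {i}) := fun i => hlevel (measurableSet_singleton i)
  have step1 : ∀ i, ∀ D : Set (E × S), MeasurableSet D → Measurable fun q : Ω × S =>
      ∑' j, (A ∩ level ⁻¹' {i}).indicator (fun e => D.indicator (fun _ => (1 : ℝ≥0∞)) (e, q.2))
        (p j q.1) := by
    intro i D hD
    refine MeasurableSpace.induction_on_inter (C := fun D _ => Measurable fun q : Ω × S =>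
      ∑' j, (A ∩ level ⁻¹' {i}).indicator (fun e => D.indicator (fun _ => (1 : ℝ≥0∞)) (e, q.2))
        (p j q.1)) generateFrom_prod.symm isPiSystem_prod ?_ ?_ ?_ ?_ D hD
    · simp
    · rintro _ ⟨B, hB, C, hC, rfl⟩
      have : (fun q : Ω × S => ∑' j, (A ∩ level ⁻¹' {i}).indicator
            (fun e => (B ×ˢ C).indicator (fun _ => (1 : ℝ≥0∞)) (e, q.2)) (p j q.1))
          = fun q => pointCount p (A ∩ level ⁻¹' {i} ∩ B) q.1 * C.indicator (fun _ => 1) q.2 := by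
        ext q
        rw [pointCount, ← ENNReal.tsum_mul_right]
        congr 1 with j
        by_cases h1 : p j q.1 ∈ A ∩ level ⁻¹' {i}
        · by_cases h2 : p j q.1 ∈ B
          · rw [Set.indicator_of_mem h1, Set.indicator_of_mem (mem_inter h1 h2), one_mul]
            by_cases h3 : q.2 ∈ C <;> simp [h2, h3]
          · rw [Set.indicator_of_mem h1,
              Set.indicator_of_notMem (fun h => h2 h.2 : p j q.1 ∉ _ ∩ B), zero_mul]
            simp [h2]
        · rw [Set.indicator_of_notMem h1,
            Set.indicator_of_notMem (fun h => h1 h.1 : p j q.1 ∉ _ ∩ B), zero_mul]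
      rw [this]
      refine Measurable.mul ((hcount _ ?_ ?_).comp measurable_fst)
        ((measurable_const.indicator hC).comp measurable_snd)
      · exact inter_subset_left.trans inter_subset_left
      · exact (hA.inter (hL i)).inter hB
    -- Complements are treated by subtraction from the total count, which is legitimate because a
    -- single level holds only finitely many points.
    · intro D hD ih
      have : (fun q : Ω × S => ∑' j, (A ∩ level ⁻¹' {i}).indicator
            (fun e => Dᶜ.indicator (fun _ => (1 : ℝ≥0∞)) (e, q.2)) (p j q.1))
          = fun q => pointCount p (A ∩ level ⁻¹' {i}) q.1 - ∑' j, (A ∩ level ⁻¹' {i}).indicator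
            (fun e => D.indicator (fun _ => (1 : ℝ≥0∞)) (e, q.2)) (p j q.1) := by
        ext q
        have hadd : pointCount p (A ∩ level ⁻¹' {i}) q.1 = (∑' j, (A ∩ level ⁻¹' {i}).indicator
            (fun e => Dᶜ.indicator (fun _ => (1 : ℝ≥0∞)) (e, q.2)) (p j q.1))
            + ∑' j, (A ∩ level ⁻¹' {i}).indicator
            (fun e => D.indicator (fun _ => (1 : ℝ≥0∞)) (e, q.2)) (p j q.1) := by
          rw [← ENNReal.tsum_add, pointCount]
          congr 1 with j
          by_cases h1 : p j q.1 ∈ A ∩ level ⁻¹' {i} <;> by_cases h2 : (p j q.1, q.2) ∈ D <;>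
            simp [h1, h2]
        rw [hadd, ENNReal.add_sub_cancel_right]
        refine ne_of_lt (lt_of_le_of_lt (b := pointCount p (level ⁻¹' {i}) q.1) ?_ ?_)
        · refine ENNReal.tsum_le_tsum fun j => ?_
          by_cases h1 : p j q.1 ∈ A ∩ level ⁻¹' {i}
          · have h2 : p j q.1 ∈ level ⁻¹' {i} := h1.2
            rw [Set.indicator_of_mem h1, Set.indicator_of_mem h2]
            exact Set.indicator_le_self _ _ _
          · simp [Set.indicator_of_notMem h1]
        · rw [pointCount, tsum_eq_sum (s := (hfin q.1 i).toFinset)]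
          · refine ENNReal.sum_lt_top.2 fun j _ => lt_of_le_of_lt (Set.indicator_le_self _ _ _) ?_
            simp
          · intro j hj
            rw [Set.indicator_of_notMem]
            simpa using hj
      rw [this]
      exact ((hcount _ inter_subset_left (hA.inter (hL i))).comp measurable_fst).sub ih
    · intro D hdisj hD ih
      have : (fun q : Ω × S => ∑' j, (A ∩ level ⁻¹' {i}).indicator
            (fun e => (⋃ k, D k).indicator (fun _ => (1 : ℝ≥0∞)) (e, q.2)) (p j q.1))
          = fun q => ∑' k, ∑' j, (A ∩ level ⁻¹' {i}).indicator
            (fun e => (D k).indicator (fun _ => (1 : ℝ≥0∞)) (e, q.2)) (p j q.1) := by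
        ext q
        rw [ENNReal.tsum_comm]
        congr 1 with j
        by_cases h1 : p j q.1 ∈ A ∩ level ⁻¹' {i}
        · simp only [Set.indicator_of_mem h1]
          by_cases h2 : ∃ k, (p j q.1, q.2) ∈ D k
          · obtain ⟨k, hk⟩ := h2
            rw [Set.indicator_of_mem (mem_iUnion.2 ⟨k, hk⟩), tsum_eq_single k,
              Set.indicator_of_mem hk]
            intro l hl
            exact Set.indicator_of_notMem (fun h => (hdisj hl).le_bot ⟨h, hk⟩) _
          · rw [Set.indicator_of_notMem (by simpa using h2)]
            simp only [not_exists] at h2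
            simp [h2]
        · simp [Set.indicator_of_notMem h1]
      rw [this]
      exact Measurable.tsum ih
  have step2 : ∀ D : Set (E × S), MeasurableSet D → Measurable fun q : Ω × S =>
      ∑' j, A.indicator (fun e => D.indicator (fun _ => (1 : ℝ≥0∞)) (e, q.2)) (p j q.1) := by
    intro D hD
    have : (fun q : Ω × S => ∑' j, A.indicator (fun e => D.indicator (fun _ => (1 : ℝ≥0∞))
          (e, q.2)) (p j q.1)) = fun q => ∑' i, ∑' j, (A ∩ level ⁻¹' {i}).indicator
            (fun e => D.indicator (fun _ => (1 : ℝ≥0∞)) (e, q.2)) (p j q.1) := by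
      ext q
      rw [ENNReal.tsum_comm]
      congr 1 with j
      rw [tsum_eq_single (level (p j q.1))]
      · by_cases h : p j q.1 ∈ A
        · have h' : p j q.1 ∈ A ∩ level ⁻¹' {level (p j q.1)} := ⟨h, rfl⟩
          rw [Set.indicator_of_mem h, Set.indicator_of_mem h']
        · rw [Set.indicator_of_notMem h, Set.indicator_of_notMem (fun h' => h h'.1)]
      · intro i hi
        exact Set.indicator_of_notMem (fun h => hi h.2.symm) _
    rw [this]
    exact Measurable.tsum fun i => step1 i D hD
  refine Measurable.ennreal_induction (motive := fun f => Measurable fun q : Ω × S =>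
    ∑' j, A.indicator (fun e => f (e, q.2)) (p j q.1)) ?_ ?_ ?_ hf
  · intro c D hD
    have : (fun q : Ω × S => ∑' j, A.indicator (fun e => D.indicator (fun _ => c)
          (e, q.2)) (p j q.1)) = fun q => c * ∑' j, A.indicator
            (fun e => D.indicator (fun _ => (1 : ℝ≥0∞)) (e, q.2)) (p j q.1) := by
      ext q
      rw [← ENNReal.tsum_mul_left]
      congr 1 with j
      by_cases h1 : p j q.1 ∈ A <;> by_cases h2 : (p j q.1, q.2) ∈ D <;>
        simp [h1, h2]
    rw [this]
    exact (step2 D hD).const_mul c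
  · intro g h _ _ _ ihg ihh
    have : (fun q : Ω × S => ∑' j, A.indicator (fun e => (g + h) (e, q.2)) (p j q.1))
        = fun q => (∑' j, A.indicator (fun e => g (e, q.2)) (p j q.1))
          + ∑' j, A.indicator (fun e => h (e, q.2)) (p j q.1) := by
      ext q
      rw [← ENNReal.tsum_add]
      congr 1 with j
      by_cases h1 : p j q.1 ∈ A <;> simp [h1]
    rw [this]
    exact ihg.add ihh
  · intro g _ hmono ih
    have : (fun q : Ω × S => ∑' j, A.indicator (fun e => ⨆ n, g n (e, q.2)) (p j q.1))
        = fun q => ⨆ n, ∑' j, A.indicator (fun e => g n (e, q.2)) (p j q.1) := by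
      ext q
      simp only [← lintegral_count (α := ℕ)]
      rw [← lintegral_iSup (fun n => measurable_of_countable _)]
      · congr 1 with j
        by_cases h1 : p j q.1 ∈ A <;> simp [h1]
      · intro m n hmn j
        exact Set.indicator_le_indicator (hmono hmn _)
    rw [this]
    exact Measurable.iSup ih

/-- The σ-algebra generated by the events that there is no point in `B`, for `B ⊆ A`. -/
@[reducible]
def voidSigma [MeasurableSpace E] (p : ℕ → Ω → E) (A : Set E) : MeasurableSpace Ω :=
  MeasurableSpace.generateFrom {G | ∃ B ⊆ A, MeasurableSet B ∧ G = void p B}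

lemma measurableSet_voidSigma [MeasurableSpace E] (p : ℕ → Ω → E) {A B : Set E} (hBA : B ⊆ A)
    (hB : MeasurableSet B) : MeasurableSet[voidSigma p A] (void p B) :=
  MeasurableSpace.measurableSet_generateFrom ⟨B, hBA, hB, rfl⟩

lemma voidSigma_le [MeasurableSpace Ω] [MeasurableSpace E] {p : ℕ → Ω → E}
    (hp : ∀ j, Measurable (p j)) (A : Set E) : voidSigma p A ≤ ‹MeasurableSpace Ω› := by
  refine MeasurableSpace.generateFrom_le ?_
  rintro _ ⟨B, -, hB, rfl⟩
  exact measurableSet_void hp hB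

lemma voidSigma_mono [MeasurableSpace E] (p : ℕ → Ω → E) {A A' : Set E} (h : A ⊆ A') :
    voidSigma p A ≤ voidSigma p A' := by
  refine MeasurableSpace.generateFrom_mono ?_
  rintro _ ⟨B, hBA, hB, rfl⟩
  exact ⟨B, hBA.trans h, hB, rfl⟩

/-- Unions of sets turn into intersections of void events, so independence needs to be checked on
void events only. -/
lemma isPiSystem_void [MeasurableSpace E] (p : ℕ → Ω → E) (A : Set E) :
    IsPiSystem {G | ∃ B ⊆ A, MeasurableSet B ∧ G = void p B} := by
  rintro _ ⟨B, hBA, hB, rfl⟩ _ ⟨C, hCA, hC, rfl⟩ _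
  exact ⟨B ∪ C, union_subset hBA hCA, hB.union hC, (void_union p B C).symm⟩

/-- Since positions are distinct, counting non-empty cells of finer and finer grids recovers the
count; void events thus carry all the information about the field. -/
lemma measurable_pointCount_voidSigma [MeasurableSpace E] {X : E → ℝ} (hX : Measurable X)
    {p : ℕ → Ω → E} (hinj : ∀ ω, Function.Injective fun j => X (p j ω))
    {A B : Set E} (hBA : B ⊆ A) (hB : MeasurableSet B) :
    Measurable[voidSigma p A] (pointCount p B) := by
  let _ := voidSigma p A
  have : pointCount p B = fun ω => ⨆ n : ℕ, ∑' i : ℤ,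
      (void p (B ∩ {e | ⌊((n : ℝ) + 1) * X e⌋ = i}))ᶜ.indicator (fun _ => (1 : ℝ≥0∞)) ω := by
    ext ω
    exact pointCount_eq_iSup (hinj ω) B
  rw [this]
  refine Measurable.iSup fun n => Measurable.tsum fun i => measurable_const.indicator ?_
  refine (measurableSet_voidSigma p (inter_subset_left.trans hBA) (hB.inter ?_)).compl
  exact (Int.measurable_floor.comp (hX.const_mul _)) (measurableSet_singleton i)

end Counting

end RoadObstacles

/-! ### Simple fields, decoupling and second moments -/

namespace RoadObstacles

/-- A locally finite random sequence of points with distinct positions and mean measure `μ`, such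
that the absences of points over disjoint sets of positions are independent. -/
structure SimpleField {Ω E : Type*} [MeasurableSpace Ω] [MeasurableSpace E]
    (P : Measure Ω) (X : E → ℝ) (level : E → ℕ) (μ : Measure E) (p : ℕ → Ω → E) : Prop where
  measurable : ∀ j, Measurable (p j)
  measurable_pos : Measurable X
  measurable_level : Measurable level
  injective : ∀ ω, Function.Injective fun j => X (p j ω)
  finite_level : ∀ ω i, {j | level (p j ω) = i}.Finite
  void_indep : ∀ I I' : Set ℝ, MeasurableSet I → MeasurableSet I' → Disjoint I I' →
    ∀ B B' : Set E, MeasurableSet B → MeasurableSet B' → B ⊆ X ⁻¹' I → B' ⊆ X ⁻¹' I' →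
      P (void p B ∩ void p B') = P (void p B) * P (void p B')
  intensity : Measure.sum (fun j => P.map (p j)) = μ

section Decoupling

variable {Ω : Type*}

lemma lintegral_eq_of_indepFun {S T : Type*} [MeasurableSpace Ω] [MeasurableSpace S]
    [MeasurableSpace T] {P : Measure Ω} [IsProbabilityMeasure P] {Y : Ω → S} {Z : Ω → T}
    (hY : Measurable Y) (hZ : Measurable Z) (h : IndepFun Y Z P) {Ψ : S × T → ℝ≥0∞}
    (hΨ : Measurable Ψ) :
    ∫⁻ ω, Ψ (Y ω, Z ω) ∂P = ∫⁻ ω, ∫⁻ ω', Ψ (Y ω, Z ω') ∂P ∂P := by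
  have h1 := (indepFun_iff_map_prod_eq_prod_map_map hY.aemeasurable hZ.aemeasurable).1 h
  have : IsProbabilityMeasure (P.map Z) := Measure.isProbabilityMeasure_map hZ.aemeasurable
  calc ∫⁻ ω, Ψ (Y ω, Z ω) ∂P = ∫⁻ q, Ψ q ∂(P.map fun ω => (Y ω, Z ω)) :=
        (lintegral_map hΨ (hY.prodMk hZ)).symm
    _ = ∫⁻ y, ∫⁻ z, Ψ (y, z) ∂(P.map Z) ∂(P.map Y) := by
        rw [h1, lintegral_prod _ hΨ.aemeasurable]
    _ = ∫⁻ ω, ∫⁻ z, Ψ (Y ω, z) ∂(P.map Z) ∂P :=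
        lintegral_map hΨ.lintegral_prod_right' hY
    _ = _ := by
        congr 1 with ω
        exact lintegral_map (hΨ.comp (measurable_const.prodMk measurable_id)) hZ

/-- The identity of Ω, read once with values in `(Ω, m)` and once in `(Ω, m')`, gives two
independent random elements. This is the device that freezes the past while the next cell is
integrated out. -/
lemma lintegral_diag_of_indep {m m' mΩ : MeasurableSpace Ω} {P : Measure Ω}
    [IsProbabilityMeasure P] (hm : m ≤ mΩ) (hm' : m' ≤ mΩ) (h : Indep m m' P)
    {Ψ : Ω × Ω → ℝ≥0∞} (hΨ : Measurable[m.prod m'] Ψ) :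
    ∫⁻ ω, Ψ (ω, ω) ∂P = ∫⁻ ω, ∫⁻ ω', Ψ (ω, ω') ∂P ∂P := by
  have h1 : @IndepFun Ω Ω Ω mΩ m m' id id P :=
    (@IndepFun_iff_Indep Ω Ω Ω mΩ m m' id id P).2
      (by rwa [MeasurableSpace.comap_id, MeasurableSpace.comap_id])
  exact @lintegral_eq_of_indepFun Ω Ω Ω mΩ m m' P _ id id (fun s hs => hm s hs)
    (fun s hs => hm' s hs) h1 Ψ hΨ

end Decoupling

namespace SimpleField

variable {Ω E : Type*} {mΩ : MeasurableSpace Ω} {mE : MeasurableSpace E} {P : Measure Ω}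
  {X : E → ℝ} {level : E → ℕ} {μ : Measure E} {p : ℕ → Ω → E}

lemma indep [IsProbabilityMeasure P] (h : SimpleField P X level μ p) {I I' : Set ℝ}
    (hI : MeasurableSet I) (hI' : MeasurableSet I') (hd : Disjoint I I') :
    Indep (voidSigma p (X ⁻¹' I)) (voidSigma p (X ⁻¹' I')) P := by
  refine IndepSets.indep (voidSigma_le h.measurable _) (voidSigma_le h.measurable _)
    (isPiSystem_void p _) (isPiSystem_void p _) rfl rfl ?_
  rw [IndepSets_iff]
  rintro _ _ ⟨B, hB, hBm, rfl⟩ ⟨B', hB', hBm', rfl⟩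
  exact h.void_indep I I' hI hI' hd B B' hBm hBm' hB hB'

/-- Sums over the points in `A` are jointly measurable in the configuration and a parameter. -/
lemma measurable_tsum_uncurry (h : SimpleField P X level μ p) {S : Type*} [mS : MeasurableSpace S]
    {A : Set E} (hA : MeasurableSet A) {f : E × S → ℝ≥0∞} (hf : Measurable f) :
    Measurable[(voidSigma p A).prod mS]
      fun q : Ω × S => ∑' j, A.indicator (fun e => f (e, q.2)) (p j q.1) :=
  @measurable_tsum_indicator_uncurry Ω E S (voidSigma p A) mE mS p A hA
    (fun _ hBA hB => measurable_pointCount_voidSigma h.measurable_pos h.injective hBA hB)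
    level h.measurable_level h.finite_level f hf

lemma measurable_tsum_voidSigma (h : SimpleField P X level μ p)
    {A : Set E} (hA : MeasurableSet A) {f : E → ℝ≥0∞} (hf : Measurable f) :
    Measurable[voidSigma p A] fun ω => ∑' j, A.indicator f (p j ω) := by
  let _ := voidSigma p A
  exact (h.measurable_tsum_uncurry (S := Unit) hA (f := fun q => f q.1)
    (hf.comp measurable_fst)).comp (measurable_id.prodMk (measurable_const (a := ())))

lemma measurable_tsum (h : SimpleField P X level μ p) {f : E → ℝ≥0∞} (hf : Measurable f) :
    Measurable fun ω => ∑' j, f (p j ω) :=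
  Measurable.tsum fun j => hf.comp (h.measurable j)

lemma lintegral_tsum (h : SimpleField P X level μ p) {f : E → ℝ≥0∞} (hf : Measurable f) :
    ∫⁻ ω, ∑' j, f (p j ω) ∂P = ∫⁻ e, f e ∂μ := by
  rw [MeasureTheory.lintegral_tsum (f := fun j ω => f (p j ω))
      fun j => (hf.comp (h.measurable j)).aemeasurable,
    ← h.intensity, lintegral_sum_measure]
  congr 1 with j
  rw [lintegral_map hf (h.measurable j)]

/-- The second moment of a sum over the points. -/
lemma lintegral_tsum_sq_le [IsProbabilityMeasure P] (h : SimpleField P X level μ p)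
    {f : E → ℝ≥0∞} (hf : Measurable f) :
    ∫⁻ ω, (∑' j, f (p j ω)) ^ 2 ∂P ≤ ∫⁻ e, f e ^ 2 ∂μ + (∫⁻ e, f e ∂μ) ^ 2 := by
  classical
  let c : ℕ → E → ℤ := fun n e => ⌊((n : ℝ) + 1) * X e⌋
  have hc : ∀ n, Measurable (c n) := fun n =>
    Int.measurable_floor.comp (h.measurable_pos.const_mul _)
  -- Pairs that the grid separates: their contributions come from different cells and are therefore
  -- independent.
  let q : ℕ → ℕ × ℕ → Ω → ℝ≥0∞ := fun n z ω =>
    if c n (p z.1 ω) ≠ c n (p z.2 ω) then f (p z.1 ω) * f (p z.2 ω) else 0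
  have hq : ∀ n z, Measurable (q n z) := fun n z => by
    refine Measurable.ite ?_ ((hf.comp (h.measurable _)).mul (hf.comp (h.measurable _)))
      measurable_const
    exact (measurableSet_eq_fun ((hc n).comp (h.measurable _))
      ((hc n).comp (h.measurable _))).compl
  -- Grouped by cells, the sum runs over ordered pairs of distinct cells, where expectations factor.
  -- Adding the diagonal pairs of cells completes the square of the total mean.
  have hcell : ∀ n, ∫⁻ ω, ∑' z, q n z ω ∂P ≤ (∫⁻ e, f e ∂μ) ^ 2 := by
    intro n
    let A : ℤ → Set E := fun a => X ⁻¹' {y | ⌊((n : ℝ) + 1) * y⌋ = a}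
    have hAm : ∀ a, MeasurableSet {y : ℝ | ⌊((n : ℝ) + 1) * y⌋ = a} := fun a =>
      (Int.measurable_floor.comp (measurable_id.const_mul _)) (measurableSet_singleton a)
    have hA : ∀ a, MeasurableSet (A a) := fun a => h.measurable_pos (hAm a)
    have hmem : ∀ a e, e ∈ A a ↔ c n e = a := fun a e => Iff.rfl
    let S : ℤ → Ω → ℝ≥0∞ := fun a ω => ∑' j, (A a).indicator f (p j ω)
    have hS : ∀ a, Measurable[voidSigma p (A a)] (S a) := fun a =>
      h.measurable_tsum_voidSigma (hA a) hf
    have hS' : ∀ a, Measurable (S a) := fun a => (hS a).mono (voidSigma_le h.measurable _) le_rfl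
    have e1 : ∀ ω, ∑' z, q n z ω = ∑' w : ℤ × ℤ, if w.1 ≠ w.2 then S w.1 ω * S w.2 ω else 0 := by
      intro ω
      have : ∀ z : ℕ × ℕ, q n z ω = ∑' w : ℤ × ℤ, if w.1 ≠ w.2 then
          (A w.1).indicator f (p z.1 ω) * (A w.2).indicator f (p z.2 ω) else 0 := by
        intro z
        rw [tsum_eq_single (c n (p z.1 ω), c n (p z.2 ω))]
        · rw [Set.indicator_of_mem ((hmem _ _).2 rfl), Set.indicator_of_mem ((hmem _ _).2 rfl)]
        · rintro ⟨a, b⟩ hab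
          simp only [ne_eq, ite_not, ite_eq_left_iff]
          intro _
          by_cases ha : c n (p z.1 ω) = a
          · have hb : c n (p z.2 ω) ≠ b := fun hb => hab (by rw [ha, hb])
            rw [Set.indicator_of_notMem (fun hh => hb ((hmem _ _).1 hh)) f, mul_zero]
          · rw [Set.indicator_of_notMem (fun hh => ha ((hmem _ _).1 hh)) f, zero_mul]
      simp_rw [this]
      rw [ENNReal.tsum_comm]
      congr 1 with w
      by_cases hw : w.1 = w.2
      · simp [hw]
      · simp only [ne_eq, hw, not_false_eq_true, if_true]
        rw [ENNReal.tsum_prod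
          (f := fun a b => (A w.1).indicator f (p a ω) * (A w.2).indicator f (p b ω))]
        simp_rw [ENNReal.tsum_mul_left]
        rw [ENNReal.tsum_mul_right]
    have e2 : ∫⁻ e, f e ∂μ = ∑' a, ∫⁻ ω, S a ω ∂P := by
      simp only [S]
      simp_rw [h.lintegral_tsum (hf.indicator (hA _))]
      rw [← MeasureTheory.lintegral_tsum fun a => (hf.indicator (hA a)).aemeasurable]
      congr 1 with e
      rw [tsum_eq_single (c n e)]
      · rw [Set.indicator_of_mem ((hmem _ _).2 rfl)]
      · intro a ha
        exact Set.indicator_of_notMem (fun hh => ha ((hmem _ _).1 hh).symm) f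
    simp_rw [e1]
    rw [MeasureTheory.lintegral_tsum, e2, sq, ← ENNReal.tsum_mul_right]
    · simp_rw [← ENNReal.tsum_mul_left]
      rw [← ENNReal.tsum_prod (f := fun a b => (∫⁻ ω, S a ω ∂P) * ∫⁻ ω, S b ω ∂P)]
      refine ENNReal.tsum_le_tsum fun w => ?_
      by_cases hw : w.1 = w.2
      · simp [hw]
      · simp only [ne_eq, hw, not_false_eq_true, if_true]
        refine (lintegral_mul_eq_lintegral_mul_lintegral_of_independent_measurableSpace
          (voidSigma_le h.measurable _) (voidSigma_le h.measurable _)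
          (h.indep (hAm w.1) (hAm w.2) ?_) (hS _) (hS _)).le
        rw [Set.disjoint_left]
        exact fun y hy hy' => hw (hy.symm.trans hy')
    · intro w
      by_cases hw : w.1 = w.2
      · simp [hw]
      · simp only [ne_eq, hw, not_false_eq_true, if_true]
        exact ((hS' _).mul (hS' _)).aemeasurable
  -- Equal indices give the sum of squares. Every pair of different indices is eventually separated,
  -- so Fatou's lemma for the counting measure on pairs bounds the rest.
  have hpt : ∀ ω, (∑' j, f (p j ω)) ^ 2
      ≤ (∑' j, f (p j ω) ^ 2) + liminf (fun n => ∑' z, q n z ω) atTop := by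
    intro ω
    have hfatou : ∑' z, liminf (fun n => q n z ω) atTop
        ≤ liminf (fun n => ∑' z, q n z ω) atTop := by
      simp only [← lintegral_count (α := ℕ × ℕ)]
      exact lintegral_liminf_le fun n => measurable_of_countable _
    refine le_trans ?_ (add_le_add le_rfl hfatou)
    have hdiag : ∑' j, f (p j ω) ^ 2
        = ∑' z : ℕ × ℕ, if z.1 = z.2 then f (p z.1 ω) * f (p z.2 ω) else 0 := by
      rw [ENNReal.tsum_prod (f := fun a b => if a = b then f (p a ω) * f (p b ω) else 0)]
      congr 1 with j
      rw [tsum_eq_single j]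
      · simp [sq]
      · intro k hk
        simp [hk.symm]
    have hsq : (∑' j, f (p j ω)) ^ 2 = ∑' z : ℕ × ℕ, f (p z.1 ω) * f (p z.2 ω) := by
      rw [ENNReal.tsum_prod (f := fun a b => f (p a ω) * f (p b ω)), sq]
      simp_rw [ENNReal.tsum_mul_left]
      rw [ENNReal.tsum_mul_right]
    rw [hdiag, hsq, ← ENNReal.tsum_add]
    refine ENNReal.tsum_le_tsum fun z => ?_
    by_cases hz : z.1 = z.2
    · simp [hz]
    · simp only [hz, if_false, zero_add]
      refine le_liminf_of_le (by isBoundedDefault) ?_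
      have := eventually_injOn_floor (fun j => X (p j ω)) {z.1, z.2} (h.injective ω).injOn
      filter_upwards [this] with n hn
      have hne : c n (p z.1 ω) ≠ c n (p z.2 ω) := fun hh => hz (hn (by simp) (by simp) hh)
      simp only [q, if_pos hne, le_refl]
  calc ∫⁻ ω, (∑' j, f (p j ω)) ^ 2 ∂P
      ≤ ∫⁻ ω, ((∑' j, f (p j ω) ^ 2) + liminf (fun n => ∑' z, q n z ω) atTop) ∂P :=
        lintegral_mono hpt
    _ = ∫⁻ e, f e ^ 2 ∂μ + ∫⁻ ω, liminf (fun n => ∑' z, q n z ω) atTop ∂P := by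
        rw [lintegral_add_left (h.measurable_tsum (hf.pow_const 2)),
          h.lintegral_tsum (hf.pow_const 2)]
    _ ≤ _ := by
        refine add_le_add le_rfl ((lintegral_liminf_le fun n => Measurable.tsum (hq n)).trans ?_)
        refine liminf_le_of_frequently_le' (Frequently.of_forall hcell)

end SimpleField

end RoadObstacles

namespace RoadObstacles

/-! ### Exponentials on [0, ∞], turning products of void probabilities into sums -/

section ExpNeg

/-- The function `exp (-s)` on `[0, ∞]`. -/
noncomputable def expNeg (s : ℝ≥0∞) : ℝ≥0∞ := EReal.exp (-(s : EReal))

/-- The function `-log u`, for `u ≤ 1`. -/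
noncomputable def negLog (u : ℝ≥0∞) : ℝ≥0∞ := (-ENNReal.log u).toENNReal

lemma continuous_expNeg : Continuous expNeg :=
  ENNReal.continuous_exp.comp (continuous_neg.comp continuous_coe_ennreal_ereal)

lemma measurable_negLog : Measurable negLog :=
  (continuous_neg.measurable.comp ENNReal.measurable_log).ereal_toENNReal

lemma expNeg_zero : expNeg 0 = 1 := by simp [expNeg]

lemma expNeg_add (s t : ℝ≥0∞) : expNeg (s + t) = expNeg s * expNeg t := by
  rw [expNeg, EReal.coe_ennreal_add, EReal.neg_add (Or.inl (EReal.coe_ennreal_ne_bot s))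
    (Or.inr (EReal.coe_ennreal_ne_bot t)), sub_eq_add_neg, EReal.exp_add]
  rfl

lemma expNeg_sum {ι : Type*} (J : Finset ι) (s : ι → ℝ≥0∞) :
    expNeg (∑ j ∈ J, s j) = ∏ j ∈ J, expNeg (s j) := by
  classical
  induction J using Finset.induction_on with
  | empty => simp [expNeg_zero]
  | insert a J ha ih => rw [Finset.sum_insert ha, Finset.prod_insert ha, expNeg_add, ih]

lemma expNeg_le_one (s : ℝ≥0∞) : expNeg s ≤ 1 := by
  have : EReal.exp (-(s : EReal)) ≤ EReal.exp 0 :=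
    EReal.exp_monotone (EReal.neg_le_zero.2 (EReal.coe_ennreal_nonneg s))
  simpa [expNeg] using this

/-- The bound `u ≤ 1` prevents the truncation in `toENNReal` from acting; the case u = 0 is covered
by the value ∞ of the logarithm. -/
lemma expNeg_negLog {u : ℝ≥0∞} (hu : u ≤ 1) : expNeg (negLog u) = u := by
  have h : 0 ≤ -ENNReal.log u := EReal.neg_nonneg.2 (ENNReal.log_le_zero_iff.2 hu)
  rw [expNeg, negLog, EReal.coe_toENNReal h, neg_neg, ENNReal.exp_log]

lemma negLog_one : negLog 1 = 0 := by simp [negLog]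

end ExpNeg

/-! ### Independent marking -/

namespace SimpleField

variable {Ω E M : Type*} {mΩ : MeasurableSpace Ω} {mE : MeasurableSpace E}
  {mM : MeasurableSpace M} {P : Measure Ω} {X : E → ℝ} {level : E → ℕ} {μ : Measure E}
  {p : ℕ → Ω → E} {m : ℕ → Ω → M} {κ : Measure M}

/-- The probability that there are no marked points in `B`, given the points. -/
lemma measure_void_marked [IsProbabilityMeasure P] [IsProbabilityMeasure κ]
    (h : SimpleField P X level μ p)
    (hm : ∀ j, HasLaw (m j) κ P) (hmm : ∀ j, Measurable (m j)) (hindep : iIndepFun m P)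
    (hpm : IndepFun (fun ω j => p j ω) (fun ω j => m j ω) P) {B : Set (E × M)}
    (hB : MeasurableSet B) :
    P (void (fun j ω => (p j ω, m j ω)) B)
      = ∫⁻ ω, expNeg (∑' j, negLog (κ {y | (p j ω, y) ∉ B})) ∂P := by
  let u : E → ℝ≥0∞ := fun e => κ {y | (e, y) ∉ B}
  have hu : Measurable u := measurable_measure_prodMk_left hB.compl
  have hu1 : ∀ e, u e ≤ 1 := fun e => prob_le_one
  let g : E × M → ℝ≥0∞ := Bᶜ.indicator fun _ => 1
  have hg : Measurable g := measurable_const.indicator hB.compl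
  have hgu : ∀ e j, ∫⁻ ω, g (e, m j ω) ∂P = u e := by
    intro e j
    have hge : Measurable fun y => g (e, y) := hg.comp (measurable_const.prodMk measurable_id)
    rw [← lintegral_map (f := fun y => g (e, y)) hge (hmm j), (hm j).map_eq]
    have hs : MeasurableSet {y | (e, y) ∉ B} := measurable_prodMk_left hB.compl
    change ∫⁻ y, {y | (e, y) ∉ B}.indicator (fun _ => 1) y ∂κ = u e
    rw [lintegral_indicator_const hs, one_mul]
  let V : ℕ → Set Ω := fun n => {ω | ∀ j < n, (p j ω, m j ω) ∉ B}
  have hVm : ∀ n, MeasurableSet (V n) := by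
    intro n
    have : V n = ⋂ j, ⋂ (_ : j < n), (fun ω => (p j ω, m j ω)) ⁻¹' Bᶜ := by
      ext ω
      simp [V]
    rw [this]
    exact MeasurableSet.iInter fun j => MeasurableSet.iInter fun _ =>
      ((h.measurable j).prodMk (hmm j)) hB.compl
  -- With the points fixed, the marks are independent, so the probability that the first n marked
  -- points avoid `B` is a product of the factors `u`.
  have hVP : ∀ n, P (V n) = ∫⁻ ω, expNeg (∑ j ∈ Finset.range n, negLog (u (p j ω))) ∂P := by
    intro n
    have e1 : P (V n) = ∫⁻ ω, ∏ j ∈ Finset.range n, g (p j ω, m j ω) ∂P := by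
      rw [← lintegral_indicator_one (hVm n)]
      congr 1 with ω
      by_cases hω : ω ∈ V n
      · rw [Set.indicator_of_mem hω, Finset.prod_eq_one]
        · rfl
        · intro j hj
          exact Set.indicator_of_mem (hω j (Finset.mem_range.1 hj)) _
      · rw [Set.indicator_of_notMem hω]
        simp only [V, mem_ofPred_eq, not_forall, not_not] at hω
        obtain ⟨j, hj, hjB⟩ := hω
        refine (Finset.prod_eq_zero (Finset.mem_range.2 hj) ?_).symm
        exact Set.indicator_of_notMem (not_not.2 hjB) _
    have e2 := lintegral_eq_of_indepFun (P := P) (measurable_pi_lambda _ fun j => h.measurable j)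
      (measurable_pi_lambda _ fun j => hmm j) hpm
      (Ψ := fun q => ∏ j ∈ Finset.range n, g (q.1 j, q.2 j)) (by
        refine Finset.measurable_fun_prod _ fun j _ => hg.comp ?_
        exact ((measurable_pi_apply j).comp measurable_fst).prodMk
          ((measurable_pi_apply j).comp measurable_snd))
    rw [e1, e2]
    congr 1 with ω
    have hge : ∀ j, Measurable fun y => g (p j ω, y) := fun j =>
      hg.comp (measurable_const.prodMk measurable_id)
    rw [lintegral_prod_eq_prod_lintegral_of_indepFun (Finset.range n)
      (fun j ω' => g (p j ω, m j ω')) (hindep.comp (fun j y => g (p j ω, y)) hge)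
      (fun j => (hge j).comp (hmm j)), expNeg_sum]
    refine Finset.prod_congr rfl fun j _ => ?_
    rw [hgu, expNeg_negLog (hu1 _)]
  have hVlim : Tendsto (fun n => P (V n)) atTop
      (𝓝 (P (void (fun j ω => (p j ω, m j ω)) B))) := by
    have : void (fun j ω => (p j ω, m j ω)) B = ⋂ n, V n := by
      ext ω
      simp only [void, V, mem_ofPred_eq, mem_iInter]
      exact ⟨fun hh n j _ => hh j, fun hh j => hh (j + 1) j j.lt_succ_self⟩
    rw [this]
    refine tendsto_measure_iInter_atTop (fun n => (hVm n).nullMeasurableSet) ?_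
      ⟨0, measure_ne_top _ _⟩
    intro a b hab ω hω j hj
    exact hω j (hj.trans_le hab)
  refine tendsto_nhds_unique hVlim ?_
  simp_rw [hVP]
  refine tendsto_lintegral_of_dominated_convergence (fun _ => 1) (fun n => ?_)
    (fun n => Eventually.of_forall fun ω => expNeg_le_one _) (by simp)
    (Eventually.of_forall fun ω =>
      (continuous_expNeg.tendsto _).comp (ENNReal.tendsto_nat_tsum _))
  exact continuous_expNeg.measurable.comp (Finset.measurable_fun_sum _ fun j _ =>
    measurable_negLog.comp (hu.comp (h.measurable j)))

/-- Independent marks turn a simple field into a simple field on the product space. -/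
theorem marked [IsProbabilityMeasure P] [IsProbabilityMeasure κ] (h : SimpleField P X level μ p)
    (hm : ∀ j, HasLaw (m j) κ P) (hmm : ∀ j, Measurable (m j)) (hindep : iIndepFun m P)
    (hpm : IndepFun (fun ω j => p j ω) (fun ω j => m j ω) P) :
    SimpleField P (fun q : E × M => X q.1) (fun q => level q.1) (μ.prod κ)
      (fun j ω => (p j ω, m j ω)) where
  measurable j := (h.measurable j).prodMk (hmm j)
  measurable_pos := h.measurable_pos.comp measurable_fst
  measurable_level := h.measurable_level.comp measurable_fst
  injective := h.injective
  finite_level := h.finite_level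
  void_indep := by
    intro I I' hI hI' hd B B' hB hB' hBI hBI'
    -- The logarithmic cost of avoiding `B` at a point `e`. It vanishes at positions over which `B`
    -- is empty, so the void probability of `B` is the mean of a functional of one strip.
    let φ : Set (E × M) → E → ℝ≥0∞ := fun B e => negLog (κ {y | (e, y) ∉ B})
    have hφ : ∀ {B}, MeasurableSet B → Measurable (φ B) := fun hB =>
      measurable_negLog.comp (measurable_measure_prodMk_left hB.compl)
    have hφ0 : ∀ {B : Set (E × M)} {J : Set ℝ}, B ⊆ (fun q : E × M => X q.1) ⁻¹' J →
        ∀ e, e ∉ X ⁻¹' J → φ B e = 0 := by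
      intro B J hBJ e he
      have : {y : M | (e, y) ∉ B} = univ := eq_univ_of_forall fun y hy => he (hBJ hy)
      simp only [φ, this, measure_univ, negLog_one]
    have hmeas : ∀ {B : Set (E × M)} {J : Set ℝ}, MeasurableSet B → MeasurableSet J →
        B ⊆ (fun q : E × M => X q.1) ⁻¹' J →
        Measurable[voidSigma p (X ⁻¹' J)] fun ω => expNeg (∑' j, φ B (p j ω)) := by
      intro B J hB hJ hBJ
      have : (fun ω => expNeg (∑' j, φ B (p j ω)))
          = fun ω => expNeg (∑' j, (X ⁻¹' J).indicator (φ B) (p j ω)) := by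
        rw [Set.indicator_eq_self.2]
        intro e he
        by_contra hne
        exact he (hφ0 hBJ e hne)
      rw [this]
      exact continuous_expNeg.measurable.comp
        (h.measurable_tsum_voidSigma (h.measurable_pos hJ) (hφ hB))
    rw [← void_union, h.measure_void_marked hm hmm hindep hpm (hB.union hB'),
      h.measure_void_marked hm hmm hindep hpm hB, h.measure_void_marked hm hmm hindep hpm hB',
      ← lintegral_mul_eq_lintegral_mul_lintegral_of_independent_measurableSpace
        (voidSigma_le h.measurable _) (voidSigma_le h.measurable _) (h.indep hI hI' hd)
        (hmeas hB hI hBI) (hmeas hB' hI' hBI')]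
    congr 1 with ω
    rw [← expNeg_add, ← ENNReal.tsum_add]
    congr 2 with j
    -- A position lies in at most one of the two disjoint sets, so at most one summand is nonzero
    -- and the costs add.
    change φ (B ∪ B') (p j ω) = φ B (p j ω) + φ B' (p j ω)
    by_cases hI : p j ω ∈ X ⁻¹' I
    · have hI2 : p j ω ∉ X ⁻¹' I' := fun hh => hd.le_bot ⟨hI, hh⟩
      rw [hφ0 hBI' _ hI2, add_zero]
      have : {y : M | (p j ω, y) ∉ B ∪ B'} = {y | (p j ω, y) ∉ B} := by
        ext y
        simp only [mem_ofPred_eq, mem_union, not_or, and_iff_left_iff_imp]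
        exact fun _ hy => hI2 (hBI' hy)
      simp only [φ, this]
    · rw [hφ0 hBI _ hI, zero_add]
      have : {y : M | (p j ω, y) ∉ B ∪ B'} = {y | (p j ω, y) ∉ B'} := by
        ext y
        simp only [mem_ofPred_eq, mem_union, not_or, and_iff_right_iff_imp]
        exact fun _ hy => hI (hBI hy)
      simp only [φ, this]
  intensity := by
    rw [← h.intensity, Measure.prod_sum_left]
    congr 1 with j : 1
    have h1 : IndepFun (p j) (m j) P :=
      hpm.comp (measurable_pi_apply j) (measurable_pi_apply j)
    rw [(indepFun_iff_map_prod_eq_prod_map_map (h.measurable j).aemeasurable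
      (hmm j).aemeasurable).1 h1, (hm j).map_eq]

end SimpleField

end RoadObstacles

namespace RoadObstacles

/-! ### Consequences of Poisson counts -/

section Poisson

/-- The weights satisfy (n + 1) p(n + 1) = r p(n), so a shift of the index leaves r times the total
mass. -/
lemma lintegral_cast_poissonMeasure (r : ℝ≥0) :
    ∫⁻ n : ℕ, (n : ℝ≥0∞) ∂(poissonMeasure r) = r := by
  rw [lintegral_countable']
  have h1 : ∑' n : ℕ, poissonMeasure r {n} = 1 := by
    have := lintegral_countable' (μ := poissonMeasure r) (fun _ : ℕ => (1 : ℝ≥0∞))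
    simpa using this.symm
  rw [tsum_eq_zero_add' ENNReal.summable]
  have h2 : ∀ n : ℕ, ((n + 1 : ℕ) : ℝ≥0∞) * poissonMeasure r {n + 1}
      = r * poissonMeasure r {n} := by
    intro n
    rw [poissonMeasure_singleton, poissonMeasure_singleton, ← ENNReal.ofReal_natCast,
      ← ENNReal.ofReal_coe_nnreal, ← ENNReal.ofReal_mul (by positivity),
      ← ENNReal.ofReal_mul (by positivity)]
    congr 1
    rw [Nat.factorial_succ]
    push_cast
    field_simp
    rw [pow_succ']
  simp_rw [h2, ENNReal.tsum_mul_left, h1]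
  simp

/-- From exp(-r) ≥ 1 - r one gets (1 + r) exp(-r) ≥ 1 - r². -/
lemma poissonMeasure_compl_le (r : ℝ≥0) :
    poissonMeasure r ({0, 1} : Set ℕ)ᶜ ≤ ENNReal.ofReal ((r : ℝ) ^ 2) := by
  have h : poissonMeasure r ({0, 1} : Set ℕ)
      = ENNReal.ofReal (Real.exp (-r) + Real.exp (-r) * r) := by
    rw [Set.insert_eq, measure_union (by simp) (measurableSet_singleton _),
      poissonMeasure_singleton, poissonMeasure_singleton,
      ← ENNReal.ofReal_add (by positivity) (by positivity)]
    simp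
  rw [prob_compl_eq_one_sub (measurableSet_insert.2 (measurableSet_singleton _)), h,
    ← ENNReal.ofReal_one, ← ENNReal.ofReal_sub _ (by positivity)]
  refine ENNReal.ofReal_le_ofReal ?_
  have h1 : 1 - (r : ℝ) ≤ Real.exp (-r) := by
    have := Real.add_one_le_exp (-(r : ℝ))
    linarith
  have h2 : (0 : ℝ) ≤ r := r.coe_nonneg
  nlinarith

variable {Ω E : Type*} {Z : ℕ → Ω → E}

lemma pointCount_eq_zero_iff {B : Set E} {ω : Ω} : pointCount Z B ω = 0 ↔ ω ∈ void Z B := by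
  simp [pointCount, void]

lemma two_le_pointCount {B : Set E} {ω : Ω} {a b : ℕ} (hab : a ≠ b) (ha : Z a ω ∈ B)
    (hb : Z b ω ∈ B) : 2 ≤ pointCount Z B ω := by
  refine le_trans ?_ (ENNReal.sum_le_tsum {a, b})
  rw [Finset.sum_pair hab, Set.indicator_of_mem ha, Set.indicator_of_mem hb]
  norm_num

namespace IsPoissonField

variable [MeasurableSpace Ω] [MeasurableSpace E] {P : Measure Ω} {μ : Measure E}

lemma lintegral_pointCount (h : IsPoissonField P μ Z) {B : Set E} (hB : MeasurableSet B)
    (hμB : μ B ≠ ∞) : ∫⁻ ω, pointCount Z B ω ∂P = μ B := by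
  have h1 := h.hasLaw_count B hB hμB
  have h2 : ∫⁻ ω, pointCount Z B ω ∂P = ∫⁻ s, s ∂(P.map (pointCount Z B)) :=
    (lintegral_map' aemeasurable_id h1.aemeasurable).symm
  rw [h2, h1.map_eq, lintegral_map (f := fun s => s) measurable_id (measurable_of_countable _),
    lintegral_cast_poissonMeasure, ENNReal.coe_toNNReal hμB]

lemma measure_pointCount_compl_le (h : IsPoissonField P μ Z) {B : Set E} (hB : MeasurableSet B)
    (hμB : μ B ≠ ∞) : P {ω | 2 ≤ pointCount Z B ω} ≤ (μ B) ^ 2 := by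
  have h1 := h.hasLaw_count B hB hμB
  have hms : MeasurableSet (Ici (2 : ℝ≥0∞)) := measurableSet_Ici
  have e1 : P {ω | 2 ≤ pointCount Z B ω} = P.map (pointCount Z B) (Ici 2) := by
    rw [Measure.map_apply_of_aemeasurable h1.aemeasurable hms]
    rfl
  rw [e1, h1.map_eq, Measure.map_apply (measurable_of_countable _) hms]
  refine (measure_mono ?_).trans ((poissonMeasure_compl_le _).trans ?_)
  · intro n hn
    simp only [mem_preimage, mem_Ici] at hn
    have : 2 ≤ n := by exact_mod_cast hn
    simp only [mem_compl_iff, mem_insert_iff, mem_singleton_iff]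
    omega
  · rw [ENNReal.ofReal_pow (NNReal.coe_nonneg _), ENNReal.ofReal_coe_nnreal,
      ENNReal.coe_toNNReal hμB]

lemma measure_void_inter [IsProbabilityMeasure P] (h : IsPoissonField P μ Z) {B B' : Set E}
    (hB : MeasurableSet B) (hB' : MeasurableSet B') (hd : Disjoint B B') :
    P (void Z B ∩ void Z B') = P (void Z B) * P (void Z B') := by
  have h1 := h.iIndepFun_count 2 ![B, B'] (by intro i; fin_cases i <;> assumption) (by
    intro i j hij
    fin_cases i <;> fin_cases j
    · exact absurd rfl hij
    · exact hd
    · exact hd.symm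
    · exact absurd rfl hij)
  have h2 : IndepFun (pointCount Z B) (pointCount Z B') P := h1.indepFun (i := 0) (j := 1) (by simp)
  have h3 := h2.measure_inter_preimage_eq_mul {0} {0} (measurableSet_singleton _)
    (measurableSet_singleton _)
  have e : ∀ C : Set E, pointCount Z C ⁻¹' {0} = void Z C := fun C => by
    ext ω
    exact pointCount_eq_zero_iff
  rwa [e, e] at h3

/-- Counts determine the mean measure on sets of finite intensity only; the levels cut every set
into countably many of these. -/
lemma intensity (h : IsPoissonField P μ Z) {level : E → ℕ} (hl : Measurable level)
    (hfin : ∀ i, μ (level ⁻¹' {i}) ≠ ∞) : Measure.sum (fun j => P.map (Z j)) = μ := by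
  have key : ∀ B, MeasurableSet B → μ B ≠ ∞ → Measure.sum (fun j => P.map (Z j)) B = μ B := by
    intro B hB hμB
    rw [← h.lintegral_pointCount hB hμB, Measure.sum_apply _ hB]
    simp only [pointCount]
    rw [lintegral_tsum (f := fun j ω => B.indicator (fun _ => (1 : ℝ≥0∞)) (Z j ω)) fun j =>
      ((measurable_const.indicator hB).comp (h.measurable j)).aemeasurable]
    congr 1 with j
    rw [Measure.map_apply (h.measurable j) hB, ← lintegral_indicator_one ((h.measurable j) hB)]
    rfl
  have split : ∀ (ν : Measure E) (B : Set E), MeasurableSet B →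
      ν B = ∑' i, ν (B ∩ level ⁻¹' {i}) := by
    intro ν B hB
    rw [← measure_iUnion]
    · congr 1
      ext e
      simp
    · intro i j hij
      rw [Function.onFun, Set.disjoint_left]
      rintro e ⟨_, h1⟩ ⟨_, h2⟩
      exact hij (h1.symm.trans h2)
    · exact fun i => hB.inter (hl (measurableSet_singleton i))
  ext B hB
  rw [split _ B hB, split μ B hB]
  congr 1 with i
  exact key _ (hB.inter (hl (measurableSet_singleton i)))
    (ne_top_of_le_ne_top (hfin i) (measure_mono inter_subset_right))

end IsPoissonField

end Poisson

/-! ### The space-time field: local finiteness and distinct positions -/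

section SpaceTime

/-- A point of space-time has level at most `i` if its coordinate is at most `i` in absolute value
and its time is at most `i`. -/
noncomputable def level (e : ℝ × ℝ) : ℕ := ⌈max |e.1| e.2⌉₊

lemma measurable_level : Measurable level :=
  Nat.measurable_ceil.comp (measurable_fst.abs.max measurable_snd)

lemma level_le_iff {e : ℝ × ℝ} {i : ℕ} : level e ≤ i ↔ |e.1| ≤ i ∧ e.2 ≤ i := by
  rw [level, Nat.ceil_le, max_le_iff]

lemma spaceTimeIntensity_prod (lam : ℝ) (I J : Set ℝ) (hI : MeasurableSet I)
    (hJ : MeasurableSet J) :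
    spaceTimeIntensity lam (I ×ˢ J) = ENNReal.ofReal lam * (volume I * volume (J ∩ Ici 0)) := by
  rw [spaceTimeIntensity, Measure.smul_apply, Measure.restrict_apply (hI.prod hJ), prod_inter_prod,
    inter_univ, Measure.volume_eq_prod, Measure.prod_prod, smul_eq_mul]

lemma spaceTimeIntensity_prod_Iic (lam : ℝ) (I : Set ℝ) (hI : MeasurableSet I) (i : ℝ) :
    spaceTimeIntensity lam (I ×ˢ Iic i) = ENNReal.ofReal lam * (volume I * ENNReal.ofReal i) := by
  rw [spaceTimeIntensity_prod lam I _ hI measurableSet_Iic, inter_comm, Ici_inter_Iic,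
    Real.volume_Icc, sub_zero]

/-- The level does not bound times from below, but negative times carry no intensity. -/
lemma spaceTimeIntensity_level_ne_top (lam : ℝ) (i : ℕ) :
    spaceTimeIntensity lam (level ⁻¹' Iic i) ≠ ∞ := by
  refine ne_top_of_le_ne_top ?_ (measure_mono
    (t := Icc (-(i : ℝ)) i ×ˢ Iic (i : ℝ)) ?_)
  · rw [spaceTimeIntensity_prod_Iic lam _ measurableSet_Icc, Real.volume_Icc]
    exact ENNReal.mul_ne_top ENNReal.ofReal_ne_top
      (ENNReal.mul_ne_top ENNReal.ofReal_ne_top ENNReal.ofReal_ne_top)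
  · intro e he
    have := level_le_iff.1 he
    exact ⟨abs_le.1 this.1, this.2⟩

variable {Ω : Type*} [MeasurableSpace Ω] {P : Measure Ω} {lam : ℝ} {Z : ℕ → Ω → ℝ × ℝ}

lemma IsPoissonField.ae_finite_level (h : IsPoissonField P (spaceTimeIntensity lam) Z) :
    ∀ᵐ ω ∂P, ∀ i, {j | level (Z j ω) = i}.Finite := by
  rw [ae_all_iff]
  intro i
  have hm : MeasurableSet (level ⁻¹' Iic i) := measurable_level measurableSet_Iic
  have h1 := h.lintegral_pointCount hm (spaceTimeIntensity_level_ne_top lam i)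
  have h2 : Measurable (pointCount Z (level ⁻¹' Iic i)) := Measurable.tsum fun j =>
    (measurable_const.indicator hm).comp (h.measurable j)
  have h3 := ae_lt_top h2 (by rw [h1]; exact spaceTimeIntensity_level_ne_top lam i)
  filter_upwards [h3] with ω hω
  have h4 := ENNReal.finite_const_le_of_tsum_ne_top hω.ne one_ne_zero
  refine h4.subset fun j hj => ?_
  have : Z j ω ∈ level ⁻¹' Iic i := by
    have hj' : level (Z j ω) = i := hj
    exact hj'.le
  simp [this]

/-- Two bounded-level points with a common position share a strip of width 1 / (n + 1). There are
O(n) strips, each holding two points with probability O(1 / n²), so the event has probability O(1 /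
n) for every n. -/
lemma IsPoissonField.ae_injective (h : IsPoissonField P (spaceTimeIntensity lam) Z) :
    ∀ᵐ ω ∂P, Function.Injective fun j => (Z j ω).1 := by
  have key : ∀ i : ℕ, P {ω | ∃ a b, a ≠ b ∧ level (Z a ω) ≤ i ∧ level (Z b ω) ≤ i ∧
      (Z a ω).1 = (Z b ω).1} = 0 := by
    intro i
    set Bad := {ω | ∃ a b, a ≠ b ∧ level (Z a ω) ≤ i ∧ level (Z b ω) ≤ i ∧
      (Z a ω).1 = (Z b ω).1} with hBad
    -- The factor 3(i + 1)(n + 1) dominates the 2i(n + 1) + 1 strips that are needed. The maximum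
    -- `lam ⊔ 0` appears because the sign of `lam` is not assumed here.
    have hbound : ∀ n : ℕ, P Bad ≤
        (ENNReal.ofReal (3 * (i + 1) * (lam ⊔ 0) ^ 2 * (i : ℝ) ^ 2 / (n + 1))) := by
      intro n
      have hn : (0 : ℝ) < n + 1 := by positivity
      let B : ℤ → Set (ℝ × ℝ) := fun l =>
        {y : ℝ | ⌊((n : ℝ) + 1) * y⌋ = l} ×ˢ Iic (i : ℝ)
      have hcellm : ∀ l : ℤ, MeasurableSet {y : ℝ | ⌊((n : ℝ) + 1) * y⌋ = l} := fun l =>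
        (Int.measurable_floor.comp (measurable_id.const_mul _)) (measurableSet_singleton l)
      have hvol : ∀ l : ℤ, volume {y : ℝ | ⌊((n : ℝ) + 1) * y⌋ = l} ≤
          ENNReal.ofReal (1 / (n + 1)) := by
        intro l
        have : {y : ℝ | ⌊((n : ℝ) + 1) * y⌋ = l} ⊆ Icc (l / ((n : ℝ) + 1)) ((l + 1) / (n + 1)) := by
          intro y hy
          have hy' : ⌊((n : ℝ) + 1) * y⌋ = l := hy
          rw [Int.floor_eq_iff] at hy'
          constructor
          · rw [div_le_iff₀ hn]; linarith [hy'.1]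
          · rw [le_div_iff₀ hn]; linarith [hy'.2]
        refine (measure_mono this).trans ?_
        rw [Real.volume_Icc]
        refine ENNReal.ofReal_le_ofReal (le_of_eq ?_)
        field_simp
        ring
      have hμB : ∀ l, spaceTimeIntensity lam (B l) ≤ ENNReal.ofReal ((lam ⊔ 0) * i / (n + 1)) := by
        intro l
        rw [spaceTimeIntensity_prod_Iic lam _ (hcellm l)]
        calc _ ≤ ENNReal.ofReal (lam ⊔ 0) * (ENNReal.ofReal (1 / (n + 1)) * ENNReal.ofReal i) := by
              gcongr
              · exact le_max_left _ _
              · exact hvol l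
          _ = _ := by
              rw [← ENNReal.ofReal_mul (by positivity), ← ENNReal.ofReal_mul (by positivity)]
              congr 1
              ring
      have hPB : ∀ l, P {ω | 2 ≤ pointCount Z (B l) ω} ≤
          ENNReal.ofReal (((lam ⊔ 0) * i / (n + 1)) ^ 2) := by
        intro l
        refine (h.measure_pointCount_compl_le ((hcellm l).prod measurableSet_Iic)
          (ne_top_of_le_ne_top ENNReal.ofReal_ne_top (hμB l))).trans ?_
        rw [ENNReal.ofReal_pow (by positivity)]
        exact pow_le_pow_left₀ (zero_le) (hμB l) 2
      let L : Finset ℤ := Finset.Icc (-(i * (n + 1) : ℤ)) (i * (n + 1))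
      have hsub : Bad ⊆ ⋃ l ∈ L, {ω | 2 ≤ pointCount Z (B l) ω} := by
        rintro ω ⟨a, b, hab, ha, hb, hx⟩
        rw [level_le_iff] at ha hb
        simp only [mem_iUnion]
        refine ⟨⌊((n : ℝ) + 1) * (Z a ω).1⌋, ?_, two_le_pointCount (Z := Z) hab ⟨rfl, ha.2⟩
          ⟨by rw [hx]; rfl, hb.2⟩⟩
        obtain ⟨h1, h2⟩ := abs_le.1 ha.1
        simp only [L, Finset.mem_Icc]
        constructor
        · rw [Int.le_floor]; push_cast; nlinarith
        · have : (⌊((n : ℝ) + 1) * (Z a ω).1⌋ : ℝ) ≤ i * (n + 1) :=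
            (Int.floor_le _).trans (by nlinarith)
          exact_mod_cast this
      have hcard : (L.card : ℝ) ≤ 3 * (i + 1) * (n + 1) := by
        have h1 : (L.card : ℤ) = 2 * (i * (n + 1)) + 1 := by
          simp only [L, Int.card_Icc]
          rw [Int.toNat_of_nonneg]
          · ring
          · nlinarith [mul_nonneg (i.cast_nonneg : (0 : ℤ) ≤ i) (n.cast_nonneg : (0 : ℤ) ≤ n)]
        have h2 : (L.card : ℝ) = 2 * (i * (n + 1)) + 1 := by exact_mod_cast h1
        rw [h2]
        have : (0 : ℝ) ≤ i := i.cast_nonneg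
        have : (0 : ℝ) ≤ n := n.cast_nonneg
        nlinarith [mul_nonneg (i.cast_nonneg : (0 : ℝ) ≤ i) (n.cast_nonneg : (0 : ℝ) ≤ n)]
      calc P Bad ≤ ∑ l ∈ L, P {ω | 2 ≤ pointCount Z (B l) ω} :=
            (measure_mono hsub).trans (measure_biUnion_finset_le _ _)
        _ ≤ ∑ l ∈ L, ENNReal.ofReal (((lam ⊔ 0) * i / (n + 1)) ^ 2) :=
            Finset.sum_le_sum fun l _ => hPB l
        _ = ENNReal.ofReal (L.card * ((lam ⊔ 0) * i / (n + 1)) ^ 2) := by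
            rw [Finset.sum_const, nsmul_eq_mul, ENNReal.ofReal_mul (by positivity),
              ENNReal.ofReal_natCast]
        _ ≤ _ := by
            refine ENNReal.ofReal_le_ofReal ?_
            calc L.card * ((lam ⊔ 0) * i / (n + 1)) ^ 2
                ≤ 3 * (i + 1) * (n + 1) * ((lam ⊔ 0) * i / (n + 1)) ^ 2 := by gcongr
              _ = _ := by
                  field_simp
    have hlim : Tendsto (fun n : ℕ => ENNReal.ofReal
        (3 * (i + 1) * (lam ⊔ 0) ^ 2 * (i : ℝ) ^ 2 / (n + 1))) atTop (𝓝 0) := by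
      have h0 := tendsto_const_div_atTop_nhds_zero_nat (3 * (i + 1) * (lam ⊔ 0) ^ 2 * (i : ℝ) ^ 2)
      have h1 := (tendsto_add_atTop_iff_nat 1).2 h0
      have h2 := ENNReal.tendsto_ofReal h1
      simpa using h2
    exact le_antisymm (ge_of_tendsto' hlim hbound) (zero_le)
  have : ∀ᵐ ω ∂P, ∀ i : ℕ, ¬ ∃ a b, a ≠ b ∧ level (Z a ω) ≤ i ∧ level (Z b ω) ≤ i ∧
      (Z a ω).1 = (Z b ω).1 := by
    rw [ae_all_iff]
    intro i
    rw [ae_iff]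
    simpa only [not_not] using key i
  filter_upwards [this] with ω hω a b hab
  by_contra hne
  exact hω (max (level (Z a ω)) (level (Z b ω)))
    ⟨a, b, hne, le_max_left _ _, le_max_right _ _, hab⟩

/-- A Poisson field on space-time coincides almost surely with a simple field. -/
theorem IsPoissonField.exists_simpleField [IsProbabilityMeasure P]
    (h : IsPoissonField P (spaceTimeIntensity lam) Z) :
    ∃ Z' : ℕ → Ω → ℝ × ℝ, SimpleField P Prod.fst level (spaceTimeIntensity lam) Z' ∧
      ∀ᵐ ω ∂P, ∀ j, Z' j ω = Z j ω := by
  classical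
  obtain ⟨G, hG, hGm, hGood⟩ := (h.ae_finite_level.and h.ae_injective).exists_measurable_mem
  -- Off the good event the points (j, -1) are substituted: their positions are distinct and the
  -- level of the j-th is j, so the pathwise properties hold for every `ω`.
  let Z' : ℕ → Ω → ℝ × ℝ := fun j ω => if ω ∈ G then Z j ω else ((j : ℝ), -1)
  have hZ'G : ∀ ω ∈ G, ∀ j, Z' j ω = Z j ω := fun ω hω j => if_pos hω
  have hae : ∀ᵐ ω ∂P, ∀ j, Z' j ω = Z j ω := by
    filter_upwards [hG] with ω hω using hZ'G ω hω
  have hvoid : ∀ B, void Z' B =ᵐ[P] void Z B := by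
    intro B
    filter_upwards [hae] with ω hω
    refine propext ?_
    change (∀ j, Z' j ω ∉ B) ↔ ∀ j, Z j ω ∉ B
    simp only [hω]
  refine ⟨Z', ⟨fun j => Measurable.ite hGm (h.measurable j) measurable_const, measurable_fst,
    measurable_level, ?_, ?_, ?_, ?_⟩, hae⟩
  · intro ω
    by_cases hω : ω ∈ G
    · simp only [hZ'G ω hω]
      exact (hGood ω hω).2
    · intro a b hab
      simp only [Z', if_neg hω] at hab
      exact_mod_cast hab
  · intro ω i
    by_cases hω : ω ∈ G
    · simp only [hZ'G ω hω]
      exact (hGood ω hω).1 i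
    · refine (Set.finite_le_nat i).subset fun j hj => ?_
      have hj' : level (Z' j ω) ≤ i := le_of_eq hj
      simp only [Z', if_neg hω] at hj'
      have := (level_le_iff.1 hj').1
      simp only [Nat.abs_cast, Nat.cast_le] at this
      exact this
  · intro I I' hI hI' hd B B' hB hB' hBI hBI'
    rw [measure_congr ((hvoid B).inter (hvoid B')), measure_congr (hvoid B),
      measure_congr (hvoid B')]
    refine h.measure_void_inter hB hB' ?_
    exact (hd.preimage _).mono hBI hBI'
  · rw [← h.intensity measurable_level fun i => ne_top_of_le_ne_top
      (spaceTimeIntensity_level_ne_top lam i) (measure_mono fun e he => le_of_eq he)]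
    congr 1 with j : 1
    refine Measure.map_congr ?_
    filter_upwards [hae] with ω hω using hω j

end SpaceTime

end RoadObstacles

namespace RoadObstacles

/-! ### The uniform grid of positions -/

section Grid

/-- The cell number `k` of the uniform grid with mesh `1 / (n + 1)`. -/
def cell (n k : ℕ) : Set ℝ := Ico ((k : ℝ) / (n + 1)) ((k + 1 : ℝ) / (n + 1))

lemma measurableSet_cell (n k : ℕ) : MeasurableSet (cell n k) := measurableSet_Ico

lemma mem_cell_iff {n k : ℕ} {s : ℝ} : s ∈ cell n k ↔ ⌊((n : ℝ) + 1) * s⌋ = k := by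
  have hn : (0 : ℝ) < n + 1 := by positivity
  rw [cell, mem_Ico, div_le_iff₀ hn, lt_div_iff₀ hn, Int.floor_eq_iff, mul_comm s]
  simp

lemma disjoint_Ico_cell (n k : ℕ) : Disjoint (Ico (0 : ℝ) ((k : ℝ) / (n + 1))) (cell n k) :=
  Set.disjoint_left.2 fun _ h h' => absurd h.2 (not_lt.2 h'.1)

lemma cell_subset_Ico {n k d : ℕ} (hk : k < d * (n + 1)) : cell n k ⊆ Ico (0 : ℝ) d := by
  have hn : (0 : ℝ) < n + 1 := by positivity
  refine Ico_subset_Ico (by positivity) ?_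
  rw [div_le_iff₀ hn]
  exact_mod_cast hk

lemma Ico_union_cell (n k : ℕ) :
    Ico (0 : ℝ) ((k : ℝ) / (n + 1)) ∪ cell n k = Ico (0 : ℝ) (((k + 1 : ℕ) : ℝ) / (n + 1)) := by
  push_cast
  refine Ico_union_Ico_eq_Ico (by positivity) ?_
  gcongr
  linarith

/-- The cells of the grid partition the interval `[0, d)`. -/
lemma sum_indicator_cell (n d : ℕ) (c : ℝ≥0∞) (s : ℝ) :
    ∑ k ∈ Finset.range (d * (n + 1)), (cell n k).indicator (fun _ => c) s
      = (Ico (0 : ℝ) d).indicator (fun _ => c) s := by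
  have hn : (0 : ℝ) < n + 1 := by positivity
  by_cases hs : s ∈ Ico (0 : ℝ) d
  · rw [Set.indicator_of_mem hs]
    have h0 : 0 ≤ ((n : ℝ) + 1) * s := mul_nonneg hn.le hs.1
    have hk : ⌊((n : ℝ) + 1) * s⌋₊ < d * (n + 1) := by
      rw [Nat.floor_lt h0]
      push_cast
      nlinarith [hs.2]
    rw [Finset.sum_eq_single_of_mem _ (Finset.mem_range.2 hk)]
    · refine Set.indicator_of_mem (mem_cell_iff.2 ?_) _
      exact (Int.natCast_floor_eq_floor h0).symm
    · intro k _ hne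
      refine Set.indicator_of_notMem (fun h => hne ?_) _
      have h1 := mem_cell_iff.1 h
      rw [← Int.natCast_floor_eq_floor h0] at h1
      exact_mod_cast h1.symm
  · rw [Set.indicator_of_notMem hs]
    refine Finset.sum_eq_zero fun k hk => Set.indicator_of_notMem (fun h => hs ?_) _
    exact cell_subset_Ico (Finset.mem_range.1 hk) h

end Grid

/-! ### Deterministic clocks driven by jumps, and their grid approximations -/

section Clock

variable {u₀ : ℝ} {y a : ℕ → ℝ} {g : ℕ → ℝ → ℝ}

/-- A locally finite family of jumps: the jump number `j`, at the position `y j`, is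
`g j u` if the clock shows `u` and vanishes as long as `u < a j`. -/
structure JumpFamily (y a : ℕ → ℝ) (g : ℕ → ℝ → ℝ) : Prop where
  injective : Function.Injective y
  nonneg : ∀ j u, 0 ≤ g j u
  eq_zero : ∀ j u, u < a j → g j u = 0
  finite : ∀ d N : ℝ, {j | y j ∈ Ico 0 d ∧ a j ≤ N}.Finite

/-- On `[0, d]`, the clock `W` starts from `u₀` and is moved only by the jumps. -/
def IsClock (u₀ : ℝ) (y : ℕ → ℝ) (g : ℕ → ℝ → ℝ) (d : ℝ) (W : ℝ → ℝ) : Prop :=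
  ∀ s ∈ Icc 0 d, HasSum ({j | y j ∈ Ico 0 s}.indicator fun j => g j (W (y j))) (W s - u₀)

/-- The clock that is adjusted only at the points of the grid with mesh `1 / (n + 1)`. -/
noncomputable def gridClock (u₀ : ℝ) (y : ℕ → ℝ) (g : ℕ → ℝ → ℝ) (n : ℕ) : ℕ → ℝ
  | 0 => u₀
  -- An infinite cell sum would be read as 0 by `toReal`; wherever the grid clock is compared with a
  -- true clock the sums are finite.
  | k + 1 => gridClock u₀ y g n k + (∑' j, (cell n k).indicator
      (fun _ => ENNReal.ofReal (g j (gridClock u₀ y g n k))) (y j)).toReal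

lemma le_gridClock (n k : ℕ) : u₀ ≤ gridClock u₀ y g n k := by
  induction k with
  | zero => exact le_rfl
  | succ k ih => exact ih.trans (le_add_of_nonneg_right ENNReal.toReal_nonneg)

/-- Points are added from left to right: the jump at a new rightmost point does not alter the clock
at any earlier point, nor at that point itself, since `y j < s` is strict. -/
lemma exists_finite_clock (u₀ : ℝ) (y : ℕ → ℝ) (g : ℕ → ℝ → ℝ) (S : Finset ℕ) :
    ∃ W : ℝ → ℝ, ∀ s, W s = u₀ + ∑ j ∈ S with y j < s, g j (W (y j)) := by
  classical
  induction S using Finset.induction_on_max_value y with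
  | empty => exact ⟨fun _ => u₀, by simp⟩
  | insert b S hb hmax ih =>
    obtain ⟨W, hW⟩ := ih
    refine ⟨fun s => W s + if y b < s then g b (W (y b)) else 0, fun s => ?_⟩
    have h1 : ∀ j ∈ S, ¬ y b < y j := fun j hj => not_lt.2 (hmax j hj)
    have h2 : ∑ j ∈ S with y j < s, g j (W (y j) + if y b < y j then g b (W (y b)) else 0)
        = ∑ j ∈ S with y j < s, g j (W (y j)) := by
      refine Finset.sum_congr rfl fun j hj => ?_
      rw [if_neg (h1 j (Finset.mem_filter.1 hj).1), add_zero]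
    rw [Finset.filter_insert]
    split_ifs with hbs
    · rw [Finset.sum_insert (by simp [hb]), h2]
      simp only [hbs, lt_irrefl, if_true, if_false, add_zero]
      rw [hW s]
      ring
    · rw [h2]
      simp only [hbs, if_false, add_zero]
      exact hW s

namespace JumpFamily

lemma isClock_mono (h : JumpFamily y a g) {d : ℝ} {W : ℝ → ℝ} (hW : IsClock u₀ y g d W)
    {s s' : ℝ} (hs : 0 ≤ s)
    (hss : s ≤ s') (hs' : s' ≤ d) : W s ≤ W s' := by
  have h1 := hasSum_le (Set.indicator_le_indicator_of_subset
    (s := {j | y j ∈ Ico 0 s}) (t := {j | y j ∈ Ico 0 s'})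
    (fun j hj => ⟨hj.1, hj.2.trans_le hss⟩) fun j => h.nonneg _ _)
    (hW s ⟨hs, hss.trans hs'⟩) (hW s' ⟨hs.trans hss, hs'⟩)
  linarith

/-- Only finitely many points can act below the final values of both clocks, and the state at a
point depends only on such points strictly to its left; strong induction on their number applies. -/
lemma isClock_unique (h : JumpFamily y a g) {d : ℝ} {W W' : ℝ → ℝ} (hW : IsClock u₀ y g d W)
    (hW' : IsClock u₀ y g d W') : EqOn W W' (Icc 0 d) := by
  classical
  -- By monotonicity neither clock exceeds `N` on `[0, d]`, so points with `N < a j` give zero jumps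
  -- in both.
  let N := max (W d) (W' d)
  let S := (h.finite d N).toFinset
  suffices hind : ∀ c : ℕ, ∀ s ∈ Icc 0 d, (S.filter fun j => y j < s).card = c → W s = W' s from
    fun s hs => hind _ s hs rfl
  intro c
  induction c using Nat.strong_induction_on with
  | _ c ih =>
    intro s hs hc
    have heq : ({j | y j ∈ Ico 0 s}.indicator fun j => g j (W (y j)))
        = {j | y j ∈ Ico 0 s}.indicator fun j => g j (W' (y j)) := by
      refine Set.indicator_congr fun j hj => ?_
      have hj' : y j ∈ Ico 0 s := hj
      have hjd : y j ≤ d := hj'.2.le.trans hs.2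
      by_cases hjS : j ∈ S
      · rw [ih _ ?_ (y j) ⟨hj'.1, hjd⟩ rfl]
        rw [← hc]
        refine Finset.card_lt_card (Finset.ssubset_iff_of_subset ?_ |>.2 ⟨j, ?_, ?_⟩)
        · intro i hi
          rw [Finset.mem_filter] at hi ⊢
          exact ⟨hi.1, hi.2.trans hj'.2⟩
        · exact Finset.mem_filter.2 ⟨hjS, hj'.2⟩
        · simp
      · have haj : N < a j := by
          by_contra hcon
          exact hjS ((h.finite d N).mem_toFinset.2 ⟨⟨hj'.1, hj'.2.trans_le hs.2⟩, not_lt.1 hcon⟩)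
        rw [h.eq_zero j _ (((h.isClock_mono hW hj'.1 hjd le_rfl).trans (le_max_left _ _)).trans_lt
          haj), h.eq_zero j _ (((h.isClock_mono hW' hj'.1 hjd le_rfl).trans
          (le_max_right _ _)).trans_lt haj)]
    have h1 := hW s hs
    rw [heq] at h1
    linarith [h1.unique (hW' s hs)]

section Finite

variable {d N : ℝ} {S : Finset ℕ} {W : ℝ → ℝ}

lemma finite_clock_mono (h : JumpFamily y a g)
    (hW : ∀ s, W s = u₀ + ∑ j ∈ S with y j < s, g j (W (y j))) :
    Monotone W := by
  intro s s' hss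
  rw [hW s, hW s']
  refine add_le_add le_rfl (Finset.sum_le_sum_of_subset_of_nonneg ?_ fun j _ _ => h.nonneg _ _)
  intro j hj
  rw [Finset.mem_filter] at hj ⊢
  exact ⟨hj.1, hj.2.trans_le hss⟩

/-- The omitted points in `[0, d)` have `N < a j`; a clock that ends at or below `N` never triggers
them, so it solves the equation of the whole family. -/
lemma finite_clock_isClock (h : JumpFamily y a g) (hS : ∀ j, j ∈ S ↔ y j ∈ Ico 0 d ∧ a j ≤ N)
    (hW : ∀ s, W s = u₀ + ∑ j ∈ S with y j < s, g j (W (y j))) (hN : W d ≤ N) :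
    IsClock u₀ y g d W := by
  classical
  intro s hs
  have h1 : W s - u₀ = ∑ j ∈ S, {j | y j ∈ Ico 0 s}.indicator (fun j => g j (W (y j))) j := by
    rw [hW s, add_sub_cancel_left, Finset.sum_filter]
    refine Finset.sum_congr rfl fun j hj => ?_
    have := ((hS j).1 hj).1.1
    simp [Set.indicator_apply, this]
  rw [h1]
  refine hasSum_sum_of_ne_finset_zero fun j hj => ?_
  refine Set.indicator_apply_eq_zero.2 fun hjs => ?_
  have hjs' : y j ∈ Ico 0 s := hjs
  refine h.eq_zero j _ ?_
  have haj : N < a j := by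
    by_contra hcon
    exact hj ((hS j).2 ⟨⟨hjs'.1, hjs'.2.trans_le hs.2⟩, not_lt.1 hcon⟩)
  exact ((h.finite_clock_mono hW (hjs'.2.le.trans hs.2)).trans hN).trans_lt haj

variable {m n : ℕ}

/-- A cell holds at most one point of `S`, so the clock stands still between the left end of the
cell and that point. Points outside `S` are not yet active and contribute nothing. -/
lemma tsum_cell_eq (hS : ∀ j, j ∈ S ↔ y j ∈ Ico (0 : ℝ) m ∧ a j ≤ N)
    (hW : ∀ s, W s = u₀ + ∑ j ∈ S with y j < s, g j (W (y j)))
    (hn : InjOn (fun j => ⌊((n : ℝ) + 1) * y j⌋) S) {k : ℕ} (hk : k < m * (n + 1))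
    (hN : W (k / (n + 1)) ≤ N) {φ : ℕ → ℝ → ℝ≥0∞} (hφ : ∀ j u, u < a j → φ j u = 0) :
    ∑' j, (cell n k).indicator (fun _ => φ j (W (k / (n + 1)))) (y j)
      = ∑ j ∈ S, (cell n k).indicator (fun _ => φ j (W (y j))) (y j) := by
  classical
  rw [tsum_eq_sum (s := S)]
  · refine Finset.sum_congr rfl fun j hj => ?_
    by_cases hjc : y j ∈ cell n k
    · rw [Set.indicator_of_mem hjc, Set.indicator_of_mem hjc]
      congr 1
      rw [hW, hW (y j)]
      congr 1
      refine Finset.sum_congr (Finset.filter_congr fun i hi => ⟨fun hlt => hlt.trans_le hjc.1,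
        fun hlt => ?_⟩) fun _ _ => rfl
      by_contra hcon
      have hic : y i ∈ cell n k := ⟨not_lt.1 hcon, hlt.trans hjc.2⟩
      have : i = j := hn hi hj ((mem_cell_iff.1 hic).trans (mem_cell_iff.1 hjc).symm)
      exact absurd hlt (by rw [this]; exact lt_irrefl _)
    · rw [Set.indicator_of_notMem hjc, Set.indicator_of_notMem hjc]
  · intro j hj
    refine Set.indicator_apply_eq_zero.2 fun hjc => hφ j _ ?_
    by_contra hcon
    exact hj ((hS j).2 ⟨cell_subset_Ico hk hjc, (not_lt.1 hcon).trans hN⟩)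

/-- The alternative in `hN` serves two purposes: a bound on the grid clock yields a bound on `W`,
and afterwards the bound on `W` yields equality on every separating grid. -/
lemma gridClock_eq (h : JumpFamily y a g) (hS : ∀ j, j ∈ S ↔ y j ∈ Ico (0 : ℝ) m ∧ a j ≤ N)
    (hW : ∀ s, W s = u₀ + ∑ j ∈ S with y j < s, g j (W (y j)))
    (hn : InjOn (fun j => ⌊((n : ℝ) + 1) * y j⌋) S) {K : ℕ} (hK : K ≤ m * (n + 1))
    (hN : ∀ k < K, gridClock u₀ y g n k ≤ N ∨ W (k / (n + 1)) ≤ N) :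
    ∀ k ≤ K, gridClock u₀ y g n k = W (k / (n + 1)) := by
  classical
  intro k
  induction k with
  | zero =>
    intro _
    rw [hW, Finset.filter_false_of_mem]
    · simp [gridClock]
    · intro j hj
      have := ((hS j).1 hj).1.1
      simpa using this
  | succ k ih =>
    intro hk
    have hk' : k < K := hk
    have ihk := ih hk'.le
    have hNk : W (k / (n + 1)) ≤ N := by
      rcases hN k hk' with h1 | h1
      · rwa [← ihk]
      · exact h1
    rw [gridClock, ihk, tsum_cell_eq (φ := fun j u => ENNReal.ofReal (g j u)) hS hW hn
      (hk'.trans_le hK) hNk (fun j u hu => by rw [h.eq_zero j u hu, ENNReal.ofReal_zero]),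
      ENNReal.toReal_sum (fun j _ => by
        refine ne_top_of_le_ne_top ENNReal.ofReal_ne_top (Set.indicator_le_self _ _ _)),
      hW (k / (n + 1)), hW (((k + 1 : ℕ) : ℝ) / (n + 1)), add_assoc, Finset.sum_filter,
      Finset.sum_filter, ← Finset.sum_add_distrib]
    congr 1
    refine Finset.sum_congr rfl fun j hj => ?_
    have h0 := ((hS j).1 hj).1.1
    have hiff : y j < ((k + 1 : ℕ) : ℝ) / (n + 1) ↔ y j < k / (n + 1) ∨ y j ∈ cell n k := by
      have := congrArg (fun s => y j ∈ s) (Ico_union_cell n k)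
      simp only [mem_union, mem_Ico, h0, true_and, eq_iff_iff] at this
      exact this.symm
    by_cases h1 : y j < k / (n + 1)
    · have h2 : y j ∉ cell n k := fun hc => absurd h1 (not_lt.2 hc.1)
      rw [if_pos h1, if_pos (hiff.2 (Or.inl h1)), Set.indicator_of_notMem h2]
      simp
    · by_cases h2 : y j ∈ cell n k
      · rw [if_neg h1, if_pos (hiff.2 (Or.inr h2)), Set.indicator_of_mem h2,
          ENNReal.toReal_ofReal (h.nonneg _ _), zero_add]
      · rw [if_neg h1, if_neg (fun hc => (hiff.1 hc).elim h1 h2), Set.indicator_of_notMem h2]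
        simp

end Finite

/-- If the total jumps of the grid clocks up to a position `m` do not explode, then there is a
clock up to `m`, and functionals of it are eventually equal to those of the grid clocks. -/
lemma exists_clock_nat (h : JumpFamily y a g) {m : ℕ} {L : ℝ}
    (hL : ∃ᶠ n in atTop, ∑ k ∈ Finset.range (m * (n + 1)), ∑' j, (cell n k).indicator
      (fun _ => ENNReal.ofReal (g j (gridClock u₀ y g n k))) (y j) ≤ ENNReal.ofReal L) :
    ∃ W : ℝ → ℝ, IsClock u₀ y g m W ∧ ∀ φ : ℕ → ℝ → ℝ≥0∞, (∀ j u, u < a j → φ j u = 0) →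
      ∀ᶠ n in atTop, ∑ k ∈ Finset.range (m * (n + 1)), ∑' j, (cell n k).indicator
        (fun _ => φ j (gridClock u₀ y g n k)) (y j)
        = ∑' j, (Ico (0 : ℝ) m).indicator (fun _ => φ j (W (y j))) (y j) := by
  classical
  -- The maximum with 0 is needed because `ENNReal.ofReal L` is 0 for negative `L`.
  let N := u₀ + max L 0
  let S := (h.finite m N).toFinset
  have hS : ∀ j, j ∈ S ↔ y j ∈ Ico (0 : ℝ) m ∧ a j ≤ N := fun j => (h.finite m N).mem_toFinset
  obtain ⟨W, hW⟩ := exists_finite_clock u₀ y g S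
  have hmono := h.finite_clock_mono hW
  have hsep := eventually_injOn_floor y S h.injective.injOn
  have hend : ∀ n : ℕ, (((m * (n + 1) : ℕ) : ℝ)) / (n + 1) = m := by
    intro n
    have hn : (0 : ℝ) < n + 1 := by positivity
    push_cast
    field_simp
  -- A single grid that both separates `S` and has total jump at most `L` suffices: its clock stays
  -- below `N` and coincides with `W` at the grid points.
  have hWm : W m ≤ N := by
    obtain ⟨n, hn, hsepn⟩ := (hL.and_eventually hsep).exists
    have hbound : ∀ k ≤ m * (n + 1), gridClock u₀ y g n k ≤ N := by
      have hsum : ∀ k, gridClock u₀ y g n k = u₀ + ∑ i ∈ Finset.range k, (∑' j,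
          (cell n i).indicator (fun _ => ENNReal.ofReal (g j (gridClock u₀ y g n i)))
            (y j)).toReal := by
        intro k
        induction k with
        | zero => simp [gridClock]
        | succ k ih => rw [gridClock, Finset.sum_range_succ, ← add_assoc, ← ih]
      intro k hk
      rw [hsum k]
      refine add_le_add le_rfl ?_
      have hfin := ne_top_of_le_ne_top ENNReal.ofReal_ne_top hn
      have hle : ∑ i ∈ Finset.range k, (∑' j, (cell n i).indicator
          (fun _ => ENNReal.ofReal (g j (gridClock u₀ y g n i))) (y j))
          ≤ ENNReal.ofReal (max L 0) :=
        (Finset.sum_le_sum_of_subset (Finset.range_mono hk)).trans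
          (hn.trans (ENNReal.ofReal_le_ofReal (le_max_left _ _)))
      rw [← ENNReal.toReal_sum]
      · exact ENNReal.toReal_le_of_le_ofReal (le_max_right _ _) hle
      · intro i hi
        refine ne_top_of_le_ne_top (ne_top_of_le_ne_top ENNReal.ofReal_ne_top hle) ?_
        exact Finset.single_le_sum (f := fun i => ∑' j, (cell n i).indicator
          (fun _ => ENNReal.ofReal (g j (gridClock u₀ y g n i))) (y j)) (fun _ _ => zero_le) hi
    have heq := h.gridClock_eq hS hW hsepn le_rfl (fun k hk => Or.inl (hbound k hk.le)) _ le_rfl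
    rw [hend n] at heq
    rw [← heq]
    exact hbound _ le_rfl
  refine ⟨W, h.finite_clock_isClock hS hW hWm, fun φ hφ => ?_⟩
  filter_upwards [hsep] with n hn
  have hWk : ∀ k ≤ m * (n + 1), W (k / (n + 1)) ≤ N := by
    intro k hk
    refine (hmono ?_).trans hWm
    rw [← hend n]
    gcongr
  have heq := h.gridClock_eq hS hW hn le_rfl (fun k hk => Or.inr (hWk k hk.le))
  have h1 : ∀ k ∈ Finset.range (m * (n + 1)), ∑' j, (cell n k).indicator
        (fun _ => φ j (gridClock u₀ y g n k)) (y j)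
      = ∑ j ∈ S, (cell n k).indicator (fun _ => φ j (W (y j))) (y j) := by
    intro k hk
    rw [Finset.mem_range] at hk
    rw [heq k hk.le]
    exact tsum_cell_eq hS hW hn hk (hWk k hk.le) hφ
  rw [Finset.sum_congr rfl h1, Finset.sum_comm, tsum_eq_sum (s := S)]
  · exact Finset.sum_congr rfl fun j _ => sum_indicator_cell n m _ _
  · intro j hj
    refine Set.indicator_apply_eq_zero.2 fun hjm => hφ j _ ?_
    by_contra hcon
    exact hj ((hS j).2 ⟨hjm, (not_lt.1 hcon).trans ((hmono hjm.2.le).trans hWm)⟩)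

/-- If the total jumps of the grid clocks do not explode at finite positions, then there is a
clock, and functionals of it are eventually equal to those of the grid clocks. -/
theorem exists_clock (h : JumpFamily y a g)
    (hL : ∀ m : ℕ, ∃ L : ℝ, ∃ᶠ n in atTop, ∑ k ∈ Finset.range (m * (n + 1)),
      ∑' j, (cell n k).indicator (fun _ => ENNReal.ofReal (g j (gridClock u₀ y g n k))) (y j)
        ≤ ENNReal.ofReal L) :
    ∃ W : ℝ → ℝ, (∀ d, IsClock u₀ y g d W) ∧
      ∀ φ : ℕ → ℝ → ℝ≥0∞, (∀ j u, u < a j → φ j u = 0) → ∀ m : ℕ,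
        ∀ᶠ n in atTop, ∑ k ∈ Finset.range (m * (n + 1)), ∑' j, (cell n k).indicator
          (fun _ => φ j (gridClock u₀ y g n k)) (y j)
          = ∑' j, (Ico (0 : ℝ) m).indicator (fun _ => φ j (W (y j))) (y j) := by
  choose L hL using hL
  choose V hV hVφ using fun m => h.exists_clock_nat (hL m)
  -- The clocks on the intervals `[0, m]` are glued; uniqueness makes them agree on overlaps.
  let W : ℝ → ℝ := fun s => V ⌈s⌉₊ s
  have hWV : ∀ m : ℕ, ∀ s ∈ Icc (0 : ℝ) m, W s = V m s := by
    intro m s hs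
    have hle : ((⌈s⌉₊ : ℕ) : ℝ) ≤ m := by
      exact_mod_cast Nat.ceil_le.2 hs.2
    exact h.isClock_unique (hV ⌈s⌉₊) (fun r hr => hV m r ⟨hr.1, hr.2.trans hle⟩)
      ⟨hs.1, Nat.le_ceil s⟩
  refine ⟨W, fun d s hs => ?_, fun φ hφ m => ?_⟩
  · have hsm : s ∈ Icc (0 : ℝ) ⌈s⌉₊ := ⟨hs.1, Nat.le_ceil s⟩
    have h1 := hV ⌈s⌉₊ s hsm
    rw [hWV _ s hsm]
    convert h1 using 1
    refine Set.indicator_congr fun j hj => ?_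
    have hj' : y j ∈ Ico 0 s := hj
    rw [hWV ⌈s⌉₊ (y j) ⟨hj'.1, hj'.2.le.trans hsm.2⟩]
  · filter_upwards [hVφ m φ hφ] with n hn
    rw [hn]
    congr 1 with j
    by_cases hj : y j ∈ Ico (0 : ℝ) m
    · rw [Set.indicator_of_mem hj, Set.indicator_of_mem hj, hWV m _ ⟨hj.1, hj.2.le⟩]
    · rw [Set.indicator_of_notMem hj, Set.indicator_of_notMem hj]

end JumpFamily

end Clock

end RoadObstacles

namespace RoadObstacles

/-! ### Moments of sums along the grid clock -/

section Variance

variable {Ω : Type*} [MeasurableSpace Ω] {P : Measure Ω} [IsProbabilityMeasure P]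

/-- The second moment of a shifted centered random variable. -/
lemma lintegral_add_centered_sq_le {ξ : Ω → ℝ≥0∞} (hξ : Measurable ξ) {v : ℝ≥0∞} (hv : v ≠ ∞)
    (h1 : ∫⁻ ω, ξ ω ∂P ≠ ∞) (h2 : ∫⁻ ω, ξ ω ^ 2 ∂P ≤ v + (∫⁻ ω, ξ ω ∂P) ^ 2) (r : ℝ) :
    ∫⁻ ω, ENNReal.ofReal ((r + ((ξ ω).toReal - (∫⁻ ω, ξ ω ∂P).toReal)) ^ 2) ∂P
      ≤ ENNReal.ofReal (r ^ 2) + v := by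
  set c := (∫⁻ ω, ξ ω ∂P).toReal with hc
  have h2' : ∫⁻ ω, ξ ω ^ 2 ∂P ≠ ∞ :=
    ne_top_of_le_ne_top (ENNReal.add_ne_top.2 ⟨hv, ENNReal.pow_ne_top h1⟩) h2
  have i1 : Integrable (fun ω => (ξ ω).toReal) P := integrable_toReal_of_lintegral_ne_top
    hξ.aemeasurable h1
  have i2 : Integrable (fun ω => (ξ ω).toReal ^ 2) P := by
    have := integrable_toReal_of_lintegral_ne_top (hξ.pow_const 2).aemeasurable h2'
    simpa only [ENNReal.toReal_pow] using this
  have e1 : ∫ ω, (ξ ω).toReal ∂P = c := integral_toReal hξ.aemeasurable (ae_lt_top hξ h1)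
  have e2 : ∫ ω, (ξ ω).toReal ^ 2 ∂P ≤ v.toReal + c ^ 2 := by
    have := integral_toReal (hξ.pow_const 2).aemeasurable (ae_lt_top (hξ.pow_const 2) h2')
    simp only [ENNReal.toReal_pow] at this
    rw [this, hc, ← ENNReal.toReal_pow, ← ENNReal.toReal_add hv (ENNReal.pow_ne_top h1)]
    exact ENNReal.toReal_mono (ENNReal.add_ne_top.2 ⟨hv, ENNReal.pow_ne_top h1⟩) h2
  have hexp : ∀ ω, (r + ((ξ ω).toReal - c)) ^ 2
      = (ξ ω).toReal ^ 2 + 2 * (r - c) * (ξ ω).toReal + (r - c) ^ 2 := fun ω => by ring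
  have i3 := i2.add (i1.const_mul (2 * (r - c)))
  have i4 : Integrable (fun ω => (r + ((ξ ω).toReal - c)) ^ 2) P := by
    simp_rw [hexp]
    exact i3.add (integrable_const _)
  rw [← ofReal_integral_eq_lintegral_ofReal i4 (Eventually.of_forall fun ω => sq_nonneg _),
    ← ENNReal.ofReal_toReal hv, ← ENNReal.ofReal_add (sq_nonneg _) ENNReal.toReal_nonneg]
  refine ENNReal.ofReal_le_ofReal ?_
  have e3 : ∫ ω, (r + ((ξ ω).toReal - c)) ^ 2 ∂P
      = ∫ ω, (ξ ω).toReal ^ 2 ∂P + 2 * (r - c) * c + (r - c) ^ 2 := by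
    simp_rw [hexp]
    rw [integral_add (f := fun ω => (ξ ω).toReal ^ 2 + 2 * (r - c) * (ξ ω).toReal) i3
      (integrable_const _), integral_add i2 (i1.const_mul _), integral_const_mul, e1]
    simp
  -- With c the mean and second moment at most v + c², the cross terms cancel and r² + v remains.
  rw [e3]
  nlinarith

end Variance

/-- The σ-algebra of the field before the cell `k` of the grid number `n`. -/
@[reducible]
def past {Ω E : Type*} [MeasurableSpace E] (X : E → ℝ) (p : ℕ → Ω → E) (n k : ℕ) :
    MeasurableSpace Ω :=
  voidSigma p (X ⁻¹' Ico (0 : ℝ) ((k : ℝ) / (n + 1)))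

namespace SimpleField

variable {Ω E : Type*} {mΩ : MeasurableSpace Ω} {mE : MeasurableSpace E} {P : Measure Ω}
  {X : E → ℝ} {level : E → ℕ} {μ : Measure E} {p : ℕ → Ω → E}

/-- The sum of `φ` over the points in the cell `k` of the grid number `n`. -/
noncomputable def cellSum (X : E → ℝ) (p : ℕ → Ω → E) (n k : ℕ) (φ : E → ℝ≥0∞) (ω : Ω) : ℝ≥0∞ :=
  ∑' j, (cell n k).indicator (fun _ => φ (p j ω)) (X (p j ω))

/-- The grid clock that is driven by the points of the field. -/
noncomputable def clock (u₀ : ℝ) (X : E → ℝ) (p : ℕ → Ω → E) (f : E × ℝ → ℝ) (n k : ℕ) (ω : Ω) :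
    ℝ :=
  gridClock u₀ (fun j => X (p j ω)) (fun j u => f (p j ω, u)) n k

/-- The centered sum of `φ (·, U)` over the points in the first cells of the grid, where `U` is
the current state of the grid clock. -/
noncomputable def centered (u₀ : ℝ) (X : E → ℝ) (μ : Measure E) (p : ℕ → Ω → E) (f : E × ℝ → ℝ)
    (φ : E × ℝ → ℝ≥0∞) (n k : ℕ) (ω : Ω) : ℝ :=
  ∑ i ∈ Finset.range k,
    ((cellSum X p n i (fun e => φ (e, clock u₀ X p f n i ω)) ω).toReal
      - (∫⁻ e in X ⁻¹' cell n i, φ (e, clock u₀ X p f n i ω) ∂μ).toReal)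

lemma cellSum_eq (X : E → ℝ) (p : ℕ → Ω → E) (n k : ℕ) (φ : E → ℝ≥0∞) (ω : Ω) :
    cellSum X p n k φ ω = ∑' j, (X ⁻¹' cell n k).indicator φ (p j ω) := rfl

lemma past_le (h : SimpleField P X level μ p) (n k : ℕ) : past X p n k ≤ mΩ :=
  voidSigma_le h.measurable _

lemma past_mono (n k : ℕ) : past X p n k ≤ past X p n (k + 1) := by
  refine voidSigma_mono p (preimage_mono ?_)
  rw [← Ico_union_cell]
  exact subset_union_left

lemma voidSigma_cell_le_past (n k : ℕ) : voidSigma p (X ⁻¹' cell n k) ≤ past X p n (k + 1) := by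
  refine voidSigma_mono p (preimage_mono ?_)
  rw [← Ico_union_cell]
  exact subset_union_right

lemma measurable_cellSum_uncurry (h : SimpleField P X level μ p) {S : Type*}
    [mS : MeasurableSpace S] (n k : ℕ) {φ : E × S → ℝ≥0∞} (hφ : Measurable φ) :
    Measurable[(voidSigma p (X ⁻¹' cell n k)).prod mS]
      fun q : Ω × S => cellSum X p n k (fun e => φ (e, q.2)) q.1 :=
  h.measurable_tsum_uncurry (h.measurable_pos (measurableSet_cell n k)) hφ

lemma measurable_cellSum (h : SimpleField P X level μ p) (n k : ℕ) {φ : E → ℝ≥0∞}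
    (hφ : Measurable φ) : Measurable (cellSum X p n k φ) :=
  h.measurable_tsum (hφ.indicator (h.measurable_pos (measurableSet_cell n k)))

/-- Sums over a cell with a parameter that is determined by the past are determined by the past
of the next cell. -/
lemma measurable_cellSum_past (h : SimpleField P X level μ p) {S : Type*}
    [MeasurableSpace S] {n k : ℕ} {φ : E × S → ℝ≥0∞} (hφ : Measurable φ) {V : Ω → S}
    (hV : Measurable[past X p n k] V) :
    Measurable[past X p n (k + 1)] fun ω => cellSum X p n k (fun e => φ (e, V ω)) ω := by
  have h1 := h.measurable_cellSum_uncurry n k hφ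
  exact h1.comp ((measurable_id'' (voidSigma_cell_le_past n k)).prodMk
    (hV.mono (past_mono n k) le_rfl))

/-- The clock is predictable: its state at cell `k` uses only the earlier cells, which is what makes
it independent of the field in cell `k`. -/
lemma measurable_clock (h : SimpleField P X level μ p) (u₀ : ℝ) {f : E × ℝ → ℝ}
    (hf : Measurable f) (n k : ℕ) : Measurable[past X p n k] (clock u₀ X p f n k) := by
  induction k with
  | zero => exact measurable_const
  | succ k ih =>
    exact (ih.mono (past_mono n k) le_rfl).add (h.measurable_cellSum_past
      (φ := fun q => ENNReal.ofReal (f q)) hf.ennreal_ofReal ih).ennreal_toReal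

lemma measurable_lintegral_cell [SFinite μ] (n k : ℕ)
    {φ : E × ℝ → ℝ≥0∞} (hφ : Measurable φ) :
    Measurable fun u => ∫⁻ e in X ⁻¹' cell n k, φ (e, u) ∂μ :=
  hφ.lintegral_prod_left'

lemma measurable_centered [SFinite μ] (h : SimpleField P X level μ p) (u₀ : ℝ) {f : E × ℝ → ℝ}
    (hf : Measurable f) {φ : E × ℝ → ℝ≥0∞} (hφ : Measurable φ) (n k : ℕ) :
    Measurable[past X p n k] (centered u₀ X μ p f φ n k) := by
  induction k with
  | zero =>
    have : centered u₀ X μ p f φ n 0 = fun _ => 0 := by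
      ext ω
      simp [centered]
    rw [this]
    exact measurable_const
  | succ k ih =>
    have hc := h.measurable_clock u₀ hf n k
    have : centered u₀ X μ p f φ n (k + 1) = fun ω => centered u₀ X μ p f φ n k ω +
        ((cellSum X p n k (fun e => φ (e, clock u₀ X p f n k ω)) ω).toReal
          - (∫⁻ e in X ⁻¹' cell n k, φ (e, clock u₀ X p f n k ω) ∂μ).toReal) := by
      ext ω
      rw [centered, Finset.sum_range_succ]
      rfl
    rw [this]
    refine (ih.mono (past_mono n k) le_rfl).add
      ((h.measurable_cellSum_past hφ hc).ennreal_toReal.sub ?_)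
    exact ((measurable_lintegral_cell n k hφ).ennreal_toReal.comp hc).mono (past_mono n k) le_rfl

lemma lintegral_cellSum (h : SimpleField P X level μ p) (n k : ℕ) {φ : E → ℝ≥0∞}
    (hφ : Measurable φ) :
    ∫⁻ ω, cellSum X p n k φ ω ∂P = ∫⁻ e in X ⁻¹' cell n k, φ e ∂μ := by
  have hm := h.measurable_pos (measurableSet_cell n k)
  simp only [cellSum_eq]
  rw [h.lintegral_tsum (hφ.indicator hm), lintegral_indicator hm]

lemma lintegral_cellSum_sq_le [IsProbabilityMeasure P] (h : SimpleField P X level μ p) (n k : ℕ)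
    {φ : E → ℝ≥0∞} (hφ : Measurable φ) :
    ∫⁻ ω, cellSum X p n k φ ω ^ 2 ∂P
      ≤ ∫⁻ e in X ⁻¹' cell n k, φ e ^ 2 ∂μ + (∫⁻ e in X ⁻¹' cell n k, φ e ∂μ) ^ 2 := by
  have hm := h.measurable_pos (measurableSet_cell n k)
  simp only [cellSum_eq]
  refine (h.lintegral_tsum_sq_le (hφ.indicator hm)).trans_eq ?_
  have hsq : ∀ e, (X ⁻¹' cell n k).indicator φ e ^ 2
      = (X ⁻¹' cell n k).indicator (fun e => φ e ^ 2) e := by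
    intro e
    by_cases he : e ∈ X ⁻¹' cell n k
    · rw [Set.indicator_of_mem he, Set.indicator_of_mem he]
    · rw [Set.indicator_of_notMem he, Set.indicator_of_notMem he, zero_pow two_ne_zero]
  simp_rw [hsq]
  rw [lintegral_indicator hm, lintegral_indicator hm]

/-- The field in a cell is independent of the past. -/
lemma lintegral_past_cellSum [IsProbabilityMeasure P] (h : SimpleField P X level μ p) {S : Type*}
    [MeasurableSpace S] {n k : ℕ} {φ : E × S → ℝ≥0∞} (hφ : Measurable φ) {V : Ω → S}
    (hV : Measurable[past X p n k] V) {G : S × ℝ≥0∞ → ℝ≥0∞} (hG : Measurable G) :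
    ∫⁻ ω, G (V ω, cellSum X p n k (fun e => φ (e, V ω)) ω) ∂P
      = ∫⁻ ω, ∫⁻ ω', G (V ω, cellSum X p n k (fun e => φ (e, V ω)) ω') ∂P ∂P := by
  have h1 := h.measurable_cellSum_uncurry n k hφ
  refine lintegral_diag_of_indep (h.past_le n k) (voidSigma_le h.measurable (X ⁻¹' cell n k))
    (h.indep measurableSet_Ico (measurableSet_cell n k) (disjoint_Ico_cell n k))
    (Ψ := fun q => G (V q.1, cellSum X p n k (fun e => φ (e, V q.1)) q.2)) ?_
  have hV1 : Measurable[(past X p n k).prod (voidSigma p (X ⁻¹' cell n k))]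
      fun q : Ω × Ω => V q.1 := hV.comp (@measurable_fst _ _ (past X p n k) _)
  refine hG.comp (hV1.prodMk ?_)
  exact h1.comp ((@measurable_snd _ _ (past X p n k) (voidSigma p (X ⁻¹' cell n k))).prodMk hV1)

/-- The first moment of a sum over the points met by the grid clock. -/
theorem lintegral_sum_cellSum_le [IsProbabilityMeasure P] (h : SimpleField P X level μ p)
    {u₀ : ℝ} {f : E × ℝ → ℝ} (hf : Measurable f) {φ : E × ℝ → ℝ≥0∞} (hφ : Measurable φ) {C : ℝ≥0∞}
    {n : ℕ} (hC : ∀ k u, u₀ ≤ u → ∫⁻ e in X ⁻¹' cell n k, φ (e, u) ∂μ ≤ C * volume (cell n k))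
    (K : ℕ) :
    ∫⁻ ω, ∑ k ∈ Finset.range K, cellSum X p n k (fun e => φ (e, clock u₀ X p f n k ω)) ω ∂P
      ≤ ∑ k ∈ Finset.range K, C * volume (cell n k) := by
  have hmeas : ∀ k, Measurable fun ω => cellSum X p n k
      (fun e => φ (e, clock u₀ X p f n k ω)) ω := fun k =>
    (h.measurable_cellSum_past hφ (h.measurable_clock u₀ hf n k)).mono (h.past_le n _) le_rfl
  rw [lintegral_finsetSum _ fun k _ => hmeas k]
  refine Finset.sum_le_sum fun k _ => ?_
  rw [h.lintegral_past_cellSum (G := Prod.snd) hφ (h.measurable_clock u₀ hf n k) measurable_snd]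
  calc _ ≤ ∫⁻ _, C * volume (cell n k) ∂P := by
        refine lintegral_mono fun ω => ?_
        change ∫⁻ ω', cellSum X p n k (fun e => φ (e, clock u₀ X p f n k ω)) ω' ∂P ≤ _
        rw [h.lintegral_cellSum n k (φ := fun e => φ (e, clock u₀ X p f n k ω))
          (hφ.comp (measurable_id.prodMk measurable_const))]
        exact hC k _ (le_gridClock n k)
    _ = _ := by simp

/-- The second moment of a centered sum over the points met by the grid clock. -/
theorem lintegral_centered_sq_le [IsProbabilityMeasure P] [SFinite μ]
    (h : SimpleField P X level μ p) {u₀ : ℝ} {f : E × ℝ → ℝ} (hf : Measurable f)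
    {φ : E × ℝ → ℝ≥0∞} (hφ : Measurable φ) {C C₂ : ℝ≥0∞} (hCtop : C ≠ ∞) (hC₂top : C₂ ≠ ∞) {n : ℕ}
    (hC : ∀ k u, u₀ ≤ u → ∫⁻ e in X ⁻¹' cell n k, φ (e, u) ∂μ ≤ C * volume (cell n k))
    (hC₂ : ∀ k u, u₀ ≤ u → ∫⁻ e in X ⁻¹' cell n k, φ (e, u) ^ 2 ∂μ ≤ C₂ * volume (cell n k))
    (K : ℕ) :
    ∫⁻ ω, ENNReal.ofReal (centered u₀ X μ p f φ n K ω ^ 2) ∂P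
      ≤ ∑ k ∈ Finset.range K, C₂ * volume (cell n k) := by
  induction K with
  | zero => simp [centered]
  | succ K ih =>
    rw [Finset.sum_range_succ]
    refine le_trans ?_ (add_le_add ih le_rfl)
    have hvol : volume (cell n K) ≠ ∞ := by
      rw [cell, Real.volume_Ico]
      exact ENNReal.ofReal_ne_top
    let c : ℝ → ℝ := fun u => (∫⁻ e in X ⁻¹' cell n K, φ (e, u) ∂μ).toReal
    have hc : Measurable c := (measurable_lintegral_cell n K hφ).ennreal_toReal
    have hclock := h.measurable_clock u₀ hf n K
    have hcent := h.measurable_centered u₀ hf hφ n K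
    -- Both the clock and the accumulated centered sum are frozen, so the next increment has mean
    -- zero given the past and its second moment simply adds.
    let V : Ω → ℝ × ℝ := fun ω => (clock u₀ X p f n K ω, centered u₀ X μ p f φ n K ω)
    have hV : Measurable[past X p n K] V := hclock.prodMk hcent
    let G : (ℝ × ℝ) × ℝ≥0∞ → ℝ≥0∞ := fun q =>
      ENNReal.ofReal ((q.1.2 + (q.2.toReal - c q.1.1)) ^ 2)
    have hG : Measurable G := by
      refine ((Measurable.add (by fun_prop) (Measurable.sub (by fun_prop)
        (hc.comp (by fun_prop)))).pow_const 2).ennreal_ofReal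
    have hφ' : Measurable fun q : E × (ℝ × ℝ) => φ (q.1, q.2.1) := hφ.comp (by fun_prop)
    have e1 : ∀ ω, ENNReal.ofReal (centered u₀ X μ p f φ n (K + 1) ω ^ 2)
        = G (V ω, cellSum X p n K (fun e => φ (e, (V ω).1)) ω) := by
      intro ω
      rw [centered, Finset.sum_range_succ]
      rfl
    simp_rw [e1]
    rw [h.lintegral_past_cellSum hφ' hV hG]
    calc _ ≤ ∫⁻ ω, (ENNReal.ofReal (centered u₀ X μ p f φ n K ω ^ 2)
            + C₂ * volume (cell n K)) ∂P := by
          refine lintegral_mono fun ω => ?_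
          have hu : u₀ ≤ clock u₀ X p f n K ω := le_gridClock n K
          have hφu : Measurable fun e => φ (e, clock u₀ X p f n K ω) :=
            hφ.comp (measurable_id.prodMk measurable_const)
          have m1 := h.lintegral_cellSum n K hφu
          have m2 := h.lintegral_cellSum_sq_le n K hφu
          rw [← m1] at m2
          have := lintegral_add_centered_sq_le (P := P) (h.measurable_cellSum n K hφu)
            (v := C₂ * volume (cell n K)) (ENNReal.mul_ne_top hC₂top hvol)
            (by rw [m1]; exact ne_top_of_le_ne_top (ENNReal.mul_ne_top hCtop hvol) (hC K _ hu))
            (m2.trans (add_le_add (hC₂ K _ hu) le_rfl)) (centered u₀ X μ p f φ n K ω)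
          rw [m1] at this
          exact this
      _ = _ := by
          rw [lintegral_add_right _ measurable_const]
          simp

end SimpleField

lemma sum_volume_cell (C : ℝ≥0∞) (n m : ℕ) :
    ∑ k ∈ Finset.range (m * (n + 1)), C * volume (cell n k) = C * m := by
  have hn : (0 : ℝ) < n + 1 := by positivity
  have h1 : ∀ k, volume (cell n k) = ENNReal.ofReal (1 / (n + 1)) := by
    intro k
    rw [cell, Real.volume_Ico]
    congr 1
    field_simp
    ring
  simp_rw [h1]
  rw [Finset.sum_const, Finset.card_range, nsmul_eq_mul, mul_left_comm]
  congr 1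
  rw [← ENNReal.ofReal_natCast, ← ENNReal.ofReal_mul (by positivity), ← ENNReal.ofReal_natCast]
  congr 1
  push_cast
  field_simp

end RoadObstacles

namespace RoadObstacles

/-! ### The intensity of the delays -/

section Encounter

/-- Obstacles with their coordinates, moments of appearance, lifetimes and bypass times. -/
abbrev Obstacle : Type := ((ℝ × ℝ) × ℝ) × ℝ≥0∞

/-- The position of an obstacle relative to `x₀`. -/
def position (x₀ : ℝ) (e : Obstacle) : ℝ := e.1.1.1 - x₀

/-- The delay at an obstacle of a car that has been idle until the moment `u`. -/
noncomputable def jump (v x₀ : ℝ) (q : Obstacle × ℝ) : ℝ :=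
  delay q.1.1.1.2 q.1.1.2 q.1.2 (q.2 + position x₀ q.1 / v)

/-- The intensity of obstacles with marks. -/
noncomputable def obstacleIntensity (lam : ℝ) (Q : Measure ℝ) (F : Measure ℝ≥0∞) :
    Measure Obstacle := ((spaceTimeIntensity lam).prod Q).prod F

/-- The joint intensity of the lifetime, the bypass time and the residual lifetime of the obstacles
that are present at a fixed moment. -/
noncomputable def encounter (Q : Measure ℝ) (F : Measure ℝ≥0∞) : Measure (ℝ × ℝ≥0∞ × ℝ) :=
  (Q.prod (F.prod volume)).restrict {q | q.2.2 ∈ Ioc 0 q.1}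

/-- The time lost at an obstacle in terms of the bypass time and the residual lifetime. -/
noncomputable def wait (q : ℝ × ℝ≥0∞ × ℝ) : ℝ≥0∞ := min q.2.1 (ENNReal.ofReal q.2.2)

lemma measurable_wait : Measurable wait := by
  unfold wait
  fun_prop

lemma measurable_position (x₀ : ℝ) : Measurable (position x₀) := by
  unfold position
  fun_prop

lemma delay_nonneg (t τ : ℝ) (η : ℝ≥0∞) (s : ℝ) : 0 ≤ delay t τ η s := by
  unfold delay
  split_ifs
  · exact ENNReal.toReal_nonneg
  · exact le_rfl

lemma measurable_delay :
    Measurable fun q : (ℝ × ℝ) × ℝ≥0∞ × ℝ => delay q.1.1 q.1.2 q.2.1 q.2.2 := by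
  unfold delay
  refine Measurable.ite ?_ (by fun_prop) measurable_const
  exact (measurableSet_le (f := fun q : (ℝ × ℝ) × ℝ≥0∞ × ℝ => q.1.1) (g := fun q => q.2.2)
    (by fun_prop) (by fun_prop)).inter (measurableSet_lt
      (f := fun q : (ℝ × ℝ) × ℝ≥0∞ × ℝ => q.2.2) (g := fun q => q.1.1 + q.1.2)
      (by fun_prop) (by fun_prop))

lemma measurable_jump (v x₀ : ℝ) : Measurable (jump v x₀) := by
  have h : Measurable fun q : Obstacle × ℝ =>
      ((q.1.1.1.2, q.1.1.2), q.1.2, q.2 + position x₀ q.1 / v) := by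
    have := measurable_position x₀
    fun_prop
  exact measurable_delay.comp h

lemma measurableSet_encounter : MeasurableSet {q : ℝ × ℝ≥0∞ × ℝ | q.2.2 ∈ Ioc 0 q.1} :=
  (measurableSet_lt (f := fun _ : ℝ × ℝ≥0∞ × ℝ => (0 : ℝ)) (g := fun q => q.2.2)
    (by fun_prop) (by fun_prop)).inter (measurableSet_le
      (f := fun q : ℝ × ℝ≥0∞ × ℝ => q.2.2) (g := fun q => q.1) (by fun_prop) (by fun_prop))

lemma measurableSet_age (s : ℝ) : MeasurableSet {q : ℝ × ℝ≥0∞ × ℝ | q.1 - q.2.2 ≤ s} :=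
  measurableSet_le (by fun_prop) (by fun_prop)

variable {ψ : ℝ≥0∞ → ℝ≥0∞}

/-- The substitution of the residual lifetime for the moment of appearance. -/
lemma lintegral_delay (hψ0 : ψ 0 = 0) (τ : ℝ) (η : ℝ≥0∞) (s : ℝ) :
    ∫⁻ t in Ici 0, ψ (ENNReal.ofReal (delay t τ η s))
      = ∫⁻ r, (Ioc 0 τ ∩ {r | τ - r ≤ s}).indicator (fun r => ψ (min η (ENNReal.ofReal r))) r := by
  -- Substituting r = t + τ - s turns presence, t ≤ s < t + τ, into 0 < r ≤ τ, and t ≥ 0 into the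
  -- age condition τ - r ≤ s.
  rw [← lintegral_indicator measurableSet_Ici, ← lintegral_add_right_eq_self
    ((Ioc 0 τ ∩ {r | τ - r ≤ s}).indicator fun r => ψ (min η (ENNReal.ofReal r))) (τ - s)]
  congr 1 with t
  by_cases h0 : 0 ≤ t
  · rw [Set.indicator_of_mem (show t ∈ Ici 0 from h0)]
    by_cases h1 : t ≤ s ∧ s < t + τ
    · have hmem : t + (τ - s) ∈ Ioc 0 τ ∩ {r | τ - r ≤ s} := by
        refine ⟨⟨by linarith [h1.2], by linarith [h1.1]⟩, ?_⟩
        change τ - (t + (τ - s)) ≤ s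
        linarith
      rw [Set.indicator_of_mem hmem, delay, if_pos h1, ENNReal.ofReal_toReal, add_sub_assoc]
      exact ne_top_of_le_ne_top ENNReal.ofReal_ne_top (min_le_right _ _)
    · have hmem : t + (τ - s) ∉ Ioc 0 τ ∩ {r | τ - r ≤ s} := by
        rintro ⟨⟨h2, h3⟩, _⟩
        exact h1 ⟨by linarith, by linarith⟩
      rw [Set.indicator_of_notMem hmem, delay, if_neg h1, ENNReal.ofReal_zero, hψ0]
  · have hmem : t + (τ - s) ∉ Ioc 0 τ ∩ {r | τ - r ≤ s} := by
      rintro ⟨_, h2⟩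
      have h2' : τ - (t + (τ - s)) ≤ s := h2
      exact h0 (by linarith)
    rw [Set.indicator_of_notMem hmem, Set.indicator_of_notMem (by simpa using h0)]

lemma lintegral_encounter (Q : Measure ℝ) [SFinite Q] (F : Measure ℝ≥0∞) [SFinite F]
    (hψ : Measurable ψ) {A : Set (ℝ × ℝ≥0∞ × ℝ)} (hA : MeasurableSet A) :
    ∫⁻ q in A, ψ (wait q) ∂(encounter Q F) = ∫⁻ τ, ∫⁻ η, (∫⁻ r,
      ({q : ℝ × ℝ≥0∞ × ℝ | q.2.2 ∈ Ioc 0 q.1} ∩ A).indicator (fun q => ψ (wait q)) (τ, η, r))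
        ∂F ∂Q := by
  have hm := (hψ.comp measurable_wait).indicator (measurableSet_encounter.inter hA)
  rw [encounter, Measure.restrict_restrict hA, inter_comm,
    ← lintegral_indicator (measurableSet_encounter.inter hA)]
  change ∫⁻ q, (_ : Set _).indicator (ψ ∘ wait) q ∂_ = _
  rw [lintegral_prod _ hm.aemeasurable]
  congr 1 with τ
  exact lintegral_prod _ (hm.comp
    (by fun_prop : Measurable fun q : ℝ≥0∞ × ℝ => (τ, q))).aemeasurable

/-- The intensity of the delays of a car that arrives at a moment `s`. -/
lemma lintegral_lintegral_delay (Q : Measure ℝ) [SFinite Q] (F : Measure ℝ≥0∞) [SFinite F]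
    (hψ : Measurable ψ) (hψ0 : ψ 0 = 0) (s : ℝ) :
    ∫⁻ t in Ici 0, ∫⁻ τ, ∫⁻ η, ψ (ENNReal.ofReal (delay t τ η s)) ∂F ∂Q
      = ∫⁻ q in {q | q.1 - q.2.2 ≤ s}, ψ (wait q) ∂(encounter Q F) := by
  have hm : Measurable fun q : (ℝ × ℝ) × ℝ≥0∞ => ψ (ENNReal.ofReal (delay q.1.1 q.1.2 q.2 s)) :=
    hψ.comp (measurable_delay.comp (by fun_prop :
      Measurable fun q : (ℝ × ℝ) × ℝ≥0∞ => ((q.1.1, q.1.2), q.2, s))).ennreal_ofReal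
  rw [lintegral_lintegral_swap hm.lintegral_prod_right'.aemeasurable,
    lintegral_encounter Q F hψ (measurableSet_age s)]
  congr 1 with τ
  rw [lintegral_lintegral_swap (f := fun t η => ψ (ENNReal.ofReal (delay t τ η s)))
    (hm.comp (by fun_prop : Measurable fun q : ℝ × ℝ≥0∞ => ((q.1, τ), q.2))).aemeasurable]
  congr 1 with η
  rw [lintegral_delay hψ0]
  rfl

/-- The intensity of the delays of a car that has been idle until the moment `u`. -/
lemma lintegral_jump (lam v x₀ : ℝ) (Q : Measure ℝ) [SFinite Q] (F : Measure ℝ≥0∞) [SFinite F]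
    (hψ : Measurable ψ) (hψ0 : ψ 0 = 0) {I : Set ℝ} (hI : MeasurableSet I) (u : ℝ) :
    ∫⁻ e in position x₀ ⁻¹' I, ψ (ENNReal.ofReal (jump v x₀ (e, u))) ∂(obstacleIntensity lam Q F)
      = ENNReal.ofReal lam * ∫⁻ y in I, ∫⁻ q in {q | q.1 - q.2.2 ≤ u + y / v}, ψ (wait q)
        ∂(encounter Q F) := by
  have hpos : MeasurableSet (position x₀ ⁻¹' I) := measurable_position x₀ hI
  have hm : Measurable fun e : Obstacle => ψ (ENNReal.ofReal (jump v x₀ (e, u))) :=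
    hψ.comp ((measurable_jump v x₀).comp (by fun_prop)).ennreal_ofReal
  have hm1 := hm.indicator hpos
  have hμ : spaceTimeIntensity lam
      = ENNReal.ofReal lam • (volume : Measure ℝ).prod (volume.restrict (Ici 0)) := by
    rw [spaceTimeIntensity, Measure.volume_eq_prod, ← Measure.prod_restrict, Measure.restrict_univ]
  rw [← lintegral_indicator hpos, obstacleIntensity, lintegral_prod _ hm1.aemeasurable,
    lintegral_prod _ hm1.lintegral_prod_right'.aemeasurable, hμ, lintegral_smul_measure,
    lintegral_prod _ hm1.lintegral_prod_right'.lintegral_prod_right'.aemeasurable, smul_eq_mul,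
    ← lintegral_indicator hI, ← lintegral_add_right_eq_self _ x₀]
  congr 2 with y
  by_cases hy : y ∈ I
  · rw [Set.indicator_of_mem hy, ← lintegral_lintegral_delay Q F hψ hψ0]
    congr 1 with t
    congr 1 with τ
    congr 1 with η
    rw [Set.indicator_of_mem (by simpa [position] using hy)]
    simp only [jump, position, add_sub_cancel_right]
  · rw [Set.indicator_of_notMem hy]
    have : ∀ t τ η, (((y + x₀, t), τ), η) ∉ position x₀ ⁻¹' I := by
      intro t τ η
      simpa [position] using hy
    simp [Set.indicator_of_notMem (this _ _ _)]

/-- The upper bound of the intensity of the delays, which is attained in the stationary regime. -/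
lemma lintegral_jump_le (lam v x₀ : ℝ) (Q : Measure ℝ) [SFinite Q] (F : Measure ℝ≥0∞) [SFinite F]
    (hψ : Measurable ψ) (hψ0 : ψ 0 = 0) {I : Set ℝ} (hI : MeasurableSet I) (u : ℝ) :
    ∫⁻ e in position x₀ ⁻¹' I, ψ (ENNReal.ofReal (jump v x₀ (e, u))) ∂(obstacleIntensity lam Q F)
      ≤ ENNReal.ofReal lam * (∫⁻ q, ψ (wait q) ∂(encounter Q F)) * volume I := by
  rw [lintegral_jump lam v x₀ Q F hψ hψ0 hI, mul_assoc, ← setLIntegral_const]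
  gcongr
  exact Measure.restrict_le_self

/-- The lower bound of the intensity of the delays at late moments. -/
lemma le_lintegral_jump (lam x₀ : ℝ) {v : ℝ} (hv : 0 < v) (Q : Measure ℝ) [SFinite Q]
    (F : Measure ℝ≥0∞) [SFinite F] (hψ : Measurable ψ) (hψ0 : ψ 0 = 0) {I : Set ℝ}
    (hI : MeasurableSet I) {u b : ℝ} (hu : 0 ≤ u) (hIb : I ⊆ Ici b) :
    ENNReal.ofReal lam * (∫⁻ q in {q | q.1 - q.2.2 ≤ b / v}, ψ (wait q) ∂(encounter Q F)) * volume I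
      ≤ ∫⁻ e in position x₀ ⁻¹' I, ψ (ENNReal.ofReal (jump v x₀ (e, u)))
        ∂(obstacleIntensity lam Q F) := by
  rw [lintegral_jump lam v x₀ Q F hψ hψ0 hI, mul_assoc, ← setLIntegral_const]
  gcongr ENNReal.ofReal lam * ?_
  refine setLIntegral_mono' hI fun y hy => lintegral_mono_set fun q hq => ?_
  have hq' : q.1 - q.2.2 ≤ b / v := hq
  have hb : b / v ≤ y / v := by
    have := hIb hy
    gcongr
    exact this
  change q.1 - q.2.2 ≤ u + y / v
  linarith

end Encounter

/-! ### Finiteness of the delay intensity and its expression by residual lifetimes -/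

section MeanDelay

variable (Q : Measure ℝ) [IsProbabilityMeasure Q] (F : Measure ℝ≥0∞) [IsProbabilityMeasure F]

/-- The waiting time is at most r ≤ τ on an interval of length τ, so the integral is at most E τ².
The second moment of the lifetimes enters only here. -/
lemma lintegral_wait_ne_top (hQ_second : Integrable (fun t : ℝ => t ^ 2) Q) :
    ∫⁻ q, wait q ∂(encounter Q F) ≠ ∞ := by
  have h1 : ∫⁻ q, wait q ∂(encounter Q F) ≤ ∫⁻ τ, ENNReal.ofReal (τ ^ 2) ∂Q := by
    have := lintegral_encounter Q F (ψ := fun s => s) measurable_id MeasurableSet.univ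
    rw [Measure.restrict_univ] at this
    rw [this]
    refine lintegral_mono fun τ => ?_
    calc _ ≤ ∫⁻ _, ENNReal.ofReal (τ ^ 2) ∂F := by
          refine lintegral_mono fun η => ?_
          calc _ ≤ ∫⁻ r, (Ioc 0 τ).indicator (fun _ => ENNReal.ofReal τ) r := by
                refine lintegral_mono fun r => ?_
                by_cases hr : r ∈ Ioc 0 τ
                · have hmem : (τ, η, r) ∈ {q : ℝ × ℝ≥0∞ × ℝ | q.2.2 ∈ Ioc 0 q.1} ∩ univ :=
                    ⟨hr, mem_univ _⟩
                  rw [Set.indicator_of_mem hmem, Set.indicator_of_mem hr]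
                  exact (min_le_right _ _).trans (ENNReal.ofReal_le_ofReal hr.2)
                · rw [Set.indicator_of_notMem (fun h => hr h.1)]
                  exact zero_le
            _ = ENNReal.ofReal τ * ENNReal.ofReal τ := by
                rw [lintegral_indicator_const measurableSet_Ioc, Real.volume_Ioc, sub_zero]
            _ ≤ ENNReal.ofReal (τ ^ 2) := by
                rcases le_total 0 τ with h | h
                · rw [← ENNReal.ofReal_mul h, sq]
                · rw [ENNReal.ofReal_of_nonpos h, zero_mul]
                  exact zero_le
      _ = _ := by simp
  refine ne_top_of_le_ne_top ?_ h1
  have := hQ_second.lintegral_lt_top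
  exact this.ne

/-- Writing 1 - Q(t) as the probability of τ > t and applying Tonelli's theorem exchanges the
density for an integral over the lifetime. -/
lemma lintegral_residualLaw (hQ_pos : 0 < mean Q) {g : ℝ → ℝ≥0∞} (hg : Measurable g) :
    ∫⁻ t, g t ∂(residualLaw Q)
      = (ENNReal.ofReal (mean Q))⁻¹ * ∫⁻ τ, (∫⁻ r in Ioc 0 τ, g r) ∂Q := by
  have hm : Measurable fun t => ENNReal.ofReal ((1 - cdf Q t) / mean Q) :=
    ((measurable_const.sub (monotone_cdf Q).measurable).div_const _).ennreal_ofReal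
  have hcdf : ∀ t, ENNReal.ofReal ((1 - cdf Q t) / mean Q)
      = (ENNReal.ofReal (mean Q))⁻¹ * ∫⁻ τ, (Ioi t).indicator (fun _ => 1) τ ∂Q := by
    intro t
    rw [lintegral_indicator_const measurableSet_Ioi, one_mul, ENNReal.ofReal_div_of_pos hQ_pos,
      ENNReal.div_eq_inv_mul]
    congr 1
    rw [cdf_eq_real, ← probReal_compl_eq_one_sub measurableSet_Iic, compl_Iic, measureReal_def,
      ENNReal.ofReal_toReal (measure_ne_top _ _)]
  rw [residualLaw, lintegral_withDensity_eq_lintegral_mul _ hm hg]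
  simp only [Pi.mul_apply, hcdf]
  simp_rw [mul_assoc]
  rw [lintegral_const_mul']
  swap
  · simpa using hQ_pos
  congr 1
  have hjoint :
      Measurable fun q : ℝ × ℝ => (Ioi q.1).indicator (fun _ => (1 : ℝ≥0∞)) q.2 * g q.1 := by
    have hs : MeasurableSet {q : ℝ × ℝ | q.1 < q.2} :=
      measurableSet_lt measurable_fst measurable_snd
    exact (measurable_const.indicator hs : Measurable ({q : ℝ × ℝ | q.1 < q.2}.indicator
      fun _ => (1 : ℝ≥0∞))).mul (hg.comp measurable_fst)
  calc ∫⁻ t in Ici 0, (∫⁻ τ, (Ioi t).indicator (fun _ => 1) τ ∂Q) * g t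
      = ∫⁻ t in Ici 0, ∫⁻ τ, (Ioi t).indicator (fun _ => 1) τ * g t ∂Q := by
        congr 1 with t
        rw [lintegral_mul_const _ (measurable_const.indicator measurableSet_Ioi)]
    _ = ∫⁻ τ, (∫⁻ t in Ici 0, (Ioi t).indicator (fun _ => 1) τ * g t) ∂Q :=
        lintegral_lintegral_swap hjoint.aemeasurable
    _ = _ := by
        congr 1 with τ
        rw [← Measure.restrict_congr_set (Ico_ae_eq_Ioc : Ico 0 τ =ᵐ[volume] Ioc 0 τ),
          ← lintegral_indicator measurableSet_Ici, ← lintegral_indicator measurableSet_Ico]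
        congr 1 with t
        by_cases h0 : 0 ≤ t <;> by_cases h1 : t < τ <;> simp [Set.indicator_apply, h0, h1]

/-- The intensity of the time lost per unit time in terms of the mean delay. -/
lemma ofReal_meanDelay (hQ_pos : 0 < mean Q) :
    meanDelay Q F * mean Q = (∫⁻ q, wait q ∂(encounter Q F)).toReal := by
  have : SFinite (residualLaw Q) := by unfold residualLaw; infer_instance
  have hm : Measurable fun p : ℝ≥0∞ × ℝ => min p.1 (ENNReal.ofReal p.2) := by fun_prop
  have h1 : meanDelay Q F
      = (∫⁻ p : ℝ≥0∞ × ℝ, min p.1 (ENNReal.ofReal p.2) ∂(F.prod (residualLaw Q))).toReal := by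
    refine integral_toReal hm.aemeasurable (Eventually.of_forall fun p => ?_)
    exact (min_le_right _ _).trans_lt ENNReal.ofReal_lt_top
  have h2 : ∫⁻ p : ℝ≥0∞ × ℝ, min p.1 (ENNReal.ofReal p.2) ∂(F.prod (residualLaw Q))
      = (ENNReal.ofReal (mean Q))⁻¹ * ∫⁻ q, wait q ∂(encounter Q F) := by
    have := lintegral_encounter Q F (ψ := fun s => s) measurable_id MeasurableSet.univ
    rw [Measure.restrict_univ] at this
    rw [this, lintegral_prod _ hm.aemeasurable]
    have hin : ∀ η : ℝ≥0∞, ∫⁻ t, min η (ENNReal.ofReal t) ∂(residualLaw Q)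
        = (ENNReal.ofReal (mean Q))⁻¹ * ∫⁻ τ, (∫⁻ r in Ioc 0 τ, min η (ENNReal.ofReal r)) ∂Q :=
      fun η => lintegral_residualLaw Q hQ_pos (by fun_prop)
    simp_rw [hin]
    rw [lintegral_const_mul']
    swap
    · simpa using hQ_pos
    congr 1
    have hjoint := (measurable_wait.indicator measurableSet_encounter)
    have hstep : ∀ η : ℝ≥0∞, ∀ τ : ℝ, ∫⁻ r in Ioc 0 τ, min η (ENNReal.ofReal r)
        = ∫⁻ r, {q : ℝ × ℝ≥0∞ × ℝ | q.2.2 ∈ Ioc 0 q.1}.indicator wait (τ, η, r) := by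
      intro η τ
      rw [← lintegral_indicator measurableSet_Ioc]
      rfl
    simp_rw [hstep, inter_univ]
    refine lintegral_lintegral_swap (f := fun η τ => ∫⁻ r,
      {q : ℝ × ℝ≥0∞ × ℝ | q.2.2 ∈ Ioc 0 q.1}.indicator wait (τ, η, r)) ?_
    exact ((hjoint.comp (by fun_prop : Measurable fun q : (ℝ≥0∞ × ℝ) × ℝ =>
      (q.1.2, q.1.1, q.2))).lintegral_prod_right').aemeasurable
  rw [h1, h2, ENNReal.toReal_mul, ENNReal.toReal_inv, ENNReal.toReal_ofReal hQ_pos.le]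
  field_simp

end MeanDelay

end RoadObstacles

namespace RoadObstacles

/-! ### Truncation and summation along geometric sequences -/

section Truncation

/-- Truncation at the level `m`. -/
noncomputable def trunc (m : ℕ) (s : ℝ≥0∞) : ℝ≥0∞ := if s ≤ m then s else 0

/-- The indicator of the values that are affected by the truncation at the level `m`. -/
noncomputable def exceed (m : ℕ) (s : ℝ≥0∞) : ℝ≥0∞ := if s ≤ m then 0 else 1

/-- The contribution of a jump to the mean deviation of the sum of the jumps up to `m`. -/
noncomputable def defect (m : ℕ) (s : ℝ≥0∞) : ℝ≥0∞ :=
  (m : ℝ≥0∞)⁻¹ * trunc m s ^ 2 + m * exceed m s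

lemma measurable_trunc (m : ℕ) : Measurable (trunc m) :=
  Measurable.ite (measurableSet_le measurable_id measurable_const) measurable_id measurable_const

lemma measurable_exceed (m : ℕ) : Measurable (exceed m) :=
  Measurable.ite (measurableSet_le measurable_id measurable_const) measurable_const measurable_const

lemma trunc_zero (m : ℕ) : trunc m 0 = 0 := by simp [trunc]

lemma exceed_zero (m : ℕ) : exceed m 0 = 0 := by simp [exceed]

lemma trunc_le (m : ℕ) (s : ℝ≥0∞) : trunc m s ≤ s := by
  unfold trunc
  split_ifs
  · exact le_rfl
  · exact zero_le

lemma trunc_le_natCast (m : ℕ) (s : ℝ≥0∞) : trunc m s ≤ m := by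
  unfold trunc
  split_ifs with h
  · exact h
  · exact zero_le

lemma trunc_mono {b m : ℕ} (h : b ≤ m) (s : ℝ≥0∞) : trunc b s ≤ trunc m s := by
  unfold trunc
  have hbm : (b : ℝ≥0∞) ≤ m := by exact_mod_cast h
  by_cases h1 : s ≤ b
  · rw [if_pos h1, if_pos (h1.trans hbm)]
  · rw [if_neg h1]
    exact zero_le

/-- An increment of `s * z / (z + s)` along a geometric sequence. -/
lemma min_le_increment {c s z : ℝ} (hc : 1 < c) (hs : 0 < s) (hz : 0 < z) :
    min (2 * s ^ 2 / z) z
      ≤ 4 * (c + 1) / (c - 1) * (s * (c * z) / (c * z + s) - s * z / (z + s)) := by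
  have hc1 : 0 < c - 1 := by linarith
  have hc0 : 0 < c := by linarith
  have hA : 0 < c * z + s := by positivity
  have hB : 0 < z + s := by positivity
  -- The increment equals (c - 1) s² z / ((cz + s)(z + s)). The denominator is at most 2(c + 1)
  -- max(s, z)², which explains the constant and the two cases.
  have e : 4 * (c + 1) / (c - 1) * (s * (c * z) / (c * z + s) - s * z / (z + s))
      = 4 * (c + 1) * s ^ 2 * z / ((c * z + s) * (z + s)) := by
    field_simp
    ring
  rw [e]
  rcases le_total z s with h | h
  · refine (min_le_right _ _).trans ?_
    rw [le_div_iff₀ (by positivity)]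
    have h1 : c * z + s ≤ (c + 1) * s := by nlinarith
    have h2 : z + s ≤ 2 * s := by linarith
    have h3 : (c * z + s) * (z + s) ≤ (c + 1) * s * (2 * s) :=
      mul_le_mul h1 h2 hB.le (by positivity)
    have h4 : 0 ≤ (c + 1) * s ^ 2 * z := by positivity
    nlinarith [mul_le_mul_of_nonneg_left h3 hz.le]
  · refine (min_le_left _ _).trans ?_
    rw [div_le_div_iff₀ hz (by positivity)]
    have h1 : c * z + s ≤ (c + 1) * z := by nlinarith
    have h2 : z + s ≤ 2 * z := by linarith
    have h3 : (c * z + s) * (z + s) ≤ (c + 1) * z * (2 * z) :=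
      mul_le_mul h1 h2 hB.le (by positivity)
    nlinarith [mul_le_mul_of_nonneg_left h3 (by positivity : 0 ≤ 2 * s ^ 2)]

/-- For z ≥ 1 the integer part lies between z/2 and z, which costs the factor 2. Below the
truncation level s²/m ≤ m; above it the inequality is reversed, so the defect is the smaller of the
two. -/
lemma defect_le {s z : ℝ} (hs : 0 < s) (hz : 1 ≤ z) :
    defect ⌊z⌋₊ (ENNReal.ofReal s) ≤ ENNReal.ofReal (min (2 * s ^ 2 / z) z) := by
  set m := ⌊z⌋₊ with hm
  have hm1 : 1 ≤ m := by
    rw [hm, Nat.le_floor_iff (by linarith)]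
    exact_mod_cast hz
  have hm1' : (1 : ℝ) ≤ m := by exact_mod_cast hm1
  have hm0 : (0 : ℝ) < m := by linarith
  have hmz : (m : ℝ) ≤ z := Nat.floor_le (by linarith)
  have hzm : z ≤ 2 * m := by
    have := Nat.lt_floor_add_one z
    rw [← hm] at this
    linarith
  have hcomp : s ^ 2 / m ≤ 2 * s ^ 2 / z := by
    rw [div_le_div_iff₀ hm0 (by linarith)]
    nlinarith [sq_nonneg s]
  have hiff : ENNReal.ofReal s ≤ ENNReal.ofReal (m : ℝ) ↔ s ≤ m :=
    ENNReal.ofReal_le_ofReal_iff hm0.le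
  unfold defect trunc exceed
  rw [← ENNReal.ofReal_natCast m]
  by_cases h : s ≤ m
  · rw [if_pos (hiff.2 h), if_pos (hiff.2 h), mul_zero, add_zero, ← ENNReal.ofReal_inv_of_pos hm0,
      ← ENNReal.ofReal_pow hs.le, ← ENNReal.ofReal_mul (by positivity)]
    refine ENNReal.ofReal_le_ofReal ?_
    rw [inv_mul_eq_div]
    refine le_min hcomp (le_trans ?_ hmz)
    rw [div_le_iff₀ hm0]
    nlinarith
  · rw [if_neg (mt hiff.1 h), if_neg (mt hiff.1 h), zero_pow two_ne_zero, mul_zero, zero_add,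
      mul_one]
    refine ENNReal.ofReal_le_ofReal (le_min (le_trans ?_ hcomp) hmz)
    rw [le_div_iff₀ hm0]
    nlinarith

/-- The bounds telescope along the function s z / (z + s) of z, which never exceeds s. A bound
linear in s results, so a finite first moment suffices for the strong law. -/
lemma tsum_defect_le {c : ℝ} (hc : 1 < c) (s : ℝ) :
    ∑' i : ℕ, defect ⌊c ^ i⌋₊ (ENNReal.ofReal s)
      ≤ ENNReal.ofReal (4 * (c + 1) / (c - 1)) * ENNReal.ofReal s := by
  have hc1 : 0 < c - 1 := by linarith
  have hc0 : 0 < c := by linarith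
  rcases le_or_gt s 0 with hs | hs
  · simp [ENNReal.ofReal_of_nonpos hs, defect, trunc_zero, exceed_zero]
  refine ENNReal.tsum_le_of_sum_range_le fun n => ?_
  rw [← ENNReal.ofReal_mul (by positivity)]
  calc ∑ i ∈ Finset.range n, defect ⌊c ^ i⌋₊ (ENNReal.ofReal s)
      ≤ ∑ i ∈ Finset.range n, ENNReal.ofReal (min (2 * s ^ 2 / c ^ i) (c ^ i)) :=
        Finset.sum_le_sum fun i _ => defect_le hs (one_le_pow₀ hc.le)
    _ = ENNReal.ofReal (∑ i ∈ Finset.range n, min (2 * s ^ 2 / c ^ i) (c ^ i)) := by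
        rw [ENNReal.ofReal_sum_of_nonneg]
        intro i _
        positivity
    _ ≤ _ := by
        refine ENNReal.ofReal_le_ofReal ?_
        calc ∑ i ∈ Finset.range n, min (2 * s ^ 2 / c ^ i) (c ^ i)
            ≤ ∑ i ∈ Finset.range n, 4 * (c + 1) / (c - 1) *
              (s * c ^ (i + 1) / (c ^ (i + 1) + s) - s * c ^ i / (c ^ i + s)) := by
              refine Finset.sum_le_sum fun i _ => ?_
              rw [pow_succ' c i]
              exact min_le_increment hc hs (by positivity)
          _ = 4 * (c + 1) / (c - 1) * (s * c ^ n / (c ^ n + s) - s * c ^ 0 / (c ^ 0 + s)) := by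
              rw [← Finset.mul_sum, Finset.sum_range_sub fun i => s * c ^ i / (c ^ i + s)]
          _ ≤ 4 * (c + 1) / (c - 1) * s := by
              have hn : 0 < c ^ n := by positivity
              have h1 : s * c ^ n / (c ^ n + s) ≤ s := by
                rw [div_le_iff₀ (by positivity)]
                nlinarith
              have h2 : 0 ≤ s * c ^ 0 / (c ^ 0 + s) := by positivity
              gcongr
              linarith

end Truncation

/-! ### Almost sure control of the deviations -/

section Deviation

variable {Ω : Type*} [MeasurableSpace Ω] {P : Measure Ω} {lam v x₀ t₀ : ℝ} {Q : Measure ℝ}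
  {F : Measure ℝ≥0∞} {p : ℕ → Ω → Obstacle} {lev : Obstacle → ℕ}

open SimpleField

/-- The grid clock of the car. -/
noncomputable def carClock (v x₀ t₀ : ℝ) (p : ℕ → Ω → Obstacle) (n k : ℕ) (ω : Ω) : ℝ :=
  clock t₀ (position x₀) p (jump v x₀) n k ω

/-- The sum of `ψ` of the jumps of the grid clock up to `m`. -/
noncomputable def jumpSum (v x₀ t₀ : ℝ) (p : ℕ → Ω → Obstacle) (ψ : ℝ≥0∞ → ℝ≥0∞) (m n : ℕ)
    (ω : Ω) : ℝ≥0∞ :=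
  ∑ k ∈ Finset.range (m * (n + 1)), cellSum (position x₀) p n k
    (fun e => ψ (ENNReal.ofReal (jump v x₀ (e, carClock v x₀ t₀ p n k ω)))) ω

/-- The compensator of the sum of the truncated jumps of the grid clock up to `m`. -/
noncomputable def compensator (lam v x₀ t₀ : ℝ) (Q : Measure ℝ) (F : Measure ℝ≥0∞)
    (p : ℕ → Ω → Obstacle) (m n : ℕ) (ω : Ω) : ℝ :=
  ∑ k ∈ Finset.range (m * (n + 1)), (∫⁻ e in position x₀ ⁻¹' cell n k,
    trunc m (ENNReal.ofReal (jump v x₀ (e, carClock v x₀ t₀ p n k ω)))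
      ∂(obstacleIntensity lam Q F)).toReal

/-- The deviation of the sum of the jumps of the grid clock up to `m` from its compensator. -/
noncomputable def deviation (lam v x₀ t₀ : ℝ) (Q : Measure ℝ) (F : Measure ℝ≥0∞)
    (p : ℕ → Ω → Obstacle) (m n : ℕ) (ω : Ω) : ℝ≥0∞ :=
  ((m : ℝ≥0∞) ^ 2)⁻¹ * ENNReal.ofReal (centered t₀ (position x₀) (obstacleIntensity lam Q F) p
    (jump v x₀) (fun q => trunc m (ENNReal.ofReal (jump v x₀ q))) n (m * (n + 1)) ω ^ 2)
    + jumpSum v x₀ t₀ p (exceed m) m n ω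

instance [SFinite Q] [SFinite F] : SFinite (obstacleIntensity lam Q F) := by
  unfold obstacleIntensity spaceTimeIntensity
  infer_instance

lemma measurable_jumpSum (h : SimpleField P (position x₀) lev (obstacleIntensity lam Q F) p)
    {ψ : ℝ≥0∞ → ℝ≥0∞} (hψ : Measurable ψ) (m n : ℕ) :
    Measurable (jumpSum v x₀ t₀ p ψ m n) := by
  refine Finset.measurable_fun_sum _ fun k _ => ?_
  exact (h.measurable_cellSum_past (φ := fun q => ψ (ENNReal.ofReal (jump v x₀ q)))
    (hψ.comp (measurable_jump v x₀).ennreal_ofReal)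
    (h.measurable_clock t₀ (measurable_jump v x₀) n k)).mono (h.past_le n _) le_rfl

variable [IsProbabilityMeasure Q] [IsProbabilityMeasure F]

lemma measurable_deviation (h : SimpleField P (position x₀) lev (obstacleIntensity lam Q F) p)
    (m n : ℕ) : Measurable (deviation lam v x₀ t₀ Q F p m n) := by
  refine (Measurable.const_mul ?_ _).add (measurable_jumpSum h (measurable_exceed m) m n)
  exact (((h.measurable_centered t₀ (measurable_jump v x₀)
    ((measurable_trunc m).comp (measurable_jump v x₀).ennreal_ofReal) n _).mono
      (h.past_le n _) le_rfl).pow_const 2).ennreal_ofReal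

variable [IsProbabilityMeasure P]

lemma lintegral_jumpSum_le (h : SimpleField P (position x₀) lev (obstacleIntensity lam Q F) p)
    {ψ : ℝ≥0∞ → ℝ≥0∞} (hψ : Measurable ψ) (hψ0 : ψ 0 = 0) (m n : ℕ) :
    ∫⁻ ω, jumpSum v x₀ t₀ p ψ m n ω ∂P
      ≤ ENNReal.ofReal lam * (∫⁻ q, ψ (wait q) ∂(encounter Q F)) * m := by
  rw [← sum_volume_cell _ n m]
  exact h.lintegral_sum_cellSum_le (u₀ := t₀) (measurable_jump v x₀)
    (φ := fun q => ψ (ENNReal.ofReal (jump v x₀ q)))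
    (hψ.comp (measurable_jump v x₀).ennreal_ofReal)
    (fun k u _ => lintegral_jump_le lam v x₀ Q F hψ hψ0 (measurableSet_cell n k) u) _

/-- The variance over the distance m is of order m, so the normalization by m² leaves 1/m times the
squared truncated jump; the expected number of large jumps carries the factor m. Together they form
`defect`. -/
lemma lintegral_deviation_le (h : SimpleField P (position x₀) lev (obstacleIntensity lam Q F) p)
    (hw : ∫⁻ q, wait q ∂(encounter Q F) ≠ ∞) {m : ℕ} (hm : m ≠ 0) (n : ℕ) :
    ∫⁻ ω, deviation lam v x₀ t₀ Q F p m n ω ∂P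
      ≤ ENNReal.ofReal lam * ∫⁻ q, defect m (wait q) ∂(encounter Q F) := by
  have hmt : (m : ℝ≥0∞) ≠ ∞ := ENNReal.natCast_ne_top m
  have hm0 : (m : ℝ≥0∞) ≠ 0 := by exact_mod_cast hm
  have htr : Measurable fun q => trunc m (wait q) := (measurable_trunc m).comp measurable_wait
  have hex : Measurable fun q => exceed m (wait q) := (measurable_exceed m).comp measurable_wait
  have hsq : ∫⁻ q, trunc m (wait q) ^ 2 ∂(encounter Q F) ≠ ∞ := by
    refine ne_top_of_le_ne_top (ENNReal.mul_ne_top hmt hw) ?_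
    rw [← lintegral_const_mul _ measurable_wait]
    refine lintegral_mono fun q => ?_
    rw [sq]
    exact mul_le_mul' (trunc_le_natCast m _) (trunc_le m _)
  have h1 : ∫⁻ ω, ENNReal.ofReal (centered t₀ (position x₀) (obstacleIntensity lam Q F) p
      (jump v x₀) (fun q => trunc m (ENNReal.ofReal (jump v x₀ q))) n (m * (n + 1)) ω ^ 2) ∂P
      ≤ ENNReal.ofReal lam * (∫⁻ q, trunc m (wait q) ^ 2 ∂(encounter Q F)) * m := by
    rw [← sum_volume_cell _ n m]
    refine h.lintegral_centered_sq_le (C := ENNReal.ofReal lam *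
      ∫⁻ q, trunc m (wait q) ∂(encounter Q F)) (measurable_jump v x₀)
      ((measurable_trunc m).comp (measurable_jump v x₀).ennreal_ofReal) ?_
      (ENNReal.mul_ne_top ENNReal.ofReal_ne_top hsq) (fun k u _ => lintegral_jump_le lam v x₀ Q F
        (measurable_trunc m) (trunc_zero m) (measurableSet_cell n k) u)
      (fun k u _ => lintegral_jump_le lam v x₀ Q F (ψ := fun s => trunc m s ^ 2)
        ((measurable_trunc m).pow_const 2) (by simp [trunc_zero]) (measurableSet_cell n k) u) _
    exact ENNReal.mul_ne_top ENNReal.ofReal_ne_top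
      (ne_top_of_le_ne_top hw (lintegral_mono fun q => trunc_le m _))
  have h2 := lintegral_jumpSum_le (v := v) (t₀ := t₀) h (measurable_exceed m) (exceed_zero m) m n
  unfold deviation
  rw [lintegral_add_right _ (measurable_jumpSum h (measurable_exceed m) m n),
    lintegral_const_mul' _ _ (by simpa using hm)]
  refine (add_le_add (mul_le_mul' le_rfl h1) h2).trans_eq ?_
  unfold defect
  rw [lintegral_add_left ((htr.pow_const 2).const_mul _), lintegral_const_mul _ (htr.pow_const 2),
    lintegral_const_mul _ hex, mul_add]
  congr 1
  · have : ((m : ℝ≥0∞) ^ 2)⁻¹ * m = (m : ℝ≥0∞)⁻¹ := by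
      rw [sq, ENNReal.mul_inv (Or.inl hm0) (Or.inl hmt), mul_assoc, ENNReal.inv_mul_cancel hm0 hmt,
        mul_one]
    rw [← this]
    ring
  · ring

/-- Almost surely, the deviations vanish asymptotically along geometric sequences. -/
lemma ae_tendsto_deviation (h : SimpleField P (position x₀) lev (obstacleIntensity lam Q F) p)
    (hw : ∫⁻ q, wait q ∂(encounter Q F) ≠ ∞) {c : ℝ} (hc : 1 < c) :
    ∀ᵐ ω ∂P, Tendsto (fun i : ℕ => liminf (fun n =>
      deviation lam v x₀ t₀ Q F p ⌊c ^ i⌋₊ n ω) atTop) atTop (𝓝 0) := by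
  have hmeas : ∀ i : ℕ, Measurable fun ω => liminf (fun n =>
      deviation lam v x₀ t₀ Q F p ⌊c ^ i⌋₊ n ω) atTop := fun i =>
    Measurable.liminf fun n => measurable_deviation h _ n
  have hint : ∫⁻ ω, ∑' i : ℕ, liminf (fun n =>
      deviation lam v x₀ t₀ Q F p ⌊c ^ i⌋₊ n ω) atTop ∂P ≠ ∞ := by
    rw [lintegral_tsum fun i => (hmeas i).aemeasurable]
    have hterm : ∀ i : ℕ, ∫⁻ ω, liminf (fun n =>
        deviation lam v x₀ t₀ Q F p ⌊c ^ i⌋₊ n ω) atTop ∂P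
        ≤ ENNReal.ofReal lam * ∫⁻ q, defect ⌊c ^ i⌋₊ (wait q) ∂(encounter Q F) := by
      intro i
      have hne : ⌊c ^ i⌋₊ ≠ 0 := by
        have : 1 ≤ ⌊c ^ i⌋₊ := by
          rw [Nat.le_floor_iff (by positivity)]
          exact_mod_cast one_le_pow₀ hc.le
        omega
      refine (lintegral_liminf_le fun n => measurable_deviation h _ n).trans ?_
      exact liminf_le_of_frequently_le' (Frequently.of_forall fun n =>
        lintegral_deviation_le h hw hne n)
    refine ne_top_of_le_ne_top ?_ (ENNReal.tsum_le_tsum hterm)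
    have hdm : ∀ m, Measurable fun q => defect m (wait q) := fun m =>
      ((((measurable_trunc m).pow_const 2).const_mul _).add
        ((measurable_exceed m).const_mul _)).comp measurable_wait
    rw [ENNReal.tsum_mul_left, ← lintegral_tsum fun i => (hdm _).aemeasurable]
    refine ENNReal.mul_ne_top ENNReal.ofReal_ne_top (ne_top_of_le_ne_top
      (ENNReal.mul_ne_top (ENNReal.ofReal_ne_top (r := 4 * (c + 1) / (c - 1))) hw) ?_)
    rw [← lintegral_const_mul _ measurable_wait]
    refine lintegral_mono fun q => ?_
    have hfin : wait q ≠ ∞ := ne_top_of_le_ne_top ENNReal.ofReal_ne_top (min_le_right _ _)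
    have := tsum_defect_le hc (wait q).toReal
    rwa [ENNReal.ofReal_toReal hfin] at this
  filter_upwards [ae_lt_top (Measurable.tsum hmeas) hint] with ω hω
  exact ENNReal.tendsto_atTop_zero_of_tsum_ne_top hω.ne

/-- Almost surely, the grid clocks do not explode. -/
lemma ae_jumpSum_bounded (h : SimpleField P (position x₀) lev (obstacleIntensity lam Q F) p)
    (hw : ∫⁻ q, wait q ∂(encounter Q F) ≠ ∞) :
    ∀ᵐ ω ∂P, ∀ m : ℕ, ∃ L : ℝ, ∃ᶠ n in atTop,
      jumpSum v x₀ t₀ p (fun s => s) m n ω ≤ ENNReal.ofReal L := by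
  rw [ae_all_iff]
  intro m
  have hmeas : Measurable fun ω => liminf (fun n => jumpSum v x₀ t₀ p (fun s => s) m n ω) atTop :=
    Measurable.liminf fun n => measurable_jumpSum (ψ := fun s => s) h measurable_id m n
  have hint : ∫⁻ ω, liminf (fun n => jumpSum v x₀ t₀ p (fun s => s) m n ω) atTop ∂P ≠ ∞ := by
    refine ne_top_of_le_ne_top (ENNReal.mul_ne_top (ENNReal.mul_ne_top
      (ENNReal.ofReal_ne_top (r := lam)) hw) (ENNReal.natCast_ne_top m)) ((lintegral_liminf_le
        fun n => measurable_jumpSum (ψ := fun s => s) h measurable_id m n).trans ?_)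
    exact liminf_le_of_frequently_le' (Frequently.of_forall fun n =>
      lintegral_jumpSum_le (ψ := fun s => s) h measurable_id rfl m n)
  filter_upwards [ae_lt_top hmeas hint] with ω hω
  refine ⟨(liminf (fun n => jumpSum v x₀ t₀ p (fun s => s) m n ω) atTop).toReal + 1, ?_⟩
  have hlt : liminf (fun n => jumpSum v x₀ t₀ p (fun s => s) m n ω) atTop
      < ENNReal.ofReal
        ((liminf (fun n => jumpSum v x₀ t₀ p (fun s => s) m n ω) atTop).toReal + 1) := by
    rw [ENNReal.lt_ofReal_iff_toReal_lt hω.ne]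
    linarith
  exact (frequently_lt_of_liminf_lt (by isBoundedDefault) hlt).mono fun n hn => hn.le

end Deviation

end RoadObstacles

namespace RoadObstacles

/-! ### Compensators and pathwise bounds on the idle time -/

section Pathwise

variable {Ω : Type*} {lam v x₀ t₀ : ℝ} {Q : Measure ℝ} {F : Measure ℝ≥0∞} {p : ℕ → Ω → Obstacle}
  {ω : Ω}

/-- The idle time of a car per unit length of the road in the stationary regime. -/
noncomputable def rate (lam : ℝ) (Q : Measure ℝ) (F : Measure ℝ≥0∞) : ℝ≥0∞ :=
  ENNReal.ofReal lam * ∫⁻ q, wait q ∂(encounter Q F)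

/-- The part of the idle time per unit length that is due to delays up to `b` at obstacles of age
at most `b / v`. -/
noncomputable def truncRate (lam v : ℝ) (Q : Measure ℝ) (F : Measure ℝ≥0∞) (b : ℕ) : ℝ≥0∞ :=
  ENNReal.ofReal lam * ∫⁻ q in {q | q.1 - q.2.2 ≤ b / v}, trunc b (wait q) ∂(encounter Q F)

lemma truncRate_le (lam v : ℝ) (Q : Measure ℝ) (F : Measure ℝ≥0∞) (b : ℕ) :
    truncRate lam v Q F b ≤ rate lam Q F :=
  mul_le_mul' le_rfl ((setLIntegral_le_lintegral _ _).trans (lintegral_mono fun _ => trunc_le _ _))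

/-- The truncated rates converge to the rate. -/
lemma tendsto_truncRate (lam : ℝ) (hv : 0 < v) (Q : Measure ℝ) (F : Measure ℝ≥0∞) :
    Tendsto (truncRate lam v Q F) atTop (𝓝 (rate lam Q F)) := by
  refine ENNReal.Tendsto.const_mul ?_ (Or.inr ENNReal.ofReal_ne_top)
  have hset : ∀ b : ℕ, ∫⁻ q in {q | q.1 - q.2.2 ≤ b / v}, trunc b (wait q) ∂(encounter Q F)
      = ∫⁻ q, {q : ℝ × ℝ≥0∞ × ℝ | q.1 - q.2.2 ≤ b / v}.indicator (fun q => trunc b (wait q)) q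
        ∂(encounter Q F) := fun b => (lintegral_indicator (measurableSet_age _) _).symm
  simp_rw [hset]
  refine lintegral_tendsto_of_tendsto_of_monotone (fun b => ?_)
    (Eventually.of_forall fun q b b' hb => ?_) (Eventually.of_forall fun q => ?_)
  · exact (((measurable_trunc b).comp measurable_wait).indicator (measurableSet_age _)).aemeasurable
  · have hsub : {q : ℝ × ℝ≥0∞ × ℝ | q.1 - q.2.2 ≤ b / v}
        ⊆ {q : ℝ × ℝ≥0∞ × ℝ | q.1 - q.2.2 ≤ b' / v} := by
      intro q hq
      have hq' : q.1 - q.2.2 ≤ b / v := hq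
      have hbb : (b : ℝ) ≤ b' := by exact_mod_cast hb
      have : (b : ℝ) / v ≤ b' / v := by gcongr
      exact hq'.trans this
    exact (Set.indicator_le_indicator (f := fun q => trunc b (wait q))
      (g := fun q => trunc b' (wait q)) (trunc_mono hb (wait q))).trans
      (Set.indicator_le_indicator_of_subset hsub (fun _ => zero_le) q)
  · have hfin : wait q ≠ ∞ := ne_top_of_le_ne_top ENNReal.ofReal_ne_top (min_le_right _ _)
    obtain ⟨b₁, hb₁⟩ := ENNReal.exists_nat_gt hfin
    obtain ⟨b₂, hb₂⟩ := exists_nat_ge ((q.1 - q.2.2) * v)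
    refine tendsto_const_nhds.congr' ?_
    filter_upwards [eventually_ge_atTop b₁, eventually_ge_atTop b₂] with b h1 h2
    have hmem : q ∈ {q : ℝ × ℝ≥0∞ × ℝ | q.1 - q.2.2 ≤ b / v} := by
      change q.1 - q.2.2 ≤ b / v
      rw [le_div_iff₀ hv]
      exact hb₂.trans (by exact_mod_cast h2)
    rw [Set.indicator_of_mem hmem, trunc, if_pos]
    exact hb₁.le.trans (by exact_mod_cast h1)

lemma sum_toReal_volume_cell {C : ℝ≥0∞} (hC : C ≠ ∞) (n m : ℕ) :
    ∑ k ∈ Finset.range (m * (n + 1)), (C * volume (cell n k)).toReal = C.toReal * m := by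
  rw [← ENNReal.toReal_sum, sum_volume_cell, ENNReal.toReal_mul, ENNReal.toReal_natCast]
  intro k _
  exact ENNReal.mul_ne_top hC (by rw [cell, Real.volume_Ico]; exact ENNReal.ofReal_ne_top)

lemma compensator_term_le (lam v x₀ : ℝ) (Q : Measure ℝ) [SFinite Q] (F : Measure ℝ≥0∞) [SFinite F]
    (m n k : ℕ) (u : ℝ) :
    ∫⁻ e in position x₀ ⁻¹' cell n k, trunc m (ENNReal.ofReal (jump v x₀ (e, u)))
      ∂(obstacleIntensity lam Q F) ≤ rate lam Q F * volume (cell n k) := by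
  refine (lintegral_jump_le lam v x₀ Q F (measurable_trunc m) (trunc_zero m)
    (measurableSet_cell n k) u).trans ?_
  unfold rate
  gcongr
  exact trunc_le _ _

lemma rate_mul_volume_cell_ne_top (hr : rate lam Q F ≠ ∞) (n k : ℕ) :
    rate lam Q F * volume (cell n k) ≠ ∞ :=
  ENNReal.mul_ne_top hr (by rw [cell, Real.volume_Ico]; exact ENNReal.ofReal_ne_top)

variable [IsProbabilityMeasure Q] [IsProbabilityMeasure F]

lemma compensator_le (hr : rate lam Q F ≠ ∞) (m n : ℕ) :
    compensator lam v x₀ t₀ Q F p m n ω ≤ (rate lam Q F).toReal * m := by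
  rw [← sum_toReal_volume_cell hr n m]
  refine Finset.sum_le_sum fun k _ => ?_
  exact ENNReal.toReal_mono (rate_mul_volume_cell_ne_top hr n k)
    (compensator_term_le lam v x₀ Q F m n k _)

/-- The cells before b are dropped. Beyond b the car arrives no earlier than b / v, since t₀ ≥ 0, so
the obstacles of age at most b / v are counted in full. -/
lemma le_compensator (hr : rate lam Q F ≠ ∞) (hv : 0 < v) (ht₀ : 0 ≤ t₀) {b m : ℕ} (hbm : b ≤ m)
    (n : ℕ) : (truncRate lam v Q F b).toReal * (m - b) ≤ compensator lam v x₀ t₀ Q F p m n ω := by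
  have hb : truncRate lam v Q F b ≠ ∞ := ne_top_of_le_ne_top hr (truncRate_le lam v Q F b)
  rw [mul_sub, ← sum_toReal_volume_cell hb n m, ← sum_toReal_volume_cell hb n b,
    ← Finset.sum_Ico_eq_sub _ (Nat.mul_le_mul_right _ hbm)]
  unfold compensator
  rw [Finset.range_eq_Ico]
  refine le_trans ?_ (Finset.sum_le_sum_of_subset_of_nonneg
    (Finset.Ico_subset_Ico_left (Nat.zero_le (b * (n + 1)))) fun _ _ _ => ENNReal.toReal_nonneg)
  refine Finset.sum_le_sum fun k hk => ENNReal.toReal_mono (ne_top_of_le_ne_top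
    (rate_mul_volume_cell_ne_top hr n k) (compensator_term_le lam v x₀ Q F m n k _)) ?_
  have hsub : cell n k ⊆ Ici (b : ℝ) := by
    intro s hs
    have hkb : b * (n + 1) ≤ k := (Finset.mem_Ico.1 hk).1
    refine le_trans ?_ hs.1
    rw [le_div_iff₀ (by positivity)]
    exact_mod_cast hkb
  refine le_trans ?_ (le_lintegral_jump lam x₀ hv Q F (measurable_trunc m) (trunc_zero m)
    (measurableSet_cell n k) (ht₀.trans (le_gridClock n k)) hsub)
  unfold truncRate
  gcongr
  exact trunc_mono hbm _

/-- The idle time at a distance where the deviation is small. -/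
lemma idle_bounds (hr : rate lam Q F ≠ ∞) (hv : 0 < v) (ht₀ : 0 ≤ t₀) {W : ℝ → ℝ}
    {a : ℕ → ℝ}
    (h : JumpFamily (fun j => position x₀ (p j ω)) a (fun j u => jump v x₀ (p j ω, u)))
    (hW : ∀ d, IsClock t₀ (fun j => position x₀ (p j ω)) (fun j u => jump v x₀ (p j ω, u)) d W)
    (hφ : ∀ φ : ℕ → ℝ → ℝ≥0∞, (∀ j u, u < a j → φ j u = 0) → ∀ m : ℕ, ∀ᶠ n in atTop,
      ∑ k ∈ Finset.range (m * (n + 1)), ∑' j, (cell n k).indicator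
        (fun _ => φ j (carClock v x₀ t₀ p n k ω)) (position x₀ (p j ω))
        = ∑' j, (Ico (0 : ℝ) m).indicator (fun _ => φ j (W (position x₀ (p j ω))))
          (position x₀ (p j ω)))
    {b m : ℕ} (hbm : b ≤ m) (hm : m ≠ 0) {δ : ℝ} (hδ : 0 < δ) (hδ1 : δ ≤ 1)
    (hdev : liminf (fun n => deviation lam v x₀ t₀ Q F p m n ω) atTop < ENNReal.ofReal (δ ^ 2)) :
    (truncRate lam v Q F b).toReal * (m - b) - δ * m ≤ W m - t₀ ∧
      W m - t₀ ≤ (rate lam Q F).toReal * m + δ * m := by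
  have hm0 : (0 : ℝ) < m := by exact_mod_cast Nat.pos_of_ne_zero hm
  set y : ℕ → ℝ := fun j => position x₀ (p j ω) with hy
  have hzero : ∀ ψ : ℝ≥0∞ → ℝ≥0∞, ψ 0 = 0 → ∀ j u, u < a j →
      ψ (ENNReal.ofReal (jump v x₀ (p j ω, u))) = 0 := by
    intro ψ hψ j u hu
    rw [h.eq_zero j u hu, ENNReal.ofReal_zero, hψ]
  -- One grid suffices: its deviation is small, and its truncated and exceeding sums already equal
  -- those of the true clock.
  obtain ⟨n, hn, hn1, hn2⟩ := ((frequently_lt_of_liminf_lt (by isBoundedDefault)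
    hdev).and_eventually
    ((hφ (fun j u => trunc m (ENNReal.ofReal (jump v x₀ (p j ω, u))))
      (hzero _ (trunc_zero m)) m).and
    (hφ (fun j u => exceed m (ENNReal.ofReal (jump v x₀ (p j ω, u)))) (hzero _ (exceed_zero m))
      m))).exists
  -- The number of jumps above m is an integer less than δ² ≤ 1, hence zero; truncation therefore
  -- changes nothing and the truncated sum is the idle time itself.
  have hle : ∀ j, y j ∈ Ico (0 : ℝ) m → ENNReal.ofReal (jump v x₀ (p j ω, W (y j))) ≤ m := by
    intro j hj
    by_contra hcon
    have h1 : exceed m (ENNReal.ofReal (jump v x₀ (p j ω, W (y j)))) = 1 := if_neg hcon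
    have h2 : (1 : ℝ≥0∞) ≤ jumpSum v x₀ t₀ p (exceed m) m n ω := by
      refine le_trans ?_ hn2.ge
      refine le_trans ?_ (ENNReal.le_tsum j)
      rw [Set.indicator_of_mem hj, h1]
    have h3 : jumpSum v x₀ t₀ p (exceed m) m n ω < ENNReal.ofReal (δ ^ 2) :=
      lt_of_le_of_lt le_add_self hn
    have h4 : ENNReal.ofReal (δ ^ 2) ≤ 1 := by
      rw [ENNReal.ofReal_le_one]
      exact pow_le_one₀ hδ.le hδ1
    exact absurd (h2.trans_lt (h3.trans_le h4)) (lt_irrefl _)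
  have hsum : jumpSum v x₀ t₀ p (trunc m) m n ω = ENNReal.ofReal (W m - t₀) := by
    refine hn1.trans ?_
    have h1 := hW m m ⟨hm0.le, le_rfl⟩
    rw [← h1.tsum_eq, ENNReal.ofReal_tsum_of_nonneg _ h1.summable]
    · refine tsum_congr fun j => ?_
      by_cases hj : y j ∈ Ico (0 : ℝ) m
      · rw [Set.indicator_of_mem hj,
          Set.indicator_of_mem (show j ∈ {j | y j ∈ Ico (0 : ℝ) m} from hj)]
        exact if_pos (hle j hj)
      · rw [Set.indicator_of_notMem hj,
          Set.indicator_of_notMem (show j ∉ {j | y j ∈ Ico (0 : ℝ) m} from hj), ENNReal.ofReal_zero]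
    · exact fun j => Set.indicator_nonneg (fun _ _ => h.nonneg _ _) j
  have hidle : 0 ≤ W m - t₀ :=
    (hW m m ⟨hm0.le, le_rfl⟩).nonneg fun j => Set.indicator_nonneg (fun _ _ => h.nonneg _ _) j
  have hcent : SimpleField.centered t₀ (position x₀) (obstacleIntensity lam Q F) p (jump v x₀)
      (fun q => trunc m (ENNReal.ofReal (jump v x₀ q))) n (m * (n + 1)) ω
      = (W m - t₀) - compensator lam v x₀ t₀ Q F p m n ω := by
    rw [← ENNReal.toReal_ofReal hidle, ← hsum, jumpSum, ENNReal.toReal_sum, compensator,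
      ← Finset.sum_sub_distrib]
    · rfl
    · intro k hk
      have hfin : jumpSum v x₀ t₀ p (trunc m) m n ω ≠ ∞ := hsum ▸ ENNReal.ofReal_ne_top
      exact ENNReal.sum_ne_top.1 hfin k hk
  have hsq : ((W m - t₀) - compensator lam v x₀ t₀ Q F p m n ω) ^ 2 < (δ * m) ^ 2 := by
    have h1 : ((m : ℝ≥0∞) ^ 2)⁻¹ * ENNReal.ofReal
        (((W m - t₀) - compensator lam v x₀ t₀ Q F p m n ω) ^ 2) < ENNReal.ofReal (δ ^ 2) := by
      rw [← hcent]
      exact lt_of_le_of_lt le_self_add hn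
    rw [← ENNReal.ofReal_natCast, ← ENNReal.ofReal_pow hm0.le,
      ← ENNReal.ofReal_inv_of_pos (by positivity), ← ENNReal.ofReal_mul (by positivity),
      ENNReal.ofReal_lt_ofReal_iff (by positivity), inv_mul_lt_iff₀ (by positivity)] at h1
    rw [mul_pow]
    linarith
  have habs := abs_lt_of_sq_lt_sq hsq (by positivity)
  rw [abs_lt] at habs
  have h1 := compensator_le (v := v) (x₀ := x₀) (t₀ := t₀) (p := p) (ω := ω) hr m n
  have h2 := le_compensator (x₀ := x₀) (p := p) (ω := ω) hr hv ht₀ hbm n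
  constructor <;> linarith

end Pathwise

end RoadObstacles

namespace RoadObstacles

/-! ### From subsequences and integers to a limit along the reals -/

section Limits

/-- First b is fixed with `r b` close to κ; then `r b * b / m i` disappears as i grows. -/
lemma tendsto_div_of_eventually_bounds {I : ℕ → ℝ} {κ : ℝ} {r : ℕ → ℝ}
    (hr : Tendsto r atTop (𝓝 κ)) {m : ℕ → ℕ} (hm : Tendsto m atTop atTop)
    (h : ∀ b : ℕ, ∀ δ : ℝ, 0 < δ → δ ≤ 1 → ∀ᶠ i in atTop,
      r b * (m i - b) - δ * m i ≤ I (m i) ∧ I (m i) ≤ κ * m i + δ * m i) :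
    Tendsto (fun i => I (m i) / m i) atTop (𝓝 κ) := by
  rw [Metric.tendsto_nhds]
  intro ε hε
  set δ := min 1 (ε / 4) with hδ
  have hδ0 : 0 < δ := lt_min one_pos (by linarith)
  have hδε : δ ≤ ε / 4 := min_le_right _ _
  obtain ⟨b, hb⟩ := ((tendsto_order.1 hr).1 (κ - ε / 4) (by linarith)).exists
  have hmR : Tendsto (fun i => (m i : ℝ)) atTop atTop := tendsto_natCast_atTop_atTop.comp hm
  filter_upwards [h b δ hδ0 (min_le_left _ _), hmR.eventually_gt_atTop 0,
    (hmR.const_div_atTop (r b * b)).eventually (gt_mem_nhds (show 0 < ε / 4 by linarith))]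
    with i hi hmi hbi
  rw [Real.dist_eq, abs_lt]
  have h1 : I (m i) / m i ≤ κ + δ := by
    rw [div_le_iff₀ hmi]
    linarith [hi.2]
  have h2 : r b - r b * b / m i - δ ≤ I (m i) / m i := by
    rw [le_div_iff₀ hmi]
    have : (r b - r b * b / m i - δ) * m i = r b * (m i - b) - δ * m i := by
      field_simp
    rw [this]
    exact hi.1
  constructor <;> linarith

lemma tendsto_div_of_tendsto_natCast_div {I : ℝ → ℝ} {κ : ℝ} (hI : MonotoneOn I (Ici 0))
    (h : Tendsto (fun n : ℕ => I n / n) atTop (𝓝 κ)) :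
    Tendsto (fun d => I d / d) atTop (𝓝 κ) := by
  have h1 : Tendsto (fun d : ℝ => I ⌊d⌋₊ / ⌊d⌋₊ * (⌊d⌋₊ / d)) atTop (𝓝 κ) := by
    simpa using (h.comp tendsto_nat_floor_atTop).mul (tendsto_nat_floor_div_atTop (R := ℝ))
  have h2 : Tendsto (fun d : ℝ => I ⌈d⌉₊ / ⌈d⌉₊ * (⌈d⌉₊ / d)) atTop (𝓝 κ) := by
    simpa using (h.comp tendsto_nat_ceil_atTop).mul (tendsto_nat_ceil_div_atTop (R := ℝ))
  refine tendsto_of_tendsto_of_tendsto_of_le_of_le' h1 h2 ?_ ?_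
  · filter_upwards [eventually_ge_atTop (1 : ℝ)] with d hd
    have hfl : (0 : ℝ) < ⌊d⌋₊ := by exact_mod_cast Nat.floor_pos.2 hd
    rw [div_mul_div_cancel₀ hfl.ne']
    gcongr
    exact hI hfl.le (mem_Ici.2 (by linarith)) (Nat.floor_le (by linarith))
  · filter_upwards [eventually_ge_atTop (1 : ℝ)] with d hd
    have hd0 : 0 < d := by linarith
    have hcl : (0 : ℝ) < ⌈d⌉₊ := by exact_mod_cast Nat.ceil_pos.2 hd0
    rw [div_mul_div_cancel₀ hcl.ne']
    gcongr
    exact hI hd0.le hcl.le (Nat.le_ceil d)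

end Limits

/-! ### The passage time of the car -/

section PassageTime

/-- A passage time is, up to the time of motion, a clock that is moved by the obstacles. -/
lemma isPassageTime_iff (v x₀ t₀ : ℝ) (q : ℕ → Obstacle) (T : ℝ → ℝ) :
    IsPassageTime v x₀ t₀ (fun j => (q j).1.1.1) (fun j => (q j).1.1.2) (fun j => (q j).1.2)
      (fun j => (q j).2) T ↔
    ∀ d, IsClock t₀ (fun j => position x₀ (q j)) (fun j u => jump v x₀ (q j, u)) d
      (fun s => t₀ + T s - s / v) := by
  have hset : ∀ d, {j | (q j).1.1.1 ∈ Ico x₀ (x₀ + d)} = {j | position x₀ (q j) ∈ Ico 0 d} := by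
    intro d
    ext j
    simp only [position, mem_Ico, Set.mem_ofPred_eq, sub_nonneg, sub_lt_iff_lt_add']
  have hval : ∀ d, t₀ + T d - d / v - t₀ = T d - d / v := fun d => by ring
  simp only [IsPassageTime, IsClock, hset, hval, jump, sub_add_cancel]
  exact ⟨fun h d s hs => h s hs.1, fun h d hd => h d d ⟨hd, le_rfl⟩⟩

/-- A car with clock u reaches position y at u + y / v, hence before the obstacle appears when u < t
- y / v. Bounds on y and on t - y / v confine position and time, and so the level. -/
lemma jumpFamily_of_finite_level {v : ℝ} (hv : 0 < v) (x₀ : ℝ) {q : ℕ → Obstacle}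
    (hinj : Function.Injective fun j => position x₀ (q j))
    (hfin : ∀ i, {j | level (q j).1.1 = i}.Finite) :
    JumpFamily (fun j => position x₀ (q j)) (fun j => (q j).1.1.2 - position x₀ (q j) / v)
      (fun j u => jump v x₀ (q j, u)) where
  injective := hinj
  nonneg _ _ := delay_nonneg _ _ _ _
  eq_zero j u hu := if_neg fun hc =>
    absurd hc.1 (by simpa [sub_lt_iff_lt_add] using not_le.2 (by linarith))
  finite d N := by
    obtain ⟨i, hi⟩ := exists_nat_ge (max (|x₀| + d) (N + d / v))
    refine ((Set.finite_Iic i).biUnion fun i' _ => hfin i').subset fun j hj => ?_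
    obtain ⟨⟨h1, h2⟩, h3⟩ := hj
    refine mem_biUnion (show level (q j).1.1 ∈ Iic i from level_le_iff.2 ⟨?_, ?_⟩) rfl
    · have h1' : 0 ≤ (q j).1.1.1 - x₀ := h1
      have h2' : (q j).1.1.1 - x₀ < d := h2
      refine le_trans ?_ ((le_max_left _ _).trans hi)
      have := abs_add_le ((q j).1.1.1 - x₀) x₀
      rw [sub_add_cancel, abs_of_nonneg h1'] at this
      linarith
    · refine le_trans ?_ ((le_max_right _ _).trans hi)
      have : position x₀ (q j) / v ≤ d / v := by gcongr
      linarith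

variable {Ω : Type*} [MeasurableSpace Ω] {P : Measure Ω} [IsProbabilityMeasure P]
  {lam v : ℝ} {Q : Measure ℝ} [IsProbabilityMeasure Q] {F : Measure ℝ≥0∞}
  [IsProbabilityMeasure F] {p : ℕ → Ω → Obstacle}

/-- Existence, uniqueness and asymptotics of the passage time in a simple field of obstacles. -/
theorem ae_exists_passageTime (x₀ : ℝ) {t₀ : ℝ}
    (h : SimpleField P (position x₀) (fun e => level e.1.1) (obstacleIntensity lam Q F) p)
    (hlam : 0 < lam) (hv : 0 < v) (ht₀ : 0 ≤ t₀) (hQ_second : Integrable (fun t : ℝ => t ^ 2) Q)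
    (hQ_pos : 0 < mean Q) :
    ∀ᵐ ω ∂P, ∃ T : ℝ → ℝ,
      IsPassageTime v x₀ t₀ (fun j => (p j ω).1.1.1) (fun j => (p j ω).1.1.2)
        (fun j => (p j ω).1.2) (fun j => (p j ω).2) T ∧
      (∀ T' : ℝ → ℝ,
        IsPassageTime v x₀ t₀ (fun j => (p j ω).1.1.1) (fun j => (p j ω).1.1.2)
          (fun j => (p j ω).1.2) (fun j => (p j ω).2) T' → EqOn T' T (Ici 0)) ∧
      Tendsto (fun d : ℝ => d / T d) atTop
        (𝓝 (v / (1 + meanDelay Q F * (lam * mean Q) * v))) := by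
  have hw := lintegral_wait_ne_top Q F hQ_second
  have hr : rate lam Q F ≠ ∞ := ENNReal.mul_ne_top ENNReal.ofReal_ne_top hw
  set κ := (rate lam Q F).toReal with hκ
  have hκ' : meanDelay Q F * (lam * mean Q) = κ := by
    rw [hκ, rate, ENNReal.toReal_mul, ENNReal.toReal_ofReal hlam.le,
      ← ofReal_meanDelay Q F hQ_pos]
    ring
  have hκ0 : 0 ≤ κ := ENNReal.toReal_nonneg
  -- Ratios decreasing to 1: interpolation by monotonicity between consecutive ⌊c ^ i⌋ loses a
  -- factor of about c.
  let c : ℕ → ℝ := fun k => 1 + 1 / ((k : ℝ) + 1)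
  have hc : ∀ k, 1 < c k := fun k => by
    have : 0 < 1 / ((k : ℝ) + 1) := by positivity
    change 1 < 1 + 1 / ((k : ℝ) + 1)
    linarith
  have hclim : Tendsto c atTop (𝓝 1) := by
    simpa [c] using tendsto_one_div_add_atTop_nhds_zero_nat.const_add (1 : ℝ)
  filter_upwards [ae_jumpSum_bounded (v := v) (t₀ := t₀) h hw,
    ae_all_iff.2 fun k => ae_tendsto_deviation (v := v) (t₀ := t₀) h hw (hc k)] with ω hbdd hdev
  have hJ := jumpFamily_of_finite_level hv x₀ (h.injective ω) (h.finite_level ω)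
  obtain ⟨W, hW, hφ⟩ := hJ.exists_clock (u₀ := t₀) hbdd
  let T : ℝ → ℝ := fun s => W s - t₀ + s / v
  have hTW : (fun s => t₀ + T s - s / v) = W := by
    funext s
    simp only [T]
    ring
  refine ⟨T, (isPassageTime_iff v x₀ t₀ (fun j => p j ω) T).2 (hTW ▸ hW), ?_, ?_⟩
  · intro T' hT' s hs
    have h1 := hJ.isClock_unique ((isPassageTime_iff v x₀ t₀ (fun j => p j ω) T').1 hT' s) (hW s)
      ⟨hs, le_rfl⟩
    simp only [T] at h1 ⊢
    linarith
  · have hmono : MonotoneOn (fun s => W s - t₀) (Ici 0) := by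
      intro s hs s' _ hss
      have := hJ.isClock_mono (hW s') hs hss le_rfl
      simpa using this
    have hrate : Tendsto (fun b => (truncRate lam v Q F b).toReal) atTop (𝓝 κ) :=
      (ENNReal.tendsto_toReal hr).comp (tendsto_truncRate lam hv Q F)
    have hpow : ∀ k, Tendsto (fun i : ℕ => ⌊c k ^ i⌋₊) atTop atTop := fun k =>
      tendsto_nat_floor_atTop.comp (tendsto_pow_atTop_atTop_of_one_lt (hc k))
    have hgeo : ∀ k, Tendsto (fun i : ℕ => (W ⌊c k ^ i⌋₊ - t₀) / ⌊c k ^ i⌋₊) atTop (𝓝 κ) := by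
      intro k
      refine tendsto_div_of_eventually_bounds (I := fun n : ℕ => W n - t₀) hrate (hpow k)
        fun b δ hδ hδ1 => ?_
      filter_upwards [(hpow k).eventually_ge_atTop b, (hpow k).eventually_gt_atTop 0,
        (hdev k).eventually (gt_mem_nhds (ENNReal.ofReal_pos.2 (pow_pos hδ 2)))] with i h1 h2 h3
      exact idle_bounds hr hv ht₀ hJ hW hφ h1 h2.ne' hδ hδ1 h3
    have hnat : Tendsto (fun n : ℕ => (W n - t₀) / n) atTop (𝓝 κ) :=
      tendsto_div_of_monotone_of_tendsto_div_floor_pow (fun n : ℕ => W n - t₀) κ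
        (fun n n' hn => hmono (mem_Ici.2 n.cast_nonneg) (mem_Ici.2 n'.cast_nonneg)
          (by exact_mod_cast hn)) c hc hclim hgeo
    have hreal := tendsto_div_of_tendsto_natCast_div hmono hnat
    rw [hκ']
    have hne : κ + 1 / v ≠ 0 := by positivity
    have hlim : Tendsto (fun d : ℝ => ((W d - t₀) / d + 1 / v)⁻¹) atTop (𝓝 (κ + 1 / v)⁻¹) :=
      (hreal.add_const _).inv₀ hne
    have heq : (κ + 1 / v)⁻¹ = v / (1 + κ * v) := by
      have : 1 + κ * v ≠ 0 := by positivity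
      field_simp
      ring
    rw [← heq]
    refine hlim.congr' ?_
    filter_upwards [eventually_gt_atTop (0 : ℝ)] with d hd
    have : (W d - t₀) / d + 1 / v = T d / d := by
      simp only [T]
      field_simp
    rw [this, inv_div]

end PassageTime

lemma SimpleField.shift {Ω E : Type*} [MeasurableSpace Ω] [MeasurableSpace E] {P : Measure Ω}
    {X : E → ℝ} {lev : E → ℕ} {μ : Measure E} {p : ℕ → Ω → E} (h : SimpleField P X lev μ p)
    (c : ℝ) : SimpleField P (fun e => X e - c) lev μ p where
  measurable := h.measurable
  measurable_pos := h.measurable_pos.sub_const c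
  measurable_level := h.measurable_level
  injective ω := (sub_left_injective (b := c)).comp (h.injective ω)
  finite_level := h.finite_level
  void_indep I I' hI hI' hd B B' hB hB' hBI hBI' :=
    h.void_indep ((fun s => s - c) ⁻¹' I) ((fun s => s - c) ⁻¹' I')
      (hI.preimage (measurable_id.sub_const c)) (hI'.preimage (measurable_id.sub_const c))
      (hd.preimage _) B B' hB hB' hBI hBI'
  intensity := h.intensity

end RoadObstacles

/-! ### The theorem -/

theorem mainTheorem1
    {Ω : Type*} [MeasurableSpace Ω] (P : Measure Ω) [IsProbabilityMeasure P]
    (lam v : ℝ) (hlam : 0 < lam) (hv : 0 < v)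
    -- the law of the lifetimes, with finite second moment, and the law of the bypass times
    (Q : Measure ℝ) [IsProbabilityMeasure Q] (hQ_nonneg : ∀ᵐ t ∂Q, 0 ≤ t)
    (hQ_first : Integrable (fun t : ℝ => t) Q) (hQ_second : Integrable (fun t : ℝ => t ^ 2) Q)
    (hQ_pos : 0 < RoadObstacles.mean Q)
    (F : Measure ℝ≥0∞) [IsProbabilityMeasure F]
    -- coordinates, moments of appearance, lifetimes and bypass times of the obstacles
    (x t τ : ℕ → Ω → ℝ) (η : ℕ → Ω → ℝ≥0∞)
    (h_field : RoadObstacles.IsPoissonField P (RoadObstacles.spaceTimeIntensity lam)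
      (fun j ω => (x j ω, t j ω)))
    (hτ_law : ∀ j, HasLaw (τ j) Q P) (hτ_indep : iIndepFun τ P)
    (hη_law : ∀ j, HasLaw (η j) F P) (hη_indep : iIndepFun η P)
    -- the field, the lifetimes and the bypass times are independent of each other
    (h_indep_τ : IndepFun (fun ω j => (x j ω, t j ω)) (fun ω j => τ j ω) P)
    (h_indep_η : IndepFun (fun ω j => ((x j ω, t j ω), τ j ω)) (fun ω j => η j ω) P)
    -- place and moment of the entrance of the car
    (x₀ t₀ : ℝ) (ht₀ : 0 ≤ t₀) :
    ∀ᵐ ω ∂P, ∃ T : ℝ → ℝ,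
      RoadObstacles.IsPassageTime v x₀ t₀
        (fun j => x j ω) (fun j => t j ω) (fun j => τ j ω) (fun j => η j ω) T ∧
      (∀ T' : ℝ → ℝ,
        RoadObstacles.IsPassageTime v x₀ t₀
          (fun j => x j ω) (fun j => t j ω) (fun j => τ j ω) (fun j => η j ω) T' →
        EqOn T' T (Ici 0)) ∧
      Tendsto (fun d : ℝ => d / T d) atTop
        (𝓝 (v / (1 + RoadObstacles.meanDelay Q F * (lam * RoadObstacles.mean Q) * v))) := by
  obtain ⟨Z, hZ, hZae⟩ := h_field.exists_simpleField
  -- `HasLaw` provides almost everywhere measurability only; the marking argument is applied to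
  -- measurable versions.
  let τ' : ℕ → Ω → ℝ := fun j => (hτ_law j).aemeasurable.mk (τ j)
  let η' : ℕ → Ω → ℝ≥0∞ := fun j => (hη_law j).aemeasurable.mk (η j)
  have hτ' : ∀ j, τ j =ᵐ[P] τ' j := fun j => (hτ_law j).aemeasurable.ae_eq_mk
  have hη' : ∀ j, η j =ᵐ[P] η' j := fun j => (hη_law j).aemeasurable.ae_eq_mk
  have hτae : ∀ᵐ ω ∂P, ∀ j, τ j ω = τ' j ω := ae_all_iff.2 hτ'
  have hηae : ∀ᵐ ω ∂P, ∀ j, η j ω = η' j ω := ae_all_iff.2 hη'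
  have hZτ : IndepFun (fun ω j => Z j ω) (fun ω j => τ' j ω) P := by
    refine h_indep_τ.congr ?_ ?_
    · filter_upwards [hZae] with ω hω
      exact funext fun j => (hω j).symm
    · filter_upwards [hτae] with ω hω
      exact funext hω
  have hZη : IndepFun (fun ω j => (Z j ω, τ' j ω)) (fun ω j => η' j ω) P := by
    refine h_indep_η.congr ?_ ?_
    · filter_upwards [hZae, hτae] with ω hω hω'
      exact funext fun j => by rw [hω j, hω' j]
    · filter_upwards [hηae] with ω hω
      exact funext hω
  -- Marking is applied twice, with the lifetimes and then with the bypass times; afterwards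
  -- positions are measured from `x₀`.
  have h1 := hZ.marked (fun j => (hτ_law j).congr (hτ' j).symm)
    (fun j => (hτ_law j).aemeasurable.measurable_mk) (hτ_indep.congr hτ') hZτ
  have h2 := (h1.marked (fun j => (hη_law j).congr (hη' j).symm)
    (fun j => (hη_law j).aemeasurable.measurable_mk) (hη_indep.congr hη') hZη).shift x₀
  filter_upwards [RoadObstacles.ae_exists_passageTime x₀ h2 hlam hv ht₀ hQ_second hQ_pos,
    hZae, hτae, hηae] with ω hω hZω hτω hηω
  simpa only [hZω, ← hτω, ← hηω] using hω
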